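/- Consider the dispersionless Nizhnik equation $$u_{txy}=(u_{xx}u_{xy})_x+(u_{xy}u_{yy})_y \qquad(1)$$ for a real function $u$ of $(t,x,y)$. For an open interval $I\subseteq\mathbb R$ let $\mathfrak g=\mathfrak g(I)$ be its Lie invariance algebra over $I$, that is, the span of the vector fields $$D^t(\tau)=\tau\partial_t+\tfrac13\tau_tx\partial_x+\tfrac13\tau_ty\partial_y-\tfrac1{18}\tau_{tt}(x^3+y^3)\partial_u,\qquad D^{\rm s}=x\partial_x+y\partial_y+3u\partial_u,$$ $$P^x(\chi)=\chi\partial_x-\tfrac12\chi_tx^2\partial_u,\quad P^y(\rho)=\rho\partial_y-\tfrac12\rho_ty^2\partial_u,\quad R^x(\alpha)=\alpha x\partial_u,\quad R^y(\beta)=\beta y\partial_u,\quad Z(\sigma)=\sigma\partial_u,$$ where $\tau,\chi,\rho,\alpha,\beta,\sigma$ run through the smooth functions of $t\in I$. Let $G$ be the point-symmetry pseudogroup of (1); it is generated by the transformation $\mathscr J\colon(t,x,y,u)\mapsto(t,y,x,u)$ and the transformations $$\tilde t=T,\quad \tilde x=CT_t^{1/3}x+X,\quad \tilde y=CT_t^{1/3}y+Y,$$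 $$\tilde u=C^3u-\frac{C^3T_{tt}}{18T_t}(x^3+y^3)-\frac{C^2}{2T_t^{1/3}}(X_tx^2+Y_ty^2)+W^1x+W^2y+W^0,$$ where $C$ is a nonzero constant and $T,X,Y,W^0,W^1,W^2$ are smooth functions of $t$ on an open interval $J$ with $T_t\ne0$ on $J$ (real cube roots). An element of $G$ thus maps the points with $t\in J$ onto the points with $\tilde t\in\tilde J$ for some open intervals $J$ and $\tilde J$, and $G$-equivalence is understood locally in $t$ in this sense. The rank $\operatorname{rank}_p\mathfrak s$ of a subalgebra $\mathfrak s\subseteq\mathfrak g$ at a point $p=(t,x,y,u)$ is the rank of the matrix of the $(\partial_t,\partial_x,\partial_y)$-components at $p$ of the vector fields of $\mathfrak s$; the rank of $\mathfrak s$ is the maximum of $\operatorname{rank}_p\mathfrak s$ over all $p$ with $t\in I$. A reduction of (1) to an algebraic equation needs a three-dimensional subalgebra of rank three. **Claim.** Let $\mathfrak s$ be a three-dimensional Lie subalgebra of $\mathfrak g(I)$. Then either the rank of $\mathfrak s$ is less than three, or it is equal to three and the following holds. (i) For every point $p=(t_0,x_0,y_0,u_0)$ with $t_0\in I$ and $\operatorname{rank}_p\mathfrak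 s=3$ there are open intervals $J$ with $t_0\in J\subseteq I$ and $\tilde J$ and an element $\Phi$ of $G$ from $\{t\in J\}$ to $\{\tilde t\in\tilde J\}$ such that $\Phi_*(\mathfrak s|_J)$ contains one of the following subalgebras over $\tilde J$: * $\mathfrak s_{2.14}^{0\nu\delta'}=\langle D^t(1),\,P^x(1)+\nu P^y(1)+\delta'R^y(1)\rangle$ with $\nu\in[-1,1]$, $\delta'\in\{0,1\}$; * $\mathfrak s_{2.9}^{\rho}=\langle D^{\rm s},\,P^x(1)+P^y(\rho)\rangle$ with a smooth function $\rho$ of $t$; * $\mathfrak s_{2.17}^{\rho\beta}=\langle P^x(1)+R^y(\beta),\,P^y(\rho)+R^x(\rho\beta)\rangle$ with smooth functions $\rho,\beta$ of $t$, $\rho$ nonvanishing, and therefore also $\mathfrak s_{1.4}^\beta=\langle P^x(1)+R^y(\beta)\rangle$. (ii) Lie reductions with respect to $\mathfrak s$ give no new solutions up to $G$-equivalence. Namely, let $n\in\{3,4,\dots,\infty\}$ and let $u$ be an $\mathfrak s$-invariant solution of (1) (all vector fields of $\mathfrak s$ are tangent to the graph of $u$) of class $C^n$ on an open set $U$ of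 points $(t,x,y)$ with $t\in I$. Then every point $q\in U$ with $\operatorname{rank}_{(q,u(q))}\mathfrak s=3$ has an open neighborhood $V\subseteq U$ such that some element of $G$ maps $u|_V$ to a function of one of the following forms (in the new variables, again denoted by $t,x,y,u$): * $u=w(t,y)$ with $w$ of class $C^n$; * $u=\dfrac{\beta_t}{6\beta}y^3+\beta xy$ with a nonvanishing smooth function $\beta$ of $t$; * $u=f(y-x)$ with $f$ of class $C^n$; * $u=\dfrac{(y-\rho x)^3}{12\rho^3H}-\dfrac{\rho_t}{6\rho}y^3$ with a smooth function $\rho$ of $t$ taking neither of the values $0$ and $1$ and a nonvanishing antiderivative $H$ of $(\rho^3-1)/\rho^3$. -/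

import Mathlib

open scoped ContDiff

namespace DN

/-! ### The space of variables and the Lie invariance algebra -/

/-- The space with the coordinates `(t, x, y, u)`. -/
abbrev Space := ℝ × ℝ × ℝ × ℝ

/-- The space of the independent variables `(t, x, y)`. -/
abbrev Base := ℝ × ℝ × ℝ

/-- The projection `(t, x, y, u) ↦ (t, x, y)`. -/
def base : Space →ₗ[ℝ] Base where
  toFun p := (p.1, p.2.1, p.2.2.1)
  map_add' _ _ := rfl
  map_smul' _ _ := rfl

/-- The part of the space `(t, x, y, u)` that lies over a set `I` of values of `t`. -/
def strip (I : Set ℝ) : Set Space := {p | p.1 ∈ I}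

/-- `D^t(τ) = τ ∂_t + (1/3) τ_t x ∂_x + (1/3) τ_t y ∂_y - (1/18) τ_tt (x³ + y³) ∂_u`. -/
noncomputable def Dt (τ : ℝ → ℝ) : Space → Space := fun p =>
  (τ p.1, 1 / 3 * deriv τ p.1 * p.2.1, 1 / 3 * deriv τ p.1 * p.2.2.1,
    -(1 / 18) * deriv (deriv τ) p.1 * (p.2.1 ^ 3 + p.2.2.1 ^ 3))

/-- `D^s = x ∂_x + y ∂_y + 3 u ∂_u`. -/
def Ds : Space → Space := fun p => (0, p.2.1, p.2.2.1, 3 * p.2.2.2)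

/-- `P^x(χ) = χ ∂_x - (1/2) χ_t x² ∂_u`. -/
noncomputable def Px (χ : ℝ → ℝ) : Space → Space := fun p =>
  (0, χ p.1, 0, -(1 / 2) * deriv χ p.1 * p.2.1 ^ 2)

/-- `P^y(ρ) = ρ ∂_y - (1/2) ρ_t y² ∂_u`. -/
noncomputable def Py (ρ : ℝ → ℝ) : Space → Space := fun p =>
  (0, 0, ρ p.1, -(1 / 2) * deriv ρ p.1 * p.2.2.1 ^ 2)

/-- `R^x(α) = α x ∂_u`. -/
def Rx (α : ℝ → ℝ) : Space → Space := fun p => (0, 0, 0, α p.1 * p.2.1)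

/-- `R^y(β) = β y ∂_u`. -/
def Ry (β : ℝ → ℝ) : Space → Space := fun p => (0, 0, 0, β p.1 * p.2.2.1)

/-- `Z(σ) = σ ∂_u`. -/
def Zu (σ : ℝ → ℝ) : Space → Space := fun p => (0, 0, 0, σ p.1)

/-- A vector field on `strip I` is represented by the map `Space → Space` that equals it on
`strip I` and is zero elsewhere; `onStrip I V` represents the restriction of `V` to `strip I`. -/
noncomputable def onStrip (I : Set ℝ) (V : Space → Space) : Space → Space :=
  (strip I).indicator V

/-- The Lie invariance algebra of the dispersionless Nizhnik equation over the interval `I`: the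
span of the vector fields above, with parameter functions that are smooth on `I`. -/
noncomputable def algebra (I : Set ℝ) : Submodule ℝ (Space → Space) :=
  Submodule.span ℝ
    ({V | ∃ τ : ℝ → ℝ, ContDiffOn ℝ ∞ τ I ∧ V = onStrip I (Dt τ)} ∪
      {onStrip I Ds} ∪
      {V | ∃ χ : ℝ → ℝ, ContDiffOn ℝ ∞ χ I ∧ V = onStrip I (Px χ)} ∪
      {V | ∃ ρ : ℝ → ℝ, ContDiffOn ℝ ∞ ρ I ∧ V = onStrip I (Py ρ)} ∪
      {V | ∃ α : ℝ → ℝ, ContDiffOn ℝ ∞ α I ∧ V = onStrip I (Rx α)} ∪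
      {V | ∃ β : ℝ → ℝ, ContDiffOn ℝ ∞ β I ∧ V = onStrip I (Ry β)} ∪
      {V | ∃ σ : ℝ → ℝ, ContDiffOn ℝ ∞ σ I ∧ V = onStrip I (Zu σ)})

/-- `𝔰` is a Lie subalgebra of `algebra I` with respect to the Lie bracket of vector fields. -/
def IsSubalgebra (I : Set ℝ) (𝔰 : Submodule ℝ (Space → Space)) : Prop :=
  𝔰 ≤ algebra I ∧ ∀ V ∈ 𝔰, ∀ W ∈ 𝔰, VectorField.lieBracket ℝ V W ∈ 𝔰

/-- The rank, at the point `p`, of the matrix formed by the components of (basis) vector fields of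
`𝔰` that correspond to the independent variables `t`, `x`, `y`. -/
noncomputable def rankAt (𝔰 : Submodule ℝ (Space → Space)) (p : Space) : ℕ :=
  Module.finrank ℝ (𝔰.map (base ∘ₗ (LinearMap.proj p : (Space → Space) →ₗ[ℝ] Space)))

theorem rankAt_le_three (𝔰 : Submodule ℝ (Space → Space)) (p : Space) : rankAt 𝔰 p ≤ 3 :=
  (Submodule.finrank_le _).trans (by simp)

/-- The rank of a subalgebra over `I`: the maximum of its ranks at the points over `I`. -/
noncomputable def rank (I : Set ℝ) (𝔰 : Submodule ℝ (Space → Space)) : ℕ :=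
  sSup (rankAt 𝔰 '' strip I)

/-! ### The point-symmetry pseudogroup -/

/-- The real cube root. -/
noncomputable def cbrt (s : ℝ) : ℝ := Real.sign s * |s| ^ (1 / 3 : ℝ)

/-- The point transformation
`t̃ = T`, `x̃ = C T_t^{1/3} x + X`, `ỹ = C T_t^{1/3} y + Y`,
`ũ = C³ u - C³ T_tt / (18 T_t) (x³ + y³) - C² / (2 T_t^{1/3}) (X_t x² + Y_t y²)
  + W₁ x + W₂ y + W₀`. -/
noncomputable def pointTransf (C : ℝ) (T X Y W₀ W₁ W₂ : ℝ → ℝ) : Space → Space := fun p =>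
  (T p.1, C * cbrt (deriv T p.1) * p.2.1 + X p.1, C * cbrt (deriv T p.1) * p.2.2.1 + Y p.1,
    C ^ 3 * p.2.2.2 - C ^ 3 * deriv (deriv T) p.1 / (18 * deriv T p.1) * (p.2.1 ^ 3 + p.2.2.1 ^ 3)
      - C ^ 2 / (2 * cbrt (deriv T p.1)) * (deriv X p.1 * p.2.1 ^ 2 + deriv Y p.1 * p.2.2.1 ^ 2)
      + W₁ p.1 * p.2.1 + W₂ p.1 * p.2.2.1 + W₀ p.1)

/-- The permutation of `x` and `y`. -/
def swapXY : Space → Space := fun p => (p.1, p.2.2.1, p.2.1, p.2.2.2)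

/-- `PointSym J J' Φ`: the map `Φ`, considered on `strip J` and with the image `strip J'`, is an
element of the pseudogroup `G` generated by the transformations `pointTransf` and `swapXY`;
here `J` and `J'` are open intervals. -/
inductive PointSym : Set ℝ → Set ℝ → (Space → Space) → Prop
  | transf (J : Set ℝ) (hJ : IsOpen J) (hJ' : J.OrdConnected) (C : ℝ) (hC : C ≠ 0)
      (T X Y W₀ W₁ W₂ : ℝ → ℝ) (hT : ContDiffOn ℝ ∞ T J) (hT' : ∀ t ∈ J, deriv T t ≠ 0)
      (hX : ContDiffOn ℝ ∞ X J) (hY : ContDiffOn ℝ ∞ Y J) (hW₀ : ContDiffOn ℝ ∞ W₀ J)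
      (hW₁ : ContDiffOn ℝ ∞ W₁ J) (hW₂ : ContDiffOn ℝ ∞ W₂ J) :
      PointSym J (T '' J) (pointTransf C T X Y W₀ W₁ W₂)
  | swap (J : Set ℝ) (hJ : IsOpen J) (hJ' : J.OrdConnected) : PointSym J J swapXY
  | comp (J J' J'' : Set ℝ) (Φ Ψ : Space → Space) (hΦ : PointSym J J' Φ)
      (hΨ : PointSym J' J'' Ψ) : PointSym J J'' (Ψ ∘ Φ)

/-- The pushforward by `Φ` of the restriction of `𝔰` to `strip J` contains `𝔯`: each `W` in `𝔯`
is the pushforward of some `V` in `𝔰`. -/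
def PushforwardContains (J : Set ℝ) (Φ : Space → Space)
    (𝔰 𝔯 : Submodule ℝ (Space → Space)) : Prop :=
  ∀ W ∈ 𝔯, ∃ V ∈ 𝔰, ∀ p ∈ strip J, W (Φ p) = fderiv ℝ Φ p (V p)

/-! ### The families of subalgebras -/

/-- `𝔰_{1.4}^β = ⟨P^x(1) + R^y(β)⟩`. -/
noncomputable def s14 (J : Set ℝ) (β : ℝ → ℝ) : Submodule ℝ (Space → Space) :=
  Submodule.span ℝ {onStrip J (Px (fun _ => 1) + Ry β)}

/-- `𝔰_{2.9}^ρ = ⟨D^s, P^x(1) + P^y(ρ)⟩`. -/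
noncomputable def s29 (J : Set ℝ) (ρ : ℝ → ℝ) : Submodule ℝ (Space → Space) :=
  Submodule.span ℝ {onStrip J Ds, onStrip J (Px (fun _ => 1) + Py ρ)}

/-- `𝔰_{2.14}^{0νδ'} = ⟨D^t(1), P^x(1) + ν P^y(1) + δ' R^y(1)⟩`. -/
noncomputable def s214 (J : Set ℝ) (ν δ' : ℝ) : Submodule ℝ (Space → Space) :=
  Submodule.span ℝ {onStrip J (Dt (fun _ => 1)),
    onStrip J (Px (fun _ => 1) + ν • Py (fun _ => 1) + δ' • Ry (fun _ => 1))}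

/-- `𝔰_{2.17}^{ρβ} = ⟨P^x(1) + R^y(β), P^y(ρ) + R^x(ρβ)⟩`. -/
noncomputable def s217 (J : Set ℝ) (ρ β : ℝ → ℝ) : Submodule ℝ (Space → Space) :=
  Submodule.span ℝ {onStrip J (Px (fun _ => 1) + Ry β),
    onStrip J (Py ρ + Rx (fun t => ρ t * β t))}

/-- Over `strip J`, the subalgebra `𝔰` is mapped by `Φ` (with target over `J'`) to an algebra that
contains a subalgebra from one of the families `𝔰_{2.14}^{0νδ'}`, `𝔰_{2.9}^ρ` and
`𝔰_{2.17}^{ρβ}`, and thus also `𝔰_{1.4}^β` in the last case. -/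
def ContainsTreated (J J' : Set ℝ) (Φ : Space → Space) (𝔰 : Submodule ℝ (Space → Space)) :
    Prop :=
  (∃ ν ∈ Set.Icc (-1 : ℝ) 1, ∃ δ' ∈ ({0, 1} : Set ℝ),
    PushforwardContains J Φ 𝔰 (s214 J' ν δ')) ∨
  (∃ ρ : ℝ → ℝ, ContDiffOn ℝ ∞ ρ J' ∧ PushforwardContains J Φ 𝔰 (s29 J' ρ)) ∨
  (∃ ρ β : ℝ → ℝ, ContDiffOn ℝ ∞ ρ J' ∧ ContDiffOn ℝ ∞ β J' ∧ (∀ t ∈ J', ρ t ≠ 0) ∧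
    PushforwardContains J Φ 𝔰 (s217 J' ρ β) ∧ PushforwardContains J Φ 𝔰 (s14 J' β))

/-! ### Solutions of the dispersionless Nizhnik equation -/

/-- The partial derivative with respect to `t`. -/
noncomputable def dt (f : Base → ℝ) : Base → ℝ := fun q => fderiv ℝ f q (1, 0, 0)

/-- The partial derivative with respect to `x`. -/
noncomputable def dx (f : Base → ℝ) : Base → ℝ := fun q => fderiv ℝ f q (0, 1, 0)

/-- The partial derivative with respect to `y`. -/
noncomputable def dy (f : Base → ℝ) : Base → ℝ := fun q => fderiv ℝ f q (0, 0, 1)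

/-- The equation `u_txy = (u_xx u_xy)_x + (u_xy u_yy)_y` on `U`. -/
def IsSolution (U : Set Base) (u : Base → ℝ) : Prop :=
  ∀ q ∈ U, dy (dx (dt u)) q =
    dx (fun r => dx (dx u) r * dy (dx u) r) q + dy (fun r => dy (dx u) r * dy (dy u) r) q

/-- The point of the graph of `u` over `q`. -/
def graphPt (u : Base → ℝ) (q : Base) : Space := (q.1, q.2.1, q.2.2, u q)

/-- The function `u` on `U` is `𝔰`-invariant: each `V = V^t ∂_t + V^x ∂_x + V^y ∂_y + V^u ∂_u` in
`𝔰` is tangent to the graph of `u`. -/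
def IsInvariant (U : Set Base) (𝔰 : Submodule ℝ (Space → Space)) (u : Base → ℝ) : Prop :=
  ∀ V ∈ 𝔰, ∀ q ∈ U,
    (V (graphPt u q)).2.2.2 = (V (graphPt u q)).1 * dt u q +
      (V (graphPt u q)).2.1 * dx u q + (V (graphPt u q)).2.2.1 * dy u q

/-- The explicitly constructed families of solutions, considered on the set `U` of points `(t, x, y)`
with `t` in `J`:
`u = w(t, y)`;
`u = β_t / (6 β) y³ + β x y`;
`u = f(y - x)`;
`u = H⁻¹ (y - ρ x)³ / (12 ρ³) - ρ_t / (6 ρ) y³` with an antiderivative `H` of `(ρ³ - 1) / ρ³`. -/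
def IsKnownSolution (n : ℕ∞) (J : Set ℝ) (U : Set Base) (u : Base → ℝ) : Prop :=
  (∃ w : ℝ × ℝ → ℝ, ContDiffOn ℝ n w ((fun q : Base => (q.1, q.2.2)) '' U) ∧
    ∀ q ∈ U, u q = w (q.1, q.2.2)) ∨
  (∃ β : ℝ → ℝ, ContDiffOn ℝ ∞ β J ∧ (∀ t ∈ J, β t ≠ 0) ∧
    ∀ q ∈ U, u q = deriv β q.1 / (6 * β q.1) * q.2.2 ^ 3 + β q.1 * q.2.1 * q.2.2) ∨
  (∃ f : ℝ → ℝ, ContDiffOn ℝ n f ((fun q : Base => q.2.2 - q.2.1) '' U) ∧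
    ∀ q ∈ U, u q = f (q.2.2 - q.2.1)) ∨
  (∃ ρ H : ℝ → ℝ, ContDiffOn ℝ ∞ ρ J ∧ (∀ t ∈ J, ρ t ≠ 0 ∧ ρ t ≠ 1) ∧
    (∀ t ∈ J, HasDerivAt H ((ρ t ^ 3 - 1) / ρ t ^ 3) t ∧ H t ≠ 0) ∧
    ∀ q ∈ U, u q = (H q.1)⁻¹ * ((q.2.2 - ρ q.1 * q.2.1) ^ 3 / (12 * ρ q.1 ^ 3)) -
      deriv ρ q.1 / (6 * ρ q.1) * q.2.2 ^ 3)

/-- The transformation `Φ` maps the graph of `u` over `V` to the graph of `u'` over the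
corresponding set of points `(t̃, x̃, ỹ)`. -/
def MapsGraph (Φ : Space → Space) (V : Set Base) (u u' : Base → ℝ) : Prop :=
  ∀ q ∈ V, (Φ (graphPt u q)).2.2.2 = u' (base (Φ (graphPt u q)))

end DN

namespace DN

open Set Filter Topology

/-! ### Calculus on an open interval -/

section Calculus

variable {J : Set ℝ} {f g : ℝ → ℝ}

/-! At a point `p` of rank three, taking the `(t, x, y)`-components at `p` identifies the algebra
with `ℝ³` (`exists_frame`), so an identity between elements of the algebra can be checked at this
single point. The fields with `τ(t₀) = 0` form a plane carrying two linear functionals: `m`, the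
value `τ_t(t₀)`, and `l`, the coefficient of `D^s`. On this plane `[V, W] = (m_W/3 + l_W) V - (m_V/3
+ l_V) W` (`base_lieBracket`), and brackets always have `l = 0`. The case distinction `m = l = 0`,
`m = 0 ≠ l`, `m ≠ 0`, combined with the Jacobi identity and with uniqueness for linear ordinary
differential equations (which makes `τ` vanish near `t₀` and not only at `t₀`), gives the three
types of `trichotomy`. `exists_type` rewrites them as identities between parameter functions: type
A, two commuting translations `P^x(χ) + …`, `P^y(ρ) + …`, together with a field having `τ ≠ 0`; type
B, `D^s + …` and a translation `P^x(χ) + P^y(ρ) + …` with `ρ/χ` or `χ/ρ` constant; type C, a field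
`D^t(τ) + …` commuting with such a translation.

For the first claim one takes `T_t = χ⁻³`, which turns `P^x(χ)` into `P^x(1)` (`exists_transf`); the
functions `X`, `Y`, `W⁰`, `W¹`, `W²` absorb the remaining terms, and the commutation relations are
exactly what makes this possible. The images contain a member of `𝔰_{2.17}`, `𝔰_{2.9}` and
`𝔰_{2.14}` for the types A, B and C, respectively. The permutation of `x` and `y` covers the case
where `∂_y` is the component that can be normalized.

For the second claim the invariance conditions are integrated. In type A they prescribe `u_x` and
`u_y`, so `u` is a polynomial of degree three in `x`, `y`. In type B, up to equivalence, `u = ϑ(t)(y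
- νx)³`. In type C, up to equivalence, `u = F(y - νx) + M(xy - νx²/2)`. Substitution into the
equation gives, respectively, a linear equation for the coefficient of `xy`, the equation `ϑ_t =
12(1 - ν³)ϑ²`, and `(2ν(ν³ - 1)F'' + M(1 - 2ν³))F''' = 0`. The last one makes `F` quadratic unless
`M = 0` and `ν ∈ {0, 1}`, and then `u` is of the form `w(t, y)` or `f(y - x)`. Polynomial solutions
are handled by `LocallyKnown.of_polynomial`, the cubes by `LocallyKnown.of_cube` and the last form
by `LocallyKnown.of_wave`. -/

theorem smooth_deriv (hJ : IsOpen J) (hf : ContDiffOn ℝ ∞ f J) : ContDiffOn ℝ ∞ (deriv f) J :=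
  ((contDiffOn_infty_iff_deriv_of_isOpen hJ).1 hf).2

theorem smooth_hasDerivAt (hJ : IsOpen J) (hf : ContDiffOn ℝ ∞ f J) {t : ℝ} (ht : t ∈ J) :
    HasDerivAt f (deriv f t) t :=
  ((hf.contDiffAt (hJ.mem_nhds ht)).differentiableAt (by simp)).hasDerivAt

theorem smooth_of_hasDerivAt (hJ : IsOpen J) (hg : ContDiffOn ℝ ∞ g J)
    (h : ∀ t ∈ J, HasDerivAt f (g t) t) : ContDiffOn ℝ ∞ f J := by
  rw [contDiffOn_infty_iff_deriv_of_isOpen hJ]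
  exact ⟨fun t ht => (h t ht).differentiableAt.differentiableWithinAt,
    hg.congr fun t ht => (h t ht).deriv⟩

theorem exists_antideriv (hJ : IsOpen J) (hJ' : J.OrdConnected) (hf : ContDiffOn ℝ ∞ f J) :
    ∃ F : ℝ → ℝ, ContDiffOn ℝ ∞ F J ∧ ∀ t ∈ J, HasDerivAt F (f t) t := by
  rcases J.eq_empty_or_nonempty with rfl | ⟨t₀, ht₀⟩
  · exact ⟨0, by simp [ContDiffOn], by simp⟩
  have key : ∀ t ∈ J, HasDerivAt (fun t => ∫ s in t₀..t, f s) (f t) t := fun t ht =>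
    intervalIntegral.integral_hasDerivAt_right
      ((hf.continuousOn.mono (hJ'.uIcc_subset ht₀ ht)).intervalIntegrable)
      (hf.continuousOn.stronglyMeasurableAtFilter hJ t ht)
      (hf.continuousOn.continuousAt (hJ.mem_nhds ht))
  exact ⟨_, smooth_of_hasDerivAt hJ hf key, key⟩

theorem exists_linear_ode (hJ : IsOpen J) (hJ' : J.OrdConnected) (hf : ContDiffOn ℝ ∞ f J)
    (hg : ContDiffOn ℝ ∞ g J) :
    ∃ Y : ℝ → ℝ, ContDiffOn ℝ ∞ Y J ∧ ∀ t ∈ J, HasDerivAt Y (f t * Y t + g t) t := by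
  obtain ⟨F, hF, hF'⟩ := exists_antideriv hJ hJ' hf
  obtain ⟨K, hK, hK'⟩ := exists_antideriv hJ hJ' (hg.mul (Real.contDiff_exp.comp_contDiffOn hF.neg))
  refine ⟨fun t => Real.exp (F t) * K t, (Real.contDiff_exp.comp_contDiffOn hF).mul hK,
    fun t ht => ?_⟩
  refine ((hF' t ht).exp.mul (hK' t ht)).congr_deriv ?_
  have := Real.exp_add (F t) (-F t)
  simp only [add_neg_cancel, Real.exp_zero] at this
  simp only [Function.comp]
  linear_combination (-g t) * this

/-- Bootstrapping: if `v` is of class `C^k`, the right-hand side is too, so `v` is of class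
`C^{k+1}`. It makes certain restrictions of a solution of class `C^n` smooth in `t`. -/
theorem smooth_of_linear_ode (hJ : IsOpen J) {v : ℝ → ℝ} (hf : ContDiffOn ℝ ∞ f J)
    (hg : ContDiffOn ℝ ∞ g J) (h : ∀ t ∈ J, HasDerivAt v (f t * v t + g t) t) :
    ContDiffOn ℝ ∞ v J := by
  rw [contDiffOn_infty]
  intro n
  induction n with
  | zero =>
    exact contDiffOn_zero.2 fun t ht => (h t ht).continuousAt.continuousWithinAt
  | succ n ih =>
    push_cast
    rw [contDiffOn_succ_iff_deriv_of_isOpen hJ]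
    refine ⟨fun t ht => (h t ht).differentiableAt.differentiableWithinAt, by simp, ?_⟩
    exact (((hf.of_le (by exact_mod_cast le_top)).mul ih).add
      (hg.of_le (by exact_mod_cast le_top))).congr fun t ht => (h t ht).deriv

theorem eq_of_hasDerivAt_zero (hJ' : J.OrdConnected)
    (h : ∀ t ∈ J, HasDerivAt f 0 t) {s t : ℝ} (hs : s ∈ J) (ht : t ∈ J) : f s = f t := by
  have := hJ'.convex.norm_image_sub_le_of_norm_hasDerivWithin_le (C := 0)
    (fun r hr => (h r hr).hasDerivWithinAt) (by simp) hs ht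
  rw [zero_mul, norm_le_zero_iff, sub_eq_zero] at this
  exact this.symm

/-- A solution of a homogeneous linear system of two ordinary differential equations
that vanishes at a point vanishes near this point. -/
theorem eventually_zero_of_linear_system {t₀ : ℝ} {a b c d : ℝ → ℝ}
    (ha : ContinuousAt a t₀) (hb : ContinuousAt b t₀) (hc : ContinuousAt c t₀)
    (hd : ContinuousAt d t₀)
    (hf : ∀ᶠ t in 𝓝 t₀, HasDerivAt f (a t * f t + b t * g t) t)
    (hg : ∀ᶠ t in 𝓝 t₀, HasDerivAt g (c t * f t + d t * g t) t)
    (hf₀ : f t₀ = 0) (hg₀ : g t₀ = 0) : ∀ᶠ t in 𝓝 t₀, f t = 0 ∧ g t = 0 := by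
  -- The summand `1` leaves room for the coefficients to vary near `t₀`. With this bound the energy
  -- `E = f² + g²` satisfies `|E'| ≤ 2KE`.
  set K := |a t₀| + |b t₀| + |c t₀| + |d t₀| + 1
  have hK : ∀ᶠ t in 𝓝 t₀, |a t| + |b t| + |c t| + |d t| < K :=
    (((ha.abs.add hb.abs).add hc.abs).add hd.abs).eventually_lt continuousAt_const (by simp [K])
  obtain ⟨ε, hε, hball⟩ := Metric.eventually_nhds_iff_ball.1 (hK.and (hf.and hg))
  have hE : ∀ t ∈ Metric.ball t₀ ε, HasDerivAt (fun t => f t ^ 2 + g t ^ 2)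
      (2 * f t * (a t * f t + b t * g t) + 2 * g t * (c t * f t + d t * g t)) t := fun t ht => by
    refine (((hball t ht).2.1.pow 2).add ((hball t ht).2.2.pow 2)).congr_deriv ?_
    norm_num
  have hbound : ∀ t ∈ Metric.ball t₀ ε,
      |2 * f t * (a t * f t + b t * g t) + 2 * g t * (c t * f t + d t * g t)| ≤
        2 * K * (f t ^ 2 + g t ^ 2) := fun t ht => by
    have h1 := (hball t ht).1
    have e1 := abs_nonneg (a t)
    have e2 := abs_nonneg (b t)
    have e3 := abs_nonneg (c t)
    have e4 := abs_nonneg (d t)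
    have hp : |f t * g t| ≤ (f t ^ 2 + g t ^ 2) / 2 := by
      rw [abs_le]; constructor <;> nlinarith [sq_nonneg (f t + g t), sq_nonneg (f t - g t)]
    calc |2 * f t * (a t * f t + b t * g t) + 2 * g t * (c t * f t + d t * g t)|
        = |2 * a t * f t ^ 2 + 2 * (b t * (f t * g t)) + 2 * (c t * (f t * g t))
            + 2 * d t * g t ^ 2| := by congr 1; ring
      _ ≤ |2 * a t * f t ^ 2| + |2 * (b t * (f t * g t))| + |2 * (c t * (f t * g t))|
            + |2 * d t * g t ^ 2| := by
          refine (abs_add_le _ _).trans (add_le_add_left ?_ _)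
          refine (abs_add_le _ _).trans (add_le_add_left ?_ _)
          exact abs_add_le _ _
      _ = 2 * |a t| * f t ^ 2 + 2 * (|b t| * |f t * g t|) + 2 * (|c t| * |f t * g t|)
            + 2 * |d t| * g t ^ 2 := by simp [abs_mul]
      _ ≤ 2 * |a t| * f t ^ 2 + 2 * (|b t| * ((f t ^ 2 + g t ^ 2) / 2))
            + 2 * (|c t| * ((f t ^ 2 + g t ^ 2) / 2)) + 2 * |d t| * g t ^ 2 := by gcongr
      _ ≤ 2 * K * (f t ^ 2 + g t ^ 2) := by
          nlinarith [sq_nonneg (f t), sq_nonneg (g t), mul_nonneg e1 (sq_nonneg (g t)),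
            mul_nonneg e4 (sq_nonneg (f t)), mul_nonneg e2 (sq_nonneg (g t)),
            mul_nonneg e2 (sq_nonneg (f t)), mul_nonneg e3 (sq_nonneg (g t)),
            mul_nonneg e3 (sq_nonneg (f t)),
            mul_nonneg (sub_nonneg.2 h1.le) (add_nonneg (sq_nonneg (f t)) (sq_nonneg (g t)))]
  have hconv : Convex ℝ (Metric.ball t₀ ε) := convex_ball _ _
  have hmem : t₀ ∈ Metric.ball t₀ ε := Metric.mem_ball_self hε
  -- The product of `E` with `exp(σt)` is nonincreasing for `σ = -2K` and nondecreasing for `σ =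
  -- 2K`. Since `E(t₀) = 0`, the former gives `E ≤ 0` to the right of `t₀` and the latter to the
  -- left.
  have hm : ∀ σ : ℝ, ∀ t ∈ Metric.ball t₀ ε, HasDerivAt
      (fun t => (f t ^ 2 + g t ^ 2) * Real.exp (σ * t))
      (((2 * f t * (a t * f t + b t * g t) + 2 * g t * (c t * f t + d t * g t)) +
        σ * (f t ^ 2 + g t ^ 2)) * Real.exp (σ * t)) t := fun σ t ht => by
    have h2 : HasDerivAt (fun t => Real.exp (σ * t)) (Real.exp (σ * t) * (σ * 1)) t :=
      ((hasDerivAt_id t).const_mul σ).exp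
    refine ((hE t ht).mul h2).congr_deriv ?_
    ring
  have hcont : ∀ σ : ℝ, ContinuousOn (fun t => (f t ^ 2 + g t ^ 2) * Real.exp (σ * t))
      (Metric.ball t₀ ε) := fun σ t ht => (hm σ t ht).continuousAt.continuousWithinAt
  have hanti := antitoneOn_of_deriv_nonpos hconv (hcont (-(2 * K)))
    (fun t ht => (hm _ t (interior_subset ht)).differentiableAt.differentiableWithinAt)
    (fun t ht => by
      rw [(hm _ t (interior_subset ht)).deriv]
      refine mul_nonpos_of_nonpos_of_nonneg ?_ (Real.exp_nonneg _)
      linarith [(abs_le.1 (hbound t (interior_subset ht))).2])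
  have hmono := monotoneOn_of_deriv_nonneg hconv (hcont (2 * K))
    (fun t ht => (hm _ t (interior_subset ht)).differentiableAt.differentiableWithinAt)
    (fun t ht => by
      rw [(hm _ t (interior_subset ht)).deriv]
      refine mul_nonneg ?_ (Real.exp_nonneg _)
      linarith [(abs_le.1 (hbound t (interior_subset ht))).1])
  filter_upwards [Metric.ball_mem_nhds t₀ hε] with t ht
  have h0 : f t ^ 2 + g t ^ 2 ≤ 0 := by
    rcases le_total t₀ t with h | h
    · have := hanti hmem ht h
      simp only [hf₀, hg₀] at this
      norm_num at this
      exact nonpos_of_mul_nonpos_left this (Real.exp_pos _)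
    · have := hmono ht hmem h
      simp only [hf₀, hg₀] at this
      norm_num at this
      exact nonpos_of_mul_nonpos_left this (Real.exp_pos _)
  constructor <;> nlinarith [sq_nonneg (f t), sq_nonneg (g t)]

theorem eventually_zero_of_linear {t₀ : ℝ} {a : ℝ → ℝ} (ha : ContinuousAt a t₀)
    (hf : ∀ᶠ t in 𝓝 t₀, HasDerivAt f (a t * f t) t) (hf₀ : f t₀ = 0) :
    ∀ᶠ t in 𝓝 t₀, f t = 0 := by
  have := eventually_zero_of_linear_system (g := 0) (b := 0) (c := 0) (d := 0) ha
    continuousAt_const continuousAt_const continuousAt_const (by simpa using hf)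
    (Eventually.of_forall fun t => by simp) hf₀ rfl
  exact this.mono fun t ht => ht.1

/-- A smooth function with positive derivative has a smooth inverse. -/
theorem exists_smooth_inverse (hJ : IsOpen J) (hJ' : J.OrdConnected) (hf : ContDiffOn ℝ ∞ f J)
    (hpos : ∀ t ∈ J, 0 < deriv f t) :
    IsOpen (f '' J) ∧ ∃ S : ℝ → ℝ, ContDiffOn ℝ ∞ S (f '' J) ∧ (∀ t ∈ J, S (f t) = t) ∧
      ∀ t ∈ J, HasDerivAt S (deriv f t)⁻¹ (f t) := by
  have hmono : StrictMonoOn f J := strictMonoOn_of_deriv_pos hJ'.convex hf.continuousOn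
    fun t ht => hpos t (interior_subset ht)
  have hinj := hmono.injOn
  have hcd : ∀ t ∈ J, ContDiffAt ℝ ∞ f t := fun t ht => hf.contDiffAt (hJ.mem_nhds ht)
  have hder : ∀ t ∈ J, HasStrictDerivAt f (deriv f t) t := fun t ht =>
    (hcd t ht).hasStrictDerivAt (by simp)
  have hSl : ∀ t ∈ J, Function.invFunOn f J (f t) = t := fun t ht => hinj.leftInvOn_invFunOn ht
  -- Near `f t` the global inverse coincides with the local one of the inverse function theorem,
  -- because the latter takes values in `J`, where `f` is injective.
  have hloc : ∀ t ∈ J, ContDiffAt ℝ ∞ (Function.invFunOn f J) (f t) := fun t ht => by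
    have hne : deriv f t ≠ 0 := (hpos t ht).ne'
    have hF : HasFDerivAt f ((ContinuousLinearEquiv.unitsEquivAut ℝ (Units.mk0 _ hne) : ℝ ≃L[ℝ] ℝ) :
        ℝ →L[ℝ] ℝ) t :=
      (hder t ht).hasDerivAt.hasFDerivAt_equiv hne
    have h1 := (hcd t ht).to_localInverse hF (by simp)
    refine h1.congr_of_eventuallyEq ?_
    have hs := (hcd t ht).hasStrictFDerivAt' hF (by simp)
    have e1 := hs.eventually_right_inverse
    have e2 : ∀ᶠ y in 𝓝 (f t), hs.localInverse f _ t y ∈ J := by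
      have := h1.continuousAt
      refine this.eventually_mem ?_
      rw [(hcd t ht).localInverse_apply_image]
      exact hJ.mem_nhds ht
    filter_upwards [e1, e2] with y h3 h4
    conv_lhs => rw [← h3]
    exact hSl _ h4
  refine ⟨?_, Function.invFunOn f J, ?_, hSl, ?_⟩
  · rw [isOpen_iff_mem_nhds]
    rintro _ ⟨t, ht, rfl⟩
    rw [← (hder t ht).map_nhds_eq (hpos t ht).ne']
    exact image_mem_map (hJ.mem_nhds ht)
  · rintro _ ⟨t, ht, rfl⟩
    exact (hloc t ht).contDiffWithinAt
  · intro t ht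
    have h1 : HasDerivAt (Function.invFunOn f J) (deriv (Function.invFunOn f J) (f t)) (f t) :=
      ((hloc t ht).differentiableAt (by simp)).hasDerivAt
    have h2 := h1.comp t (hder t ht).hasDerivAt
    have h3 : HasDerivAt (Function.invFunOn f J ∘ f) 1 t :=
      (hasDerivAt_id t).congr_of_eventuallyEq
        (by filter_upwards [hJ.mem_nhds ht] with s hs using hSl s hs)
    have h4 := h2.unique h3
    have : deriv (Function.invFunOn f J) (f t) = (deriv f t)⁻¹ := eq_inv_of_mul_eq_one_left h4
    rwa [this] at h1

end Calculus

theorem cbrt_pow_three {s : ℝ} (hs : 0 < s) : cbrt (s ^ 3) = s := by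
  have h3 : 0 < s ^ 3 := by positivity
  rw [cbrt, Real.sign_of_pos h3, abs_of_pos h3, one_mul, ← Real.rpow_natCast, ← Real.rpow_mul hs.le]
  norm_num

end DN

namespace DN

open Set Filter Topology

/-! ### Coefficients of vector fields of the invariance algebra -/

/-- The parameter functions of a vector field of the invariance algebra. -/
structure Coef where
  τ : ℝ → ℝ
  χ : ℝ → ℝ
  ρ : ℝ → ℝ
  α : ℝ → ℝ
  β : ℝ → ℝ
  σ : ℝ → ℝ
  l : ℝ

namespace Coef

/-- The vector field `D^t(τ) + l D^s + P^x(χ) + P^y(ρ) + R^x(α) + R^y(β) + Z(σ)`. -/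
noncomputable def fld (c : Coef) : Space → Space := fun p =>
  (c.τ p.1, 1 / 3 * deriv c.τ p.1 * p.2.1 + c.l * p.2.1 + c.χ p.1,
    1 / 3 * deriv c.τ p.1 * p.2.2.1 + c.l * p.2.2.1 + c.ρ p.1,
    3 * c.l * p.2.2.2 - 1 / 18 * deriv (deriv c.τ) p.1 * (p.2.1 ^ 3 + p.2.2.1 ^ 3)
      - 1 / 2 * deriv c.χ p.1 * p.2.1 ^ 2 - 1 / 2 * deriv c.ρ p.1 * p.2.2.1 ^ 2
      + c.α p.1 * p.2.1 + c.β p.1 * p.2.2.1 + c.σ p.1)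

structure SmoothOn (c : Coef) (J : Set ℝ) : Prop where
  τ : ContDiffOn ℝ ∞ c.τ J
  χ : ContDiffOn ℝ ∞ c.χ J
  ρ : ContDiffOn ℝ ∞ c.ρ J
  α : ContDiffOn ℝ ∞ c.α J
  β : ContDiffOn ℝ ∞ c.β J
  σ : ContDiffOn ℝ ∞ c.σ J

theorem SmoothOn.mono {c : Coef} {I J : Set ℝ} (h : c.SmoothOn I) (hJ : J ⊆ I) : c.SmoothOn J :=
  ⟨h.τ.mono hJ, h.χ.mono hJ, h.ρ.mono hJ, h.α.mono hJ, h.β.mono hJ, h.σ.mono hJ⟩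

/-- The parameters of a vector field, recovered from its values; the argument `t₀` is an
arbitrary point of the interval where the field is defined. -/
noncomputable def of (t₀ : ℝ) (V : Space → Space) : Coef where
  τ t := (V (t, 0, 0, 0)).1
  χ t := (V (t, 0, 0, 0)).2.1
  ρ t := (V (t, 0, 0, 0)).2.2.1
  -- For `y = u = 0` the `∂_u`-component is a cubic polynomial in `x` with linear coefficient `α`.
  -- Odd differences remove the even terms, and the weights `8` and `-1` cancel the cubic term (`8·2
  -- - 16 = 0`), leaving `12α`.
  α t := (8 * ((V (t, 1, 0, 0)).2.2.2 - (V (t, -1, 0, 0)).2.2.2) -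
    ((V (t, 2, 0, 0)).2.2.2 - (V (t, -2, 0, 0)).2.2.2)) / 12
  β t := (8 * ((V (t, 0, 1, 0)).2.2.2 - (V (t, 0, -1, 0)).2.2.2) -
    ((V (t, 0, 2, 0)).2.2.2 - (V (t, 0, -2, 0)).2.2.2)) / 12
  σ t := (V (t, 0, 0, 0)).2.2.2
  l := ((V (t₀, 0, 0, 1)).2.2.2 - (V (t₀, 0, 0, 0)).2.2.2) / 3

variable {I : Set ℝ} {c d : Coef}

theorem fld_congr (hI : IsOpen I) (hτ : EqOn c.τ d.τ I) (hχ : EqOn c.χ d.χ I)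
    (hρ : EqOn c.ρ d.ρ I) (hα : EqOn c.α d.α I) (hβ : EqOn c.β d.β I) (hσ : EqOn c.σ d.σ I)
    (hl : c.l = d.l) : EqOn c.fld d.fld (strip I) := by
  intro p hp
  have ht : p.1 ∈ I := hp
  have e1 := hτ.eventuallyEq_of_mem (hI.mem_nhds ht)
  have e2 := hχ.eventuallyEq_of_mem (hI.mem_nhds ht)
  have e3 := hρ.eventuallyEq_of_mem (hI.mem_nhds ht)
  simp only [fld, hτ ht, hχ ht, hρ ht, hα ht, hβ ht, hσ ht, hl, e1.deriv_eq, e2.deriv_eq,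
    e3.deriv_eq, e1.deriv.deriv_eq]

theorem of_eqOn {t₀ : ℝ} (ht₀ : t₀ ∈ I) {V : Space → Space} (h : EqOn V c.fld (strip I)) :
    EqOn (of t₀ V).τ c.τ I ∧ EqOn (of t₀ V).χ c.χ I ∧ EqOn (of t₀ V).ρ c.ρ I ∧
    EqOn (of t₀ V).α c.α I ∧ EqOn (of t₀ V).β c.β I ∧ EqOn (of t₀ V).σ c.σ I ∧
    (of t₀ V).l = c.l := by
  have h' : ∀ t ∈ I, ∀ x y u, V (t, x, y, u) = c.fld (t, x, y, u) := fun t ht x y u => h ht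
  refine ⟨fun t ht => ?_, fun t ht => ?_, fun t ht => ?_, fun t ht => ?_, fun t ht => ?_,
    fun t ht => ?_, ?_⟩ <;> simp only [of, h' _ ‹_›, h' _ ht₀] <;> simp [fld] <;> ring

theorem exists_of_mem_algebra (hI : IsOpen I) {V : Space → Space} (hV : V ∈ algebra I) :
    ∃ c : Coef, c.SmoothOn I ∧ EqOn V c.fld (strip I) ∧ ∀ p ∉ strip I, V p = 0 := by
  have hz : ContDiffOn ℝ ∞ (fun _ : ℝ => (0 : ℝ)) I := contDiffOn_const
  have hout : ∀ (W : Space → Space), ∀ p ∉ strip I, onStrip I W p = 0 := fun W p hp =>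
    indicator_of_notMem hp _
  induction hV using Submodule.span_induction with
  | mem V hV =>
    rcases hV with ((((((⟨f, hf, rfl⟩ | rfl) | ⟨f, hf, rfl⟩) | ⟨f, hf, rfl⟩) | ⟨f, hf, rfl⟩) |
      ⟨f, hf, rfl⟩) | ⟨f, hf, rfl⟩)
    · refine ⟨⟨f, fun _ => 0, fun _ => 0, fun _ => 0, fun _ => 0, fun _ => 0, 0⟩,
        ⟨hf, hz, hz, hz, hz, hz⟩, fun p hp => ?_, hout _⟩
      rw [onStrip, indicator_of_mem hp]; simp [fld, Dt]
    · refine ⟨⟨fun _ => 0, fun _ => 0, fun _ => 0, fun _ => 0, fun _ => 0, fun _ => 0, 1⟩,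
        ⟨hz, hz, hz, hz, hz, hz⟩, fun p hp => ?_, hout _⟩
      rw [onStrip, indicator_of_mem hp]; simp [fld, Ds]
    · refine ⟨⟨fun _ => 0, f, fun _ => 0, fun _ => 0, fun _ => 0, fun _ => 0, 0⟩,
        ⟨hz, hf, hz, hz, hz, hz⟩, fun p hp => ?_, hout _⟩
      rw [onStrip, indicator_of_mem hp]; simp [fld, Px]
    · refine ⟨⟨fun _ => 0, fun _ => 0, f, fun _ => 0, fun _ => 0, fun _ => 0, 0⟩,
        ⟨hz, hz, hf, hz, hz, hz⟩, fun p hp => ?_, hout _⟩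
      rw [onStrip, indicator_of_mem hp]; simp [fld, Py]
    · refine ⟨⟨fun _ => 0, fun _ => 0, fun _ => 0, f, fun _ => 0, fun _ => 0, 0⟩,
        ⟨hz, hz, hz, hf, hz, hz⟩, fun p hp => ?_, hout _⟩
      rw [onStrip, indicator_of_mem hp]; simp [fld, Rx]
    · refine ⟨⟨fun _ => 0, fun _ => 0, fun _ => 0, fun _ => 0, f, fun _ => 0, 0⟩,
        ⟨hz, hz, hz, hz, hf, hz⟩, fun p hp => ?_, hout _⟩
      rw [onStrip, indicator_of_mem hp]; simp [fld, Ry]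
    · refine ⟨⟨fun _ => 0, fun _ => 0, fun _ => 0, fun _ => 0, fun _ => 0, f, 0⟩,
        ⟨hz, hz, hz, hz, hz, hf⟩, fun p hp => ?_, hout _⟩
      rw [onStrip, indicator_of_mem hp]; simp [fld, Zu]
  | zero =>
    exact ⟨⟨fun _ => 0, fun _ => 0, fun _ => 0, fun _ => 0, fun _ => 0, fun _ => 0, 0⟩,
        ⟨hz, hz, hz, hz, hz, hz⟩, fun p hp => by simp [fld]; rfl, fun _ _ => rfl⟩
  | add V W _ _ hV hW =>
    obtain ⟨c, hc, h1, h2⟩ := hV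
    obtain ⟨d, hd, h3, h4⟩ := hW
    refine ⟨⟨fun t => c.τ t + d.τ t, fun t => c.χ t + d.χ t, fun t => c.ρ t + d.ρ t,
      fun t => c.α t + d.α t, fun t => c.β t + d.β t, fun t => c.σ t + d.σ t, c.l + d.l⟩,
      ⟨hc.τ.add hd.τ, hc.χ.add hd.χ, hc.ρ.add hd.ρ, hc.α.add hd.α, hc.β.add hd.β, hc.σ.add hd.σ⟩,
      fun p hp => ?_, fun p hp => by simp [h2 p hp, h4 p hp]⟩
    have ht : p.1 ∈ I := hp
    have hdτ : ∀ t ∈ I, deriv (fun t => c.τ t + d.τ t) t = deriv c.τ t + deriv d.τ t := fun t ht =>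
      ((smooth_hasDerivAt hI hc.τ ht).add (smooth_hasDerivAt hI hd.τ ht)).deriv
    have hdτ' : deriv (deriv fun t => c.τ t + d.τ t) p.1 =
        deriv (deriv c.τ) p.1 + deriv (deriv d.τ) p.1 := by
      rw [(eventuallyEq_of_mem (hI.mem_nhds ht) hdτ).deriv_eq]
      exact ((smooth_hasDerivAt hI (smooth_deriv hI hc.τ) ht).add
        (smooth_hasDerivAt hI (smooth_deriv hI hd.τ) ht)).deriv
    have hdχ : deriv (fun t => c.χ t + d.χ t) p.1 = deriv c.χ p.1 + deriv d.χ p.1 :=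
      ((smooth_hasDerivAt hI hc.χ ht).add (smooth_hasDerivAt hI hd.χ ht)).deriv
    have hdρ : deriv (fun t => c.ρ t + d.ρ t) p.1 = deriv c.ρ p.1 + deriv d.ρ p.1 :=
      ((smooth_hasDerivAt hI hc.ρ ht).add (smooth_hasDerivAt hI hd.ρ ht)).deriv
    rw [Pi.add_apply, h1 hp, h3 hp]
    simp only [fld, hdτ', hdτ _ ht, hdχ, hdρ, Prod.mk_add_mk, Prod.mk.injEq]
    refine ⟨trivial, ?_, ?_, ?_⟩ <;> ring
  | smul k V _ hV =>
    obtain ⟨c, hc, h1, h2⟩ := hV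
    refine ⟨⟨fun t => k * c.τ t, fun t => k * c.χ t, fun t => k * c.ρ t,
      fun t => k * c.α t, fun t => k * c.β t, fun t => k * c.σ t, k * c.l⟩,
      ⟨contDiffOn_const.mul hc.τ, contDiffOn_const.mul hc.χ, contDiffOn_const.mul hc.ρ,
        contDiffOn_const.mul hc.α, contDiffOn_const.mul hc.β, contDiffOn_const.mul hc.σ⟩,
      fun p hp => ?_, fun p hp => by simp [h2 p hp]⟩
    rw [Pi.smul_apply, h1 hp]
    simp only [fld, deriv_const_mul_field', Prod.smul_mk, smul_eq_mul, Prod.mk.injEq]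
    refine ⟨trivial, ?_, ?_, ?_⟩ <;> ring

/-- Thus an element of the span is replaced by canonical parameters that depend linearly on the
field. -/
theorem of_spec (hI : IsOpen I) {t₀ : ℝ} (ht₀ : t₀ ∈ I) {V : Space → Space} (hV : V ∈ algebra I) :
    (of t₀ V).SmoothOn I ∧ EqOn V (of t₀ V).fld (strip I) ∧ ∀ p ∉ strip I, V p = 0 := by
  obtain ⟨c, hc, h1, h2⟩ := exists_of_mem_algebra hI hV
  obtain ⟨e1, e2, e3, e4, e5, e6, e7⟩ := of_eqOn ht₀ h1
  exact ⟨⟨hc.τ.congr e1, hc.χ.congr e2, hc.ρ.congr e3, hc.α.congr e4, hc.β.congr e5,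
    hc.σ.congr e6⟩, h1.trans (fld_congr hI e1 e2 e3 e4 e5 e6 e7).symm, h2⟩

end Coef

theorem isOpen_strip {I : Set ℝ} (hI : IsOpen I) : IsOpen (strip I) :=
  hI.preimage continuous_fst

theorem hasDerivAt_comp_line {f : ℝ → ℝ} {t a f' : ℝ} (h : HasDerivAt f f' t) :
    HasDerivAt (fun s => f (t + s * a)) (f' * a) 0 := by
  have h1 : HasDerivAt (fun s : ℝ => t + s * a) a 0 := by
    simpa using ((hasDerivAt_id (0 : ℝ)).mul_const a).const_add t
  have h2 : HasDerivAt f f' (t + 0 * a) := by simpa using h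
  exact h2.comp (0 : ℝ) h1

theorem hasDerivAt_line (t a : ℝ) : HasDerivAt (fun s : ℝ => t + s * a) a 0 := by
  simpa using ((hasDerivAt_id (0 : ℝ)).mul_const a).const_add t

/-- The derivative of a map along a vector is computed along a line. -/
theorem fderiv_apply_eq_of_line {E F : Type*} [NormedAddCommGroup E] [NormedSpace ℝ E]
    [NormedAddCommGroup F] [NormedSpace ℝ F] {f : E → F} {p v : E} {w : F}
    (hf : DifferentiableAt ℝ f p) (h : HasDerivAt (fun s : ℝ => f (p + s • v)) w 0) :
    fderiv ℝ f p v = w := by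
  have h1 : HasDerivAt (fun s : ℝ => p + s • v) v 0 := by
    simpa using ((hasDerivAt_id (0 : ℝ)).smul_const v).const_add p
  have h2 : HasFDerivAt f (fderiv ℝ f p) (p + (0 : ℝ) • v) := by simpa using hf.hasFDerivAt
  exact (h2.comp_hasDerivAt (0 : ℝ) h1).unique h

namespace Coef

variable {I : Set ℝ} {c d : Coef}

theorem contDiffOn_fld (hI : IsOpen I) (hc : c.SmoothOn I) : ContDiffOn ℝ ∞ c.fld (strip I) := by
  have hm : MapsTo (fun p : Space => p.1) (strip I) I := fun p hp => hp
  have h1 {f : ℝ → ℝ} (hf : ContDiffOn ℝ ∞ f I) :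
      ContDiffOn ℝ ∞ (fun p : Space => f p.1) (strip I) := hf.comp contDiffOn_fst hm
  have a1 := h1 hc.τ
  have a2 := h1 (smooth_deriv hI hc.τ)
  have a3 := h1 (smooth_deriv hI (smooth_deriv hI hc.τ))
  have a4 := h1 hc.χ
  have a5 := h1 (smooth_deriv hI hc.χ)
  have a6 := h1 hc.ρ
  have a7 := h1 (smooth_deriv hI hc.ρ)
  have a8 := h1 hc.α
  have a9 := h1 hc.β
  have a10 := h1 hc.σ
  unfold fld
  fun_prop

theorem fderiv_fld (hI : IsOpen I) (hc : c.SmoothOn I) {t : ℝ} (ht : t ∈ I) (x y u a b e f : ℝ) :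
    fderiv ℝ c.fld (t, x, y, u) (a, b, e, f) =
      (deriv c.τ t * a,
        1 / 3 * deriv (deriv c.τ) t * a * x + 1 / 3 * deriv c.τ t * b + c.l * b + deriv c.χ t * a,
        1 / 3 * deriv (deriv c.τ) t * a * y + 1 / 3 * deriv c.τ t * e + c.l * e + deriv c.ρ t * a,
        3 * c.l * f - 1 / 18 * deriv (deriv (deriv c.τ)) t * a * (x ^ 3 + y ^ 3)
          - 1 / 6 * deriv (deriv c.τ) t * (x ^ 2 * b + y ^ 2 * e)
          - 1 / 2 * deriv (deriv c.χ) t * a * x ^ 2 - deriv c.χ t * x * b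
          - 1 / 2 * deriv (deriv c.ρ) t * a * y ^ 2 - deriv c.ρ t * y * e
          + deriv c.α t * a * x + c.α t * b + deriv c.β t * a * y + c.β t * e
          + deriv c.σ t * a) := by
  have hs : strip I ∈ 𝓝 ((t, x, y, u) : Space) := (isOpen_strip hI).mem_nhds ht
  refine fderiv_apply_eq_of_line
    (((contDiffOn_fld hI hc).contDiffAt hs).differentiableAt (by simp)) ?_
  have L {f : ℝ → ℝ} (hf : ContDiffOn ℝ ∞ f I) :
      HasDerivAt (fun s => f (t + s * a)) (deriv f t * a) 0 :=
    hasDerivAt_comp_line (smooth_hasDerivAt hI hf ht)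
  have hx := hasDerivAt_line x b
  have hy := hasDerivAt_line y e
  have hu := hasDerivAt_line u f
  have a1 := L hc.τ
  have a2 := L (smooth_deriv hI hc.τ)
  have a3 := L (smooth_deriv hI (smooth_deriv hI hc.τ))
  have a4 := L hc.χ
  have a5 := L (smooth_deriv hI hc.χ)
  have a6 := L hc.ρ
  have a7 := L (smooth_deriv hI hc.ρ)
  have a8 := L hc.α
  have a9 := L hc.β
  have a10 := L hc.σ
  simp only [fld, Prod.smul_mk, Prod.mk_add_mk, smul_eq_mul]
  refine a1.prodMk (HasDerivAt.prodMk ?_ (HasDerivAt.prodMk ?_ ?_))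
  · refine ((((a2.const_mul (1 / 3)).mul hx).add (hx.const_mul c.l)).add a4).congr_deriv ?_
    simp only [zero_mul, add_zero]; ring
  · refine ((((a2.const_mul (1 / 3)).mul hy).add (hy.const_mul c.l)).add a6).congr_deriv ?_
    simp only [zero_mul, add_zero]; ring
  · refine (((((((hu.const_mul (3 * c.l)).sub ((a3.const_mul (1 / 18)).mul
      ((hx.pow 3).add (hy.pow 3)))).sub ((a5.const_mul (1 / 2)).mul (hx.pow 2))).sub
      ((a7.const_mul (1 / 2)).mul (hy.pow 2))).add (a8.mul hx)).add
      (a9.mul hy)).add a10).congr_deriv ?_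
    simp; ring

/-- The parameters of the Lie bracket of two vector fields. -/
theorem of_lieBracket (hI : IsOpen I) (hc : c.SmoothOn I) (hd : d.SmoothOn I) {V W : Space → Space}
    (hV : EqOn V c.fld (strip I)) (hW : EqOn W d.fld (strip I)) (t₀ : ℝ) :
    (∀ t ∈ I, (of t₀ (VectorField.lieBracket ℝ V W)).τ t =
      c.τ t * deriv d.τ t - deriv c.τ t * d.τ t) ∧
    (∀ t ∈ I, (of t₀ (VectorField.lieBracket ℝ V W)).χ t =
      c.τ t * deriv d.χ t - 1 / 3 * deriv c.τ t * d.χ t - c.l * d.χ t -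
      (d.τ t * deriv c.χ t - 1 / 3 * deriv d.τ t * c.χ t - d.l * c.χ t)) ∧
    (∀ t ∈ I, (of t₀ (VectorField.lieBracket ℝ V W)).ρ t =
      c.τ t * deriv d.ρ t - 1 / 3 * deriv c.τ t * d.ρ t - c.l * d.ρ t -
      (d.τ t * deriv c.ρ t - 1 / 3 * deriv d.τ t * c.ρ t - d.l * c.ρ t)) ∧
    (∀ t ∈ I, (of t₀ (VectorField.lieBracket ℝ V W)).α t =
      c.τ t * deriv d.α t + 1 / 3 * deriv c.τ t * d.α t - 2 * c.l * d.α t -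
      (d.τ t * deriv c.α t + 1 / 3 * deriv d.τ t * c.α t - 2 * d.l * c.α t) -
      (c.χ t * deriv d.χ t - deriv c.χ t * d.χ t)) ∧
    (∀ t ∈ I, (of t₀ (VectorField.lieBracket ℝ V W)).β t =
      c.τ t * deriv d.β t + 1 / 3 * deriv c.τ t * d.β t - 2 * c.l * d.β t -
      (d.τ t * deriv c.β t + 1 / 3 * deriv d.τ t * c.β t - 2 * d.l * c.β t) -
      (c.ρ t * deriv d.ρ t - deriv c.ρ t * d.ρ t)) ∧
    (∀ t ∈ I, (of t₀ (VectorField.lieBracket ℝ V W)).σ t =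
      c.τ t * deriv d.σ t - 3 * c.l * d.σ t - (d.τ t * deriv c.σ t - 3 * d.l * c.σ t) +
      (c.χ t * d.α t - d.χ t * c.α t + c.ρ t * d.β t - d.ρ t * c.β t)) ∧
    (t₀ ∈ I → (of t₀ (VectorField.lieBracket ℝ V W)).l = 0) := by
  have key : ∀ t ∈ I, ∀ x y u, VectorField.lieBracket ℝ V W (t, x, y, u) =
      fderiv ℝ d.fld (t, x, y, u) (c.fld (t, x, y, u)) -
        fderiv ℝ c.fld (t, x, y, u) (d.fld (t, x, y, u)) := fun t ht x y u => by
    have hs : strip I ∈ 𝓝 ((t, x, y, u) : Space) := (isOpen_strip hI).mem_nhds ht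
    rw [VectorField.lieBracket, (hV.eventuallyEq_of_mem hs).fderiv_eq,
      (hW.eventuallyEq_of_mem hs).fderiv_eq, hV (x := (t, x, y, u)) ht,
      hW (x := (t, x, y, u)) ht]
  have key' : ∀ t ∈ I, ∀ x y u, VectorField.lieBracket ℝ V W (t, x, y, u) = _ := fun t ht x y u =>
    (key t ht x y u).trans (by rw [fld, fld, fderiv_fld hI hd ht, fderiv_fld hI hc ht])
  refine ⟨fun t ht => ?_, fun t ht => ?_, fun t ht => ?_, fun t ht => ?_, fun t ht => ?_,
    fun t ht => ?_, fun ht => ?_⟩ <;> simp only [of, key' _ ht, Prod.mk_sub_mk] <;> ring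

end Coef

end DN

namespace DN

open Set Filter Topology VectorField

/-! ### Structure of three-dimensional subalgebras of rank three -/

namespace Coef

/-- The parameters are combinations of point values of the field, so linearity holds for arbitrary
fields. This is how structure constants are turned into relations between parameter functions. -/
theorem of_comb {t₀ k₁ k₂ k₃ : ℝ} {V A B C : Space → Space} (h : V = k₁ • A + k₂ • B + k₃ • C) :
    (∀ t, (of t₀ V).τ t = k₁ * (of t₀ A).τ t + k₂ * (of t₀ B).τ t + k₃ * (of t₀ C).τ t) ∧
    (∀ t, (of t₀ V).χ t = k₁ * (of t₀ A).χ t + k₂ * (of t₀ B).χ t + k₃ * (of t₀ C).χ t) ∧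
    (∀ t, (of t₀ V).ρ t = k₁ * (of t₀ A).ρ t + k₂ * (of t₀ B).ρ t + k₃ * (of t₀ C).ρ t) ∧
    (∀ t, (of t₀ V).α t = k₁ * (of t₀ A).α t + k₂ * (of t₀ B).α t + k₃ * (of t₀ C).α t) ∧
    (∀ t, (of t₀ V).β t = k₁ * (of t₀ A).β t + k₂ * (of t₀ B).β t + k₃ * (of t₀ C).β t) ∧
    (∀ t, (of t₀ V).σ t = k₁ * (of t₀ A).σ t + k₂ * (of t₀ B).σ t + k₃ * (of t₀ C).σ t) ∧
    (of t₀ V).l = k₁ * (of t₀ A).l + k₂ * (of t₀ B).l + k₃ * (of t₀ C).l := by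
  subst h
  simp only [of, Pi.add_apply, Pi.smul_apply, Prod.fst_add, Prod.snd_add, Prod.smul_fst,
    Prod.smul_snd, smul_eq_mul]
  refine ⟨?_, ?_, ?_, ?_, ?_, ?_, ?_⟩ <;> intros <;> first | trivial | ring

end Coef

open Coef

section Bracket

variable {I : Set ℝ} {A B C : Space → Space}

theorem contDiffAt_of_mem_algebra (hI : IsOpen I) (hA : A ∈ algebra I) {p : Space}
    (hp : p ∈ strip I) : ContDiffAt ℝ ∞ A p := by
  obtain ⟨h1, h2, -⟩ := of_spec hI hp hA
  exact ((contDiffOn_fld hI h1).congr h2).contDiffAt ((isOpen_strip hI).mem_nhds hp)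

/-- Fields of the algebra vanish off the strip but may fail to be differentiable over the endpoints
of `I`. There the bracket is still zero, as each derivative is applied to the zero vector; hence
bracket identities hold on the whole space. -/
theorem lieBracket_apply_of_notMem (hI : IsOpen I) (hA : A ∈ algebra I) (hB : B ∈ algebra I)
    {p : Space} (hp : p ∉ strip I) : lieBracket ℝ A B p = 0 := by
  obtain ⟨_, -, -, h1⟩ := exists_of_mem_algebra hI hA
  obtain ⟨_, -, -, h2⟩ := exists_of_mem_algebra hI hB
  exact lieBracket_eq_zero_of_eq_zero (h1 p hp) (h2 p hp)

theorem lieBracket_comb_left (hI : IsOpen I) (hA : A ∈ algebra I) (hB : B ∈ algebra I)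
    (hC : C ∈ algebra I) (k m : ℝ) :
    lieBracket ℝ (k • A + m • B) C = k • lieBracket ℝ A C + m • lieBracket ℝ B C := by
  ext1 p
  by_cases hp : p ∈ strip I
  · have h1 := (contDiffAt_of_mem_algebra hI hA hp).differentiableAt (by simp)
    have h2 := (contDiffAt_of_mem_algebra hI hB hp).differentiableAt (by simp)
    rw [lieBracket_add_left (h1.const_smul k) (h2.const_smul m), lieBracket_const_smul_left h1,
      lieBracket_const_smul_left h2]
    rfl
  · rw [lieBracket_apply_of_notMem hI
      (add_mem (Submodule.smul_mem _ _ hA) (Submodule.smul_mem _ _ hB)) hC hp]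
    simp [lieBracket_apply_of_notMem hI hA hC hp, lieBracket_apply_of_notMem hI hB hC hp]

theorem lieBracket_swap' : lieBracket ℝ A B = -lieBracket ℝ B A := by
  ext1 p
  exact lieBracket_swap

theorem lieBracket_comb_right (hI : IsOpen I) (hA : A ∈ algebra I) (hB : B ∈ algebra I)
    (hC : C ∈ algebra I) (k m : ℝ) :
    lieBracket ℝ C (k • A + m • B) = k • lieBracket ℝ C A + m • lieBracket ℝ C B := by
  rw [lieBracket_swap', lieBracket_comb_left hI hA hB hC, lieBracket_swap' (A := C) (B := A),
    lieBracket_swap' (A := C) (B := B)]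
  module

end Bracket

/-- Evaluation at `p` is a linear map between three-dimensional spaces whose image has dimension
three, hence an isomorphism. So `𝔰` has a frame with prescribed values at `p`, and equalities in `𝔰`
can be tested at `p`. -/
theorem exists_frame {𝔰 : Submodule ℝ (Space → Space)} (hdim : Module.finrank ℝ 𝔰 = 3) {p : Space}
    (hr : rankAt 𝔰 p = 3) :
    (∀ b : Base, ∃ V ∈ 𝔰, base (V p) = b) ∧
      ∀ V ∈ 𝔰, ∀ W ∈ 𝔰, base (V p) = base (W p) → V = W := by
  have : FiniteDimensional ℝ 𝔰 := FiniteDimensional.of_finrank_pos (by omega)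
  set L : (Space → Space) →ₗ[ℝ] Base :=
    base ∘ₗ (LinearMap.proj p : (Space → Space) →ₗ[ℝ] Space)
  have hrange : LinearMap.range (L.domRestrict 𝔰) = 𝔰.map L := by
    rw [LinearMap.domRestrict, LinearMap.range_comp, Submodule.range_subtype]
  have h3 : Module.finrank ℝ (LinearMap.range (L.domRestrict 𝔰)) = 3 := by rw [hrange]; exact hr
  have hsurj : LinearMap.range (L.domRestrict 𝔰) = ⊤ :=
    Submodule.eq_top_of_finrank_eq (by rw [h3]; simp)
  have hker := LinearMap.finrank_range_add_finrank_ker (L.domRestrict 𝔰)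
  have hinj : LinearMap.ker (L.domRestrict 𝔰) = ⊥ := Submodule.finrank_eq_zero.1 (by omega)
  refine ⟨fun b => ?_, fun V hV W hW h => ?_⟩
  · obtain ⟨V, hV⟩ := LinearMap.range_eq_top.1 hsurj b
    exact ⟨V, V.2, hV⟩
  · have := LinearMap.ker_eq_bot.1 hinj (a₁ := ⟨V, hV⟩) (a₂ := ⟨W, hW⟩) h
    exact congrArg Subtype.val this

section Trichotomy

variable {I : Set ℝ} {𝔰 : Submodule ℝ (Space → Space)} {p : Space}

/-- The bracket of two vector fields whose `t`-components vanish at `t₀`. -/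
theorem base_lieBracket (hI : IsOpen I) (h𝔰 : IsSubalgebra I 𝔰) (hp : p ∈ strip I)
    {V W : Space → Space} (hV : V ∈ 𝔰) (hW : W ∈ 𝔰) (hV0 : (of p.1 V).τ p.1 = 0)
    (hW0 : (of p.1 W).τ p.1 = 0) :
    base (lieBracket ℝ V W p) =
      (1 / 3 * deriv (of p.1 W).τ p.1 + (of p.1 W).l) • base (V p) -
        (1 / 3 * deriv (of p.1 V).τ p.1 + (of p.1 V).l) • base (W p) := by
  obtain ⟨hc, hVc, -⟩ := of_spec hI hp (h𝔰.1 hV)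
  obtain ⟨hd, hWd, -⟩ := of_spec hI hp (h𝔰.1 hW)
  obtain ⟨hb, hVb, -⟩ := of_spec hI hp (h𝔰.1 (h𝔰.2 V hV W hW))
  obtain ⟨e1, e2, e3, -, -, -, e7⟩ := of_lieBracket hI hc hd hVc hWd p.1
  have hp' : p.1 ∈ I := hp
  -- The `τ` of a bracket is `τ_V τ_W' - τ_V' τ_W`, with derivative `τ_V τ_W'' - τ_V'' τ_W`, and
  -- both factors `τ` vanish at `t₀`.
  have e1' : deriv (of p.1 (lieBracket ℝ V W)).τ p.1 = 0 := by
    rw [(eventuallyEq_of_mem (hI.mem_nhds hp') e1).deriv_eq]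
    refine (((smooth_hasDerivAt hI hc.τ hp').mul
      (smooth_hasDerivAt hI (smooth_deriv hI hd.τ) hp')).sub
      ((smooth_hasDerivAt hI (smooth_deriv hI hc.τ) hp').mul
      (smooth_hasDerivAt hI hd.τ hp'))).deriv.trans ?_
    rw [hV0, hW0]
    ring
  rw [hVb hp, hVc hp, hWd hp]
  simp only [fld, base, LinearMap.coe_mk, AddHom.coe_mk, e1 _ hp', e2 _ hp', e3 _ hp', e7 hp', e1',
    hV0, hW0, Prod.smul_mk, Prod.mk_sub_mk, smul_eq_mul, Prod.mk.injEq]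
  refine ⟨by ring, by ring, by ring⟩

/-- The alternatives correspond to `m = l = 0`, to `m = 0 ≠ l` and to `m ≠ 0` on the plane spanned
by the fields `E₁`, `E₂` that equal `∂_x`, `∂_y` at `p` up to the `∂_u`-component. The coefficient
of `D^s` vanishes on all brackets, and this restricts the structure constants. -/
theorem trichotomy (hI : IsOpen I) (h𝔰 : IsSubalgebra I 𝔰) (hdim : Module.finrank ℝ 𝔰 = 3)
    (hp : p ∈ strip I) (hr : rankAt 𝔰 p = 3) :
    (∃ E ∈ 𝔰, ∃ V ∈ 𝔰, ∃ W ∈ 𝔰, (of p.1 E).τ p.1 = 1 ∧ (of p.1 V).l = 0 ∧ (of p.1 W).l = 0 ∧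
      (∀ᶠ t in 𝓝 p.1, (of p.1 V).τ t = 0 ∧ (of p.1 W).τ t = 0) ∧
      (of p.1 V).χ p.1 = 1 ∧ (of p.1 V).ρ p.1 = 0 ∧ (of p.1 W).χ p.1 = 0 ∧ (of p.1 W).ρ p.1 = 1 ∧
      lieBracket ℝ V W = 0) ∨
    (∃ A ∈ 𝔰, ∃ V ∈ 𝔰, ∃ W ∈ 𝔰, ∃ k : ℝ, (of p.1 A).τ p.1 = 1 ∧ (of p.1 A).l = 0 ∧
      (of p.1 V).l = 1 ∧ (of p.1 W).l = 0 ∧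
      (∀ᶠ t in 𝓝 p.1, (of p.1 V).τ t = 0 ∧ (of p.1 W).τ t = 0) ∧
      (base (V p)).2.1 * (base (W p)).2.2 - (base (W p)).2.1 * (base (V p)).2.2 ≠ 0 ∧
      lieBracket ℝ V W = (-1 : ℝ) • W ∧ lieBracket ℝ A V = 0 ∧ lieBracket ℝ A W = k • W) ∨
    (∃ A ∈ 𝔰, ∃ W ∈ 𝔰, (of p.1 A).τ p.1 = 1 ∧ (of p.1 A).l = 0 ∧ (of p.1 W).l = 0 ∧
      (∀ᶠ t in 𝓝 p.1, (of p.1 W).τ t = 0) ∧ ((of p.1 W).χ p.1 ≠ 0 ∨ (of p.1 W).ρ p.1 ≠ 0) ∧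
      lieBracket ℝ A W = 0) := by
  obtain ⟨hsurj, hinj⟩ := exists_frame hdim hr
  have hp' : p.1 ∈ I := hp
  have hspec := fun {V} (hV : V ∈ 𝔰) => of_spec hI hp (h𝔰.1 hV)
  have hbase : ∀ {V}, V ∈ 𝔰 → base (V p) = ((of p.1 V).τ p.1,
      1 / 3 * deriv (of p.1 V).τ p.1 * p.2.1 + (of p.1 V).l * p.2.1 + (of p.1 V).χ p.1,
      1 / 3 * deriv (of p.1 V).τ p.1 * p.2.2.1 + (of p.1 V).l * p.2.2.1 + (of p.1 V).ρ p.1) :=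
    fun hV => by rw [(hspec hV).2.1 hp]; rfl
  have hτ : ∀ {V}, V ∈ 𝔰 → (of p.1 V).τ p.1 = (base (V p)).1 := fun hV => by rw [hbase hV]
  obtain ⟨E₀, hE₀, b₀⟩ := hsurj (1, 0, 0)
  obtain ⟨E₁, hE₁, b₁⟩ := hsurj (0, 1, 0)
  obtain ⟨E₂, hE₂, b₂⟩ := hsurj (0, 0, 1)
  have t₀ : (of p.1 E₀).τ p.1 = 1 := by rw [hτ hE₀, b₀]
  have t₁ : (of p.1 E₁).τ p.1 = 0 := by rw [hτ hE₁, b₁]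
  have t₂ : (of p.1 E₂).τ p.1 = 0 := by rw [hτ hE₂, b₂]
  have hbr : ∀ {V W}, V ∈ 𝔰 → W ∈ 𝔰 → (of p.1 V).τ p.1 = 0 → (of p.1 W).τ p.1 = 0 →
      lieBracket ℝ V W = (1 / 3 * deriv (of p.1 W).τ p.1 + (of p.1 W).l) • V +
        (-(1 / 3 * deriv (of p.1 V).τ p.1 + (of p.1 V).l)) • W := fun hV hW h1 h2 => by
    refine hinj _ (h𝔰.2 _ hV _ hW) _ (add_mem (𝔰.smul_mem _ hV) (𝔰.smul_mem _ hW)) ?_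
    rw [base_lieBracket hI h𝔰 hp hV hW h1 h2, Pi.add_apply, map_add, Pi.smul_apply, Pi.smul_apply,
      map_smul, map_smul]
    module
  have hcomb3 : ∀ {V A B C : Space → Space} (k₁ k₂ k₃ : ℝ), A ∈ 𝔰 → B ∈ 𝔰 → C ∈ 𝔰 →
      V = k₁ • A + k₂ • B + k₃ • C → deriv (of p.1 V).τ p.1 = k₁ * deriv (of p.1 A).τ p.1 +
        k₂ * deriv (of p.1 B).τ p.1 + k₃ * deriv (of p.1 C).τ p.1 := fun k₁ k₂ k₃ hA hB hC h => by
    have e := (of_comb (t₀ := p.1) h).1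
    rw [show (of p.1 _).τ = _ from funext e]
    exact ((((smooth_hasDerivAt hI (hspec hA).1.τ hp').const_mul k₁).add
      ((smooth_hasDerivAt hI (hspec hB).1.τ hp').const_mul k₂)).add
      ((smooth_hasDerivAt hI (hspec hC).1.τ hp').const_mul k₃)).deriv
  have hlbr : ∀ {V W}, V ∈ 𝔰 → W ∈ 𝔰 → (of p.1 (lieBracket ℝ V W)).l = 0 := fun hV hW =>
    (of_lieBracket hI (hspec hV).1 (hspec hW).1 (hspec hV).2.1 (hspec hW).2.1 p.1).2.2.2.2.2.2 hp'
  have hτbr : ∀ {V W}, V ∈ 𝔰 → W ∈ 𝔰 → ∀ t ∈ I, (of p.1 (lieBracket ℝ V W)).τ t =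
      (of p.1 V).τ t * deriv (of p.1 W).τ t - deriv (of p.1 V).τ t * (of p.1 W).τ t :=
    fun hV hW => (of_lieBracket hI (hspec hV).1 (hspec hW).1 (hspec hV).2.1 (hspec hW).2.1 p.1).1
  -- Cramer's rule in the plane of fields tangent to `t = t₀` at `p`. The coefficient of `E₀` is
  -- read off from the `t`-component.
  have hdec : ∀ {X V W}, X ∈ 𝔰 → V ∈ 𝔰 → W ∈ 𝔰 → (of p.1 V).τ p.1 = 0 → (of p.1 W).τ p.1 = 0 →
      (base (V p)).2.1 * (base (W p)).2.2 - (base (W p)).2.1 * (base (V p)).2.2 ≠ 0 →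
      ∃ b c : ℝ, X = (of p.1 X).τ p.1 • E₀ + b • V + c • W := fun {X V W} hX hV hW h1 h2 h3 => by
    rw [hτ hV] at h1
    rw [hτ hW] at h2
    set v := base (V p)
    set w := base (W p)
    set D := v.2.1 * w.2.2 - w.2.1 * v.2.2
    refine ⟨((base (X p)).2.1 * w.2.2 - w.2.1 * (base (X p)).2.2) / D,
      (v.2.1 * (base (X p)).2.2 - (base (X p)).2.1 * v.2.2) / D, ?_⟩
    refine hinj _ hX _ (add_mem (add_mem (𝔰.smul_mem _ hE₀) (𝔰.smul_mem _ hV))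
      (𝔰.smul_mem _ hW)) ?_
    simp only [Pi.add_apply, map_add, Pi.smul_apply, map_smul, b₀, hτ hX]
    refine Prod.ext ?_ (Prod.ext ?_ ?_)
    · simp [show (base (V p)).1 = 0 from h1, show (base (W p)).1 = 0 from h2]
    · simp only [Prod.snd_add, Prod.fst_add, Prod.smul_snd, Prod.smul_fst, smul_eq_mul]
      change _ = _ + _ * v.2.1 + _ * w.2.1
      field_simp
      simp only [D]; ring
    · simp only [Prod.snd_add, Prod.smul_snd, smul_eq_mul]
      change _ = _ + _ * v.2.2 + _ * w.2.2
      field_simp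
      simp only [D]; ring
  -- If `ad E₀` preserves the span of `V` and `W`, comparing the `τ`-parameters gives a homogeneous
  -- linear system for `(τ_V, τ_W)` near `t₀`, regular because `τ(E₀) = 1` at `t₀`. Zero initial
  -- values then force `τ_V = τ_W = 0` near `t₀`.
  have hsys : ∀ {W}, W ∈ 𝔰 → ∀ {V}, V ∈ 𝔰 → ∀ a b a' b' : ℝ,
      lieBracket ℝ E₀ V = (0 : ℝ) • E₀ + a • V + b • W →
      lieBracket ℝ E₀ W = (0 : ℝ) • E₀ + a' • V + b' • W → (of p.1 V).τ p.1 = 0 →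
      (of p.1 W).τ p.1 = 0 →
      ∀ᶠ t in 𝓝 p.1, (of p.1 V).τ t = 0 ∧ (of p.1 W).τ t = 0 := fun {W} hW {V} hV a b a' b' h1 h2
      hV0 hW0 => by
    have hc0 := (hspec hE₀).1.τ
    have hcont : ContinuousAt (of p.1 E₀).τ p.1 := (smooth_hasDerivAt hI hc0 hp').continuousAt
    have hcont' : ContinuousAt (deriv (of p.1 E₀).τ) p.1 :=
      (smooth_hasDerivAt hI (smooth_deriv hI hc0) hp').continuousAt
    have hne : (of p.1 E₀).τ p.1 ≠ 0 := by rw [t₀]; norm_num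
    refine eventually_zero_of_linear_system
      (a := fun t => (deriv (of p.1 E₀).τ t + a) / (of p.1 E₀).τ t)
      (b := fun t => b / (of p.1 E₀).τ t) (c := fun t => a' / (of p.1 E₀).τ t)
      (d := fun t => (deriv (of p.1 E₀).τ t + b') / (of p.1 E₀).τ t)
      ((hcont'.add continuousAt_const).div hcont hne) (continuousAt_const.div hcont hne)
      (continuousAt_const.div hcont hne) ((hcont'.add continuousAt_const).div hcont hne) ?_ ?_
      hV0 hW0
    · filter_upwards [hcont.eventually_ne hne, hI.mem_nhds hp'] with t ht htI
      refine (smooth_hasDerivAt hI (hspec hV).1.τ htI).congr_deriv ?_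
      have e1 := hτbr hE₀ hV t htI
      rw [(of_comb h1).1] at e1
      field_simp
      linear_combination -e1
    · filter_upwards [hcont.eventually_ne hne, hI.mem_nhds hp'] with t ht htI
      refine (smooth_hasDerivAt hI (hspec hW).1.τ htI).congr_deriv ?_
      have e1 := hτbr hE₀ hW t htI
      rw [(of_comb h2).1] at e1
      field_simp
      linear_combination -e1
  set m₁ := deriv (of p.1 E₁).τ p.1
  set m₂ := deriv (of p.1 E₂).τ p.1
  set l₁ := (of p.1 E₁).l
  set l₂ := (of p.1 E₂).l
  by_cases hm : m₁ = 0 ∧ m₂ = 0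
  · have hdet : (base (E₁ p)).2.1 * (base (E₂ p)).2.2 - (base (E₂ p)).2.1 * (base (E₁ p)).2.2 ≠ 0 := by
      rw [b₁, b₂]; norm_num
    obtain ⟨a, b, h1⟩ := hdec (h𝔰.2 _ hE₀ _ hE₁) hE₁ hE₂ t₁ t₂ hdet
    obtain ⟨a', b', h2⟩ := hdec (h𝔰.2 _ hE₀ _ hE₂) hE₁ hE₂ t₁ t₂ hdet
    rw [hτbr hE₀ hE₁ _ hp', show deriv (of p.1 E₁).τ p.1 = 0 from hm.1, t₁] at h1
    rw [hτbr hE₀ hE₂ _ hp', show deriv (of p.1 E₂).τ p.1 = 0 from hm.2, t₂] at h2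
    rw [mul_zero, mul_zero, sub_zero] at h1 h2
    have hz := hsys hE₂ hE₁ a b a' b' h1 h2 t₁ t₂
    by_cases hl : l₁ = 0 ∧ l₂ = 0
    · refine Or.inl ⟨E₀, hE₀, E₁, hE₁, E₂, hE₂, t₀, hl.1, hl.2, hz, ?_⟩
      have c₁ := hbase hE₁
      have c₂ := hbase hE₂
      rw [show deriv (of p.1 E₁).τ p.1 = 0 from hm.1, show (of p.1 E₁).l = 0 from hl.1, b₁] at c₁
      rw [show deriv (of p.1 E₂).τ p.1 = 0 from hm.2, show (of p.1 E₂).l = 0 from hl.2, b₂] at c₂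
      simp only [mul_zero, zero_mul, zero_add, Prod.mk.injEq] at c₁ c₂
      refine ⟨c₁.2.1.symm, c₁.2.2.symm, c₂.2.1.symm, c₂.2.2.symm, ?_⟩
      rw [hbr hE₁ hE₂ t₁ t₂, show deriv (of p.1 E₁).τ p.1 = 0 from hm.1,
        show deriv (of p.1 E₂).τ p.1 = 0 from hm.2, show (of p.1 E₁).l = 0 from hl.1,
        show (of p.1 E₂).l = 0 from hl.2]
      simp
    · right; left
      have hN : l₁ ^ 2 + l₂ ^ 2 ≠ 0 := fun h => hl ⟨by nlinarith [sq_nonneg l₁, sq_nonneg l₂],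
        by nlinarith [sq_nonneg l₁, sq_nonneg l₂]⟩
      set N := l₁ ^ 2 + l₂ ^ 2
      -- A basis of the plane adapted to the functional `l`: it is `1` on `V` and `0` on `W`.
      obtain ⟨V, hVdef⟩ : ∃ V, V = (0 : ℝ) • E₀ + (l₁ / N) • E₁ + (l₂ / N) • E₂ := ⟨_, rfl⟩
      obtain ⟨W, hWdef⟩ : ∃ W, W = (0 : ℝ) • E₀ + l₂ • E₁ + (-l₁) • E₂ := ⟨_, rfl⟩
      have hV : V ∈ 𝔰 := hVdef ▸ add_mem (add_mem (𝔰.smul_mem _ hE₀) (𝔰.smul_mem _ hE₁))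
        (𝔰.smul_mem _ hE₂)
      have hW : W ∈ 𝔰 := hWdef ▸ add_mem (add_mem (𝔰.smul_mem _ hE₀) (𝔰.smul_mem _ hE₁))
        (𝔰.smul_mem _ hE₂)
      have hVl : (of p.1 V).l = 1 := by
        rw [(of_comb hVdef).2.2.2.2.2.2]
        change 0 * _ + l₁ / N * l₁ + l₂ / N * l₂ = 1
        field_simp; simp only [N]; ring
      have hWl : (of p.1 W).l = 0 := by
        rw [(of_comb hWdef).2.2.2.2.2.2]
        change 0 * _ + l₂ * l₁ + -l₁ * l₂ = 0
        ring
      have hVW : ∀ᶠ t in 𝓝 p.1, (of p.1 V).τ t = 0 ∧ (of p.1 W).τ t = 0 := by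
        filter_upwards [hz] with t ht
        rw [(of_comb hVdef).1, (of_comb hWdef).1, ht.1, ht.2]
        constructor <;> ring
      have hV0 := hVW.self_of_nhds.1
      have hW0 := hVW.self_of_nhds.2
      have hVm : deriv (of p.1 V).τ p.1 = 0 := by
        rw [hcomb3 _ _ _ hE₀ hE₁ hE₂ hVdef]
        change 0 * _ + _ * m₁ + _ * m₂ = 0
        rw [hm.1, hm.2]; ring
      have hWm : deriv (of p.1 W).τ p.1 = 0 := by
        rw [hcomb3 _ _ _ hE₀ hE₁ hE₂ hWdef]
        change 0 * _ + _ * m₁ + _ * m₂ = 0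
        rw [hm.1, hm.2]; ring
      have hdetVW : (base (V p)).2.1 * (base (W p)).2.2 - (base (W p)).2.1 * (base (V p)).2.2 ≠ 0 := by
        have : (base (V p)).2.1 * (base (W p)).2.2 - (base (W p)).2.1 * (base (V p)).2.2 = -1 := by
          rw [hVdef, hWdef]
          simp only [Pi.add_apply, map_add, Pi.smul_apply, map_smul, b₀, b₁, b₂, Prod.smul_mk,
            Prod.mk_add_mk, smul_eq_mul]
          field_simp; simp only [N]; ring
        rw [this]; norm_num
      have hVWbr : lieBracket ℝ V W = (-1 : ℝ) • W := by
        rw [hbr hV hW hV0 hW0, hVm, hWm, hVl, hWl]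
        simp
      obtain ⟨b, c, h3⟩ := hdec (h𝔰.2 _ hE₀ _ hV) hV hW hV0 hW0 hdetVW
      obtain ⟨b'', c'', h4⟩ := hdec (h𝔰.2 _ hE₀ _ hW) hV hW hV0 hW0 hdetVW
      rw [hτbr hE₀ hV _ hp', hVm, hV0, mul_zero, mul_zero, sub_zero] at h3
      rw [hτbr hE₀ hW _ hp', hWm, hW0, mul_zero, mul_zero, sub_zero] at h4
      -- Applying `l` to the two decompositions removes their `V`-terms: `[E₀, V] = cW` and `[E₀, W]
      -- = c''W`.
      have hb := (of_comb (t₀ := p.1) h3).2.2.2.2.2.2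
      have hb'' := (of_comb (t₀ := p.1) h4).2.2.2.2.2.2
      rw [hlbr hE₀ hV, hVl, hWl] at hb
      rw [hlbr hE₀ hW, hVl, hWl] at hb''
      obtain rfl : b = 0 := by linarith
      obtain rfl : b'' = 0 := by linarith
      -- Subtracting the multiple of `V` makes `l_A = 0`. Since `[W, V] = W`, subtracting `cW`
      -- cancels `[E₀, V]`.
      obtain ⟨A, hAdef⟩ : ∃ A, A = (1 : ℝ) • E₀ + (-(of p.1 E₀).l) • V + (-c) • W := ⟨_, rfl⟩
      have hEV : (1 : ℝ) • E₀ + (-(of p.1 E₀).l) • V ∈ 𝔰 :=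
        add_mem (𝔰.smul_mem _ hE₀) (𝔰.smul_mem _ hV)
      have hA : A ∈ 𝔰 := hAdef ▸ add_mem hEV (𝔰.smul_mem _ hW)
      have hbrA : ∀ {X}, X ∈ 𝔰 → lieBracket ℝ A X =
          lieBracket ℝ E₀ X + (-(of p.1 E₀).l) • lieBracket ℝ V X + (-c) • lieBracket ℝ W X :=
        fun {X} hX => by
          have h5 := lieBracket_comb_left hI (h𝔰.1 hEV) (h𝔰.1 hW) (h𝔰.1 hX) 1 (-c)
          rw [one_smul, one_smul ℝ (lieBracket _ _ _)] at h5
          rw [hAdef, h5, lieBracket_comb_left hI (h𝔰.1 hE₀) (h𝔰.1 hV) (h𝔰.1 hX), one_smul]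
      refine ⟨A, hA, V, hV, W, hW, c'' + (of p.1 E₀).l, ?_, ?_, hVl, hWl, hVW, hdetVW, hVWbr,
        ?_, ?_⟩
      · rw [(of_comb hAdef).1, t₀, hV0, hW0]; ring
      · rw [(of_comb hAdef).2.2.2.2.2.2, hVl, hWl]; ring
      · rw [hbrA hV, h3, lieBracket_self, lieBracket_swap', hVWbr]; module
      · rw [hbrA hW, h4, lieBracket_self, hVWbr]; module
  · right; right
    -- Applying `l` to `[E₁, E₂]`, which has no `D^s`-component, shows that `l` is proportional to
    -- `m`. The field `W` chosen below in the kernel of `m` therefore has `l = 0` as well.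
    have hrel : m₂ * l₁ = m₁ * l₂ := by
      have h1 := hbr hE₁ hE₂ t₁ t₂
      have h2 : lieBracket ℝ E₁ E₂ = (0 : ℝ) • E₀ + (1 / 3 * m₂ + l₂) • E₁ +
        (-(1 / 3 * m₁ + l₁)) • E₂ := by rw [h1]; simp [m₁, m₂, l₁, l₂]
      have h3 := (of_comb (t₀ := p.1) h2).2.2.2.2.2.2
      rw [hlbr hE₁ hE₂] at h3
      change 0 = 0 * _ + (1 / 3 * m₂ + l₂) * l₁ + -(1 / 3 * m₁ + l₁) * l₂ at h3
      linarith
    have hN : m₁ ^ 2 + m₂ ^ 2 ≠ 0 := fun h => hm ⟨by nlinarith [sq_nonneg m₁, sq_nonneg m₂],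
      by nlinarith [sq_nonneg m₁, sq_nonneg m₂]⟩
    set N := m₁ ^ 2 + m₂ ^ 2
    obtain ⟨V, hVdef⟩ : ∃ V, V = (0 : ℝ) • E₀ + (m₁ / N) • E₁ + (m₂ / N) • E₂ := ⟨_, rfl⟩
    obtain ⟨W, hWdef⟩ : ∃ W, W = (0 : ℝ) • E₀ + m₂ • E₁ + (-m₁) • E₂ := ⟨_, rfl⟩
    have hV : V ∈ 𝔰 := hVdef ▸ add_mem (add_mem (𝔰.smul_mem _ hE₀) (𝔰.smul_mem _ hE₁))
      (𝔰.smul_mem _ hE₂)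
    have hW : W ∈ 𝔰 := hWdef ▸ add_mem (add_mem (𝔰.smul_mem _ hE₀) (𝔰.smul_mem _ hE₁))
      (𝔰.smul_mem _ hE₂)
    have hVm : deriv (of p.1 V).τ p.1 = 1 := by
      rw [hcomb3 _ _ _ hE₀ hE₁ hE₂ hVdef]
      change 0 * _ + m₁ / N * m₁ + m₂ / N * m₂ = 1
      field_simp; simp only [N]; ring
    have hWm : deriv (of p.1 W).τ p.1 = 0 := by
      rw [hcomb3 _ _ _ hE₀ hE₁ hE₂ hWdef]
      change 0 * _ + m₂ * m₁ + -m₁ * m₂ = 0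
      ring
    have hWl : (of p.1 W).l = 0 := by
      rw [(of_comb hWdef).2.2.2.2.2.2]
      change 0 * _ + m₂ * l₁ + -m₁ * l₂ = 0
      linarith
    have hV0 : (of p.1 V).τ p.1 = 0 := by rw [(of_comb hVdef).1, t₁, t₂]; simp
    have hW0 : (of p.1 W).τ p.1 = 0 := by rw [(of_comb hWdef).1, t₁, t₂]; simp
    have bV : base (V p) = (0, m₁ / N, m₂ / N) := by
      rw [hVdef]; simp [b₁, b₂]
    have bW : base (W p) = (0, m₂, -m₁) := by
      rw [hWdef]; simp [b₁, b₂]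
    have hdetVW : (base (V p)).2.1 * (base (W p)).2.2 - (base (W p)).2.1 * (base (V p)).2.2 ≠ 0 := by
      have : (base (V p)).2.1 * (base (W p)).2.2 - (base (W p)).2.1 * (base (V p)).2.2 = -1 := by
        rw [bV, bW]; field_simp; simp only [N]; ring
      rw [this]; norm_num
    set μ := 1 / 3 + (of p.1 V).l with hμ
    have hVWbr : lieBracket ℝ V W = (-μ) • W := by
      rw [hbr hV hW hV0 hW0, hVm, hWm, hWl]
      simp [μ]
    obtain ⟨b, c, h3⟩ := hdec (h𝔰.2 _ hE₀ _ hV) hV hW hV0 hW0 hdetVW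
    obtain ⟨b', c', h4⟩ := hdec (h𝔰.2 _ hE₀ _ hW) hV hW hV0 hW0 hdetVW
    rw [hτbr hE₀ hV _ hp', hVm, hV0, t₀, mul_zero, mul_one, sub_zero] at h3
    rw [hτbr hE₀ hW _ hp', hWm, hW0, mul_zero, mul_zero, sub_zero] at h4
    have hb := (of_comb (t₀ := p.1) h3).2.2.2.2.2.2
    have hb' := (of_comb (t₀ := p.1) h4).2.2.2.2.2.2
    rw [hlbr hE₀ hV, hWl] at hb
    rw [hlbr hE₀ hW, hWl] at hb'
    -- The known brackets are `[V, W] = -μW`, `[E₀, V] = E₀ + bV + cW` and `[E₀, W] = b'V + c'W`.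
    -- The `V`- and `W`-components of the Jacobi identity give `b'(1 + μ) = 0` and, after `b' = 0`,
    -- also `c' = bμ`.
    have jac : lieBracket ℝ E₀ (lieBracket ℝ V W) p =
        lieBracket ℝ (lieBracket ℝ E₀ V) W p + lieBracket ℝ V (lieBracket ℝ E₀ W) p :=
      leibniz_identity_lieBracket (n := ∞) (by simpa using ENat.LEInfty.out) (contDiffAt_of_mem_algebra hI (h𝔰.1 hE₀) hp)
        (contDiffAt_of_mem_algebra hI (h𝔰.1 hV) hp) (contDiffAt_of_mem_algebra hI (h𝔰.1 hW) hp)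
    have hE3 : lieBracket ℝ (lieBracket ℝ E₀ V) W =
        lieBracket ℝ E₀ W + b • lieBracket ℝ V W := by
      have h5 : (1 : ℝ) • E₀ + b • V ∈ 𝔰 := add_mem (𝔰.smul_mem _ hE₀) (𝔰.smul_mem _ hV)
      have h6 := lieBracket_comb_left hI (h𝔰.1 h5) (h𝔰.1 hW) (h𝔰.1 hW) 1 c
      rw [one_smul, one_smul ℝ (lieBracket _ _ _)] at h6
      rw [h3, h6, lieBracket_comb_left hI (h𝔰.1 hE₀) (h𝔰.1 hV) (h𝔰.1 hW), lieBracket_self]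
      simp
    have hE4 : lieBracket ℝ V (lieBracket ℝ E₀ W) = c' • lieBracket ℝ V W := by
      rw [h4, zero_smul, zero_add, lieBracket_comb_right hI (h𝔰.1 hV) (h𝔰.1 hW) (h𝔰.1 hV),
        lieBracket_self]
      simp
    have hE5 : lieBracket ℝ E₀ (lieBracket ℝ V W) = (-μ) • lieBracket ℝ E₀ W := by
      have h6 := lieBracket_comb_right hI (h𝔰.1 hW) (h𝔰.1 hW) (h𝔰.1 hE₀) (-μ) 0
      simp only [zero_smul, add_zero] at h6
      rw [hVWbr, h6]
    rw [hE3, hE4, hE5, hVWbr, h4] at jac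
    have jac' := congrArg base jac
    simp only [Pi.add_apply, map_add, Pi.smul_apply, map_smul, bV, bW, b₀, Prod.smul_mk,
      Prod.mk_add_mk, smul_eq_mul, Prod.mk.injEq] at jac'
    obtain ⟨-, j1, j2⟩ := jac'
    have k1 : b' * (1 + μ) = 0 := by
      have hNN : m₁ * (m₁ / N) + m₂ * (m₂ / N) = 1 := by field_simp; simp only [N]
      linear_combination (-m₁) * j1 - m₂ * j2 - b' * (1 + μ) * hNN
    -- If `b' ≠ 0`, then `b' l_V = 0` gives `l_V = 0` and hence `μ = 1/3`, contradicting `1 + μ =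
    -- 0`.
    have hb0 : b' = 0 := by
      by_contra hne
      have e1 : (of p.1 V).l = 0 := by
        have : b' * (of p.1 V).l = 0 := by linarith
        exact (mul_eq_zero.1 this).resolve_left hne
      have e2 := (mul_eq_zero.1 k1).resolve_left hne
      rw [hμ, e1] at e2
      norm_num at e2
    subst hb0
    have k2 : c' = b * μ := by
      have h5 : (c' - b * μ) * N = 0 := by
        simp only [N]
        linear_combination m₁ * j2 - m₂ * j1
      linarith [(mul_eq_zero.1 h5).resolve_right hN]
    -- Adding `bV` makes the field commute with `W`, since `[E₀, W] = bμW = -b[V, W]`. The relation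
    -- `l(E₀) + b l_V = 0`, obtained from `[E₀, V]`, gives `l_A = 0`.
    obtain ⟨A, hAdef⟩ : ∃ A, A = (1 : ℝ) • E₀ + b • V + (0 : ℝ) • W := ⟨_, rfl⟩
    have hAdef' : A = (1 : ℝ) • E₀ + b • V := by rw [hAdef]; simp
    have hA : A ∈ 𝔰 := hAdef' ▸ add_mem (𝔰.smul_mem _ hE₀) (𝔰.smul_mem _ hV)
    refine ⟨A, hA, W, hW, ?_, ?_, hWl, ?_, ?_, ?_⟩
    · rw [(of_comb hAdef).1, t₀, hV0, hW0]; ring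
    · rw [(of_comb hAdef).2.2.2.2.2.2]; linarith
    · refine (hsys hW hW 0 c' 0 c' ?_ ?_ hW0 hW0).mono fun t ht => ht.1
      · rw [h4]; simp
      · rw [h4]; simp
    · have h5 := hbase hW
      rw [bW, hWm, hWl] at h5
      simp only [mul_zero, zero_mul, zero_add, Prod.mk.injEq] at h5
      by_contra hcon
      push Not at hcon
      rw [hcon.1, hcon.2] at h5
      exact hm ⟨by linarith [h5.2.2], h5.2.1⟩
    · rw [hAdef', lieBracket_comb_left hI (h𝔰.1 hE₀) (h𝔰.1 hV) (h𝔰.1 hW), h4, hVWbr, k2]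
      module

end Trichotomy

end DN

namespace DN

open Set Filter Topology

/-! ### Transformations and pushforwards -/

theorem deriv_eq_zero_of_zeroOn {J : Set ℝ} (hJ : IsOpen J) {f : ℝ → ℝ} (h : ∀ t ∈ J, f t = 0) :
    ∀ t ∈ J, deriv f t = 0 := fun t ht => by
  rw [(eventuallyEq_of_mem (hJ.mem_nhds ht) (g := fun _ => 0) h).deriv_eq]
  simp

theorem contDiffOn_polyTransf (C : ℝ) {D : Set Space} {T k a b₁ b₂ X Y W₀ W₁ W₂ : Space → ℝ}
    (hT : ContDiffOn ℝ ∞ T D) (hk : ContDiffOn ℝ ∞ k D) (ha : ContDiffOn ℝ ∞ a D)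
    (hb₁ : ContDiffOn ℝ ∞ b₁ D) (hb₂ : ContDiffOn ℝ ∞ b₂ D)
    (hX : ContDiffOn ℝ ∞ X D) (hY : ContDiffOn ℝ ∞ Y D) (hW₀ : ContDiffOn ℝ ∞ W₀ D)
    (hW₁ : ContDiffOn ℝ ∞ W₁ D) (hW₂ : ContDiffOn ℝ ∞ W₂ D) :
    ContDiffOn ℝ ∞ (fun p : Space => (T p, C * p.2.1 * k p + X p, C * p.2.2.1 * k p + Y p,
      C ^ 3 * p.2.2.2 + C ^ 3 * a p * (p.2.1 ^ 3 + p.2.2.1 ^ 3)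
        - C ^ 2 / 2 * (b₁ p * p.2.1 ^ 2 + b₂ p * p.2.2.1 ^ 2)
        + W₁ p * p.2.1 + W₂ p * p.2.2.1 + W₀ p)) D := by
  fun_prop

/-- The point-symmetry transformation with `T_t = χ⁻³`. -/
theorem exists_transf {J : Set ℝ} (hJ : IsOpen J) (hJ' : J.OrdConnected) {χ X Y W₀ W₁ W₂ : ℝ → ℝ}
    (hχ : ContDiffOn ℝ ∞ χ J) (hpos : ∀ t ∈ J, 0 < χ t) {C : ℝ} (hC : C ≠ 0)
    (hX : ContDiffOn ℝ ∞ X J) (hY : ContDiffOn ℝ ∞ Y J) (hW₀ : ContDiffOn ℝ ∞ W₀ J)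
    (hW₁ : ContDiffOn ℝ ∞ W₁ J) (hW₂ : ContDiffOn ℝ ∞ W₂ J) :
    ∃ (T S : ℝ → ℝ) (Φ : Space → Space), PointSym J (T '' J) Φ ∧
      ContDiffOn ℝ ∞ S (T '' J) ∧ (∀ t ∈ J, S (T t) = t) ∧
      (∀ t ∈ J, HasDerivAt S (χ t ^ 3) (T t)) ∧
      (∀ t ∈ J, ∀ x y u, Φ (t, x, y, u) = (T t, C * x / χ t + X t, C * y / χ t + Y t,
        C ^ 3 * u + C ^ 3 * (deriv χ t / (6 * χ t)) * (x ^ 3 + y ^ 3)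
          - C ^ 2 / 2 * (χ t * deriv X t * x ^ 2 + χ t * deriv Y t * y ^ 2)
          + W₁ t * x + W₂ t * y + W₀ t)) ∧
      (∀ t ∈ J, ∀ x y u a b e f, fderiv ℝ Φ (t, x, y, u) (a, b, e, f) =
        (a / χ t ^ 3, C * (b / χ t - x * deriv χ t * a / χ t ^ 2) + deriv X t * a,
          C * (e / χ t - y * deriv χ t * a / χ t ^ 2) + deriv Y t * a,
          C ^ 3 * f + C ^ 3 * (deriv (fun s => deriv χ s / (6 * χ s)) t * a * (x ^ 3 + y ^ 3) +
            deriv χ t / (6 * χ t) * (3 * x ^ 2 * b + 3 * y ^ 2 * e))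
          - C ^ 2 / 2 * (deriv (fun s => χ s * deriv X s) t * a * x ^ 2
            + χ t * deriv X t * (2 * x * b) + deriv (fun s => χ s * deriv Y s) t * a * y ^ 2
            + χ t * deriv Y t * (2 * y * e))
          + deriv W₁ t * a * x + W₁ t * b + deriv W₂ t * a * y + W₂ t * e + deriv W₀ t * a)) := by
  have hne : ∀ t ∈ J, χ t ≠ 0 := fun t ht => (hpos t ht).ne'
  -- With `T_t = χ⁻³` the coefficient `C T_t^{1/3}` is `C/χ`, so `χ∂_x` is mapped to `C∂_x`, and
  -- `-T_tt/(18T_t) = χ_t/(6χ)`.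
  obtain ⟨T, hT, hT'⟩ := exists_antideriv hJ hJ' (hχ.inv hne |>.pow 3)
  have hdT : ∀ t ∈ J, deriv T t = (χ t)⁻¹ ^ 3 := fun t ht => (hT' t ht).deriv
  have hdTpos : ∀ t ∈ J, 0 < deriv T t := fun t ht => by
    rw [hdT t ht]
    have := hpos t ht
    positivity
  have hddT : ∀ t ∈ J, deriv (deriv T) t = -3 * deriv χ t / χ t ^ 4 := fun t ht => by
    rw [(eventuallyEq_of_mem (hJ.mem_nhds ht) hdT).deriv_eq]
    have h0 := hne t ht
    refine (((smooth_hasDerivAt hJ hχ ht).inv h0).pow 3).deriv.trans ?_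
    norm_num
    field_simp
  obtain ⟨-, S, hS, hST, hS'⟩ := exists_smooth_inverse hJ hJ' hT hdTpos
  have hval : ∀ t ∈ J, ∀ x y u, pointTransf C T X Y W₀ W₁ W₂ (t, x, y, u) =
      (T t, C * x / χ t + X t, C * y / χ t + Y t,
        C ^ 3 * u + C ^ 3 * (deriv χ t / (6 * χ t)) * (x ^ 3 + y ^ 3)
          - C ^ 2 / 2 * (χ t * deriv X t * x ^ 2 + χ t * deriv Y t * y ^ 2)
          + W₁ t * x + W₂ t * y + W₀ t) := fun t ht x y u => by
    have h0 := hne t ht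
    have hc : cbrt (deriv T t) = (χ t)⁻¹ := by
      rw [hdT t ht, cbrt_pow_three (inv_pos.2 (hpos t ht))]
    simp only [pointTransf, hc]
    simp only [hdT t ht, hddT t ht, Prod.mk.injEq, true_and]
    refine ⟨by ring, by ring, ?_⟩
    field_simp
    ring
  refine ⟨T, S, pointTransf C T X Y W₀ W₁ W₂, PointSym.transf J hJ hJ' C hC T X Y W₀ W₁ W₂ hT
    (fun t ht => (hdTpos t ht).ne') hX hY hW₀ hW₁ hW₂, hS, hST, fun t ht => ?_, hval, ?_⟩
  · refine (hS' t ht).congr_deriv ?_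
    rw [hdT t ht, inv_pow, inv_inv]
  intro t ht x y u a b e f
  have h0 := hne t ht
  have hopen := isOpen_strip hJ
  have hmem : ((t, x, y, u) : Space) ∈ strip J := ht
  have hm : MapsTo (fun p : Space => p.1) (strip J) J := fun p hp => hp
  have hp {f : ℝ → ℝ} (hf : ContDiffOn ℝ ∞ f J) :
      ContDiffOn ℝ ∞ (fun p : Space => f p.1) (strip J) := hf.comp contDiffOn_fst hm
  have s1 : ContDiffOn ℝ ∞ (fun t => (χ t)⁻¹) J := hχ.inv hne
  have s2 : ContDiffOn ℝ ∞ (fun t => deriv χ t / (6 * χ t)) J :=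
    (smooth_deriv hJ hχ).div (contDiffOn_const.mul hχ) fun t ht => by simp [hne t ht]
  have s3 : ContDiffOn ℝ ∞ (fun t => χ t * deriv X t) J := hχ.mul (smooth_deriv hJ hX)
  have s4 : ContDiffOn ℝ ∞ (fun t => χ t * deriv Y t) J := hχ.mul (smooth_deriv hJ hY)
  set Ψ : Space → Space := fun p => (T p.1, C * p.2.1 * (χ p.1)⁻¹ + X p.1,
    C * p.2.2.1 * (χ p.1)⁻¹ + Y p.1,
    C ^ 3 * p.2.2.2 + C ^ 3 * (deriv χ p.1 / (6 * χ p.1)) * (p.2.1 ^ 3 + p.2.2.1 ^ 3)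
      - C ^ 2 / 2 * ((χ p.1 * deriv X p.1) * p.2.1 ^ 2 + (χ p.1 * deriv Y p.1) * p.2.2.1 ^ 2)
      + W₁ p.1 * p.2.1 + W₂ p.1 * p.2.2.1 + W₀ p.1)
  have hEq : pointTransf C T X Y W₀ W₁ W₂ =ᶠ[𝓝 (t, x, y, u)] Ψ := by
    filter_upwards [hopen.mem_nhds hmem] with p hp
    exact hval p.1 hp p.2.1 p.2.2.1 p.2.2.2
  have hdiff : DifferentiableAt ℝ Ψ (t, x, y, u) := by
    refine ContDiffAt.differentiableAt (n := ∞) (ContDiffOn.contDiffAt (s := strip J) ?_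
      (hopen.mem_nhds hmem)) (by simp)
    exact contDiffOn_polyTransf C (hp hT) (hp s1) (hp s2) (hp s3) (hp s4) (hp hX) (hp hY) (hp hW₀)
      (hp hW₁) (hp hW₂)
  rw [hEq.fderiv_eq]
  refine fderiv_apply_eq_of_line hdiff ?_
  have L {f : ℝ → ℝ} (hf : ContDiffOn ℝ ∞ f J) :
      HasDerivAt (fun s => f (t + s * a)) (deriv f t * a) 0 :=
    hasDerivAt_comp_line (smooth_hasDerivAt hJ hf ht)
  have hx := hasDerivAt_line x b
  have hy := hasDerivAt_line y e
  have hu := hasDerivAt_line u f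
  simp only [Ψ, Prod.smul_mk, Prod.mk_add_mk, smul_eq_mul]
  have hinv : deriv (fun t => (χ t)⁻¹) t = -deriv χ t / χ t ^ 2 :=
    ((smooth_hasDerivAt hJ hχ ht).inv h0).deriv
  refine HasDerivAt.prodMk ?_ (HasDerivAt.prodMk ?_ (HasDerivAt.prodMk ?_ ?_))
  · refine (L hT).congr_deriv ?_
    rw [hdT t ht, inv_pow]; ring
  · refine (((hx.const_mul C).mul (L s1)).add (L hX)).congr_deriv ?_
    rw [hinv]
    simp only [zero_mul, add_zero]
    field_simp
    ring
  · refine (((hy.const_mul C).mul (L s1)).add (L hY)).congr_deriv ?_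
    rw [hinv]
    simp only [zero_mul, add_zero]
    field_simp
    ring
  · refine (((((((hu.const_mul (C ^ 3)).add (((L s2).const_mul (C ^ 3)).mul
      ((hx.pow 3).add (hy.pow 3)))).sub ((((L s3).mul (hx.pow 2)).add
      ((L s4).mul (hy.pow 2))).const_mul (C ^ 2 / 2))).add ((L hW₁).mul hx)).add
      ((L hW₂).mul hy)).add (L hW₀))).congr_deriv ?_
    simp
    ring

/-- `𝔰` contains, over `J`, the vector field with the parameters `c`. -/
def HasFld (𝔰 : Submodule ℝ (Space → Space)) (J : Set ℝ) (c : Coef) : Prop :=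
  ∃ V ∈ 𝔰, EqOn V c.fld (strip J)

theorem HasFld.mono {𝔰 : Submodule ℝ (Space → Space)} {J K : Set ℝ} {c : Coef}
    (h : HasFld 𝔰 J c) (hK : K ⊆ J) : HasFld 𝔰 K c :=
  h.imp fun _ hV => ⟨hV.1, hV.2.mono fun _ hp => hK hp⟩

theorem pushforwardContains_span {J : Set ℝ} {Φ : Space → Space}
    {𝔰 : Submodule ℝ (Space → Space)} {S : Set (Space → Space)}
    (h : ∀ W ∈ S, ∃ V ∈ 𝔰, ∀ p ∈ strip J, W (Φ p) = fderiv ℝ Φ p (V p)) :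
    PushforwardContains J Φ 𝔰 (Submodule.span ℝ S) := by
  intro W hW
  induction hW using Submodule.span_induction with
  | mem W hW => exact h W hW
  | zero => exact ⟨0, 𝔰.zero_mem, by simp⟩
  | add A B _ _ hA hB =>
    obtain ⟨V, hV, h1⟩ := hA
    obtain ⟨V', hV', h2⟩ := hB
    exact ⟨V + V', 𝔰.add_mem hV hV', fun p hp => by simp [h1 p hp, h2 p hp]⟩
  | smul k A _ hA =>
    obtain ⟨V, hV, h1⟩ := hA
    exact ⟨k • V, 𝔰.smul_mem k hV, fun p hp => by simp [h1 p hp]⟩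

/-- The vector field `k V` of `𝔰`, where `V` has the parameters `c`, is mapped to `G`. -/
theorem HasFld.exists_pushforward {𝔰 : Submodule ℝ (Space → Space)} {J J' : Set ℝ} {c : Coef}
    (h : HasFld 𝔰 J c) (k : ℝ) {Φ G : Space → Space} (hΦ : ∀ p ∈ strip J, (Φ p).1 ∈ J')
    (hG : ∀ t ∈ J, ∀ x y u, G (Φ (t, x, y, u)) =
      k • fderiv ℝ Φ (t, x, y, u) (c.fld (t, x, y, u))) :
    ∃ V ∈ 𝔰, ∀ p ∈ strip J, onStrip J' G (Φ p) = fderiv ℝ Φ p (V p) := by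
  obtain ⟨V, hV, hV'⟩ := h
  refine ⟨k • V, 𝔰.smul_mem k hV, fun p hp => ?_⟩
  rw [onStrip, indicator_of_mem (show Φ p ∈ strip J' from hΦ p hp), Pi.smul_apply, map_smul,
    hV' hp]
  exact hG p.1 hp p.2.1 p.2.2.1 p.2.2.2

/-! ### Swapping `x` and `y` -/

/-- The permutation of `x` and `y` as a linear map. -/
noncomputable def swapL : Space ≃L[ℝ] Space :=
  LinearEquiv.toContinuousLinearEquiv
    { toFun := swapXY
      map_add' := fun _ _ => rfl
      map_smul' := fun _ _ => rfl
      invFun := swapXY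
      left_inv := fun _ => rfl
      right_inv := fun _ => rfl }

theorem coe_swapL : (swapL : Space → Space) = swapXY := rfl

/-- The image of a space of vector fields under the permutation of `x` and `y`. -/
def swapSub (𝔰 : Submodule ℝ (Space → Space)) : Submodule ℝ (Space → Space) where
  carrier := {V | (fun p => swapXY (V (swapXY p))) ∈ 𝔰}
  add_mem' hV hW := 𝔰.add_mem hV hW
  zero_mem' := 𝔰.zero_mem
  smul_mem' k _ hV := 𝔰.smul_mem k hV

def Coef.swap (c : Coef) : Coef := ⟨c.τ, c.ρ, c.χ, c.β, c.α, c.σ, c.l⟩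

theorem Coef.SmoothOn.swap {c : Coef} {J : Set ℝ} (h : c.SmoothOn J) : c.swap.SmoothOn J :=
  ⟨h.τ, h.ρ, h.χ, h.β, h.α, h.σ⟩

theorem HasFld.swap {𝔰 : Submodule ℝ (Space → Space)} {J : Set ℝ} {c : Coef}
    (h : HasFld 𝔰 J c) : HasFld (swapSub 𝔰) J c.swap := by
  obtain ⟨V, hV, hV'⟩ := h
  refine ⟨fun p => swapXY (V (swapXY p)), hV, fun p hp => ?_⟩
  have : V (swapXY p) = c.fld (swapXY p) := hV' (show swapXY p ∈ strip J from hp)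
  change swapXY (V (swapXY p)) = _
  rw [this]
  simp only [swapXY, Coef.fld, Coef.swap, Prod.mk.injEq, true_and]
  ring

/-- Near `t₀`, the subalgebra contains a treated subalgebra up to equivalence. -/
def LocallyTreated (I : Set ℝ) (𝔰 : Submodule ℝ (Space → Space)) (t₀ : ℝ) : Prop :=
  ∃ (J J' : Set ℝ) (Φ : Space → Space), t₀ ∈ J ∧ J ⊆ I ∧ PointSym J J' Φ ∧
    ContainsTreated J J' Φ 𝔰

theorem PushforwardContains.swap {J : Set ℝ} {Φ : Space → Space}
    {𝔰 𝔯 : Submodule ℝ (Space → Space)} (h : PushforwardContains J Φ (swapSub 𝔰) 𝔯) :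
    PushforwardContains J (Φ ∘ swapXY) 𝔰 𝔯 := by
  intro W hW
  obtain ⟨V, hV, h1⟩ := h W hW
  refine ⟨fun p => swapXY (V (swapXY p)), hV, fun p hp => ?_⟩
  have h2 := h1 (swapXY p) hp
  rw [Function.comp_apply, h2]
  have h3 := swapL.comp_right_fderiv (f := Φ) (x := p)
  rw [coe_swapL] at h3
  rw [h3]
  rfl

theorem PointSym.isOpen_ordConnected {J J' : Set ℝ} {Φ : Space → Space} (h : PointSym J J' Φ) :
    IsOpen J ∧ J.OrdConnected := by
  induction h with
  | transf J hJ hJ' => exact ⟨hJ, hJ'⟩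
  | swap J hJ hJ' => exact ⟨hJ, hJ'⟩
  | comp J J' J'' Φ Ψ _ _ h _ => exact h

/-- Composition with the permutation. It lets the constructions below assume that the
`∂_x`-component is the nonvanishing, or the larger, one. -/
theorem LocallyTreated.of_swap {I : Set ℝ} {𝔰 : Submodule ℝ (Space → Space)} {t₀ : ℝ}
    (h : LocallyTreated I (swapSub 𝔰) t₀) : LocallyTreated I 𝔰 t₀ := by
  obtain ⟨J, J', Φ, h1, h2, h3, h4⟩ := h
  have hJ := h3.isOpen_ordConnected
  refine ⟨J, J', Φ ∘ swapXY, h1, h2, PointSym.comp J J J' swapXY Φ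
    (PointSym.swap J hJ.1 hJ.2) h3, ?_⟩
  rcases h4 with ⟨ν, hν, δ, hδ, h⟩ | ⟨ρ, hρ, h⟩ | ⟨ρ, β, hρ, hβ, h0, h, h'⟩
  · exact Or.inl ⟨ν, hν, δ, hδ, h.swap⟩
  · exact Or.inr (Or.inl ⟨ρ, hρ, h.swap⟩)
  · exact Or.inr (Or.inr ⟨ρ, β, hρ, hβ, h0, h.swap, h'.swap⟩)

end DN

namespace DN

open Set Filter Topology VectorField

/-! ### The three types of subalgebras of rank three -/

theorem exists_interval {J : Set ℝ} (hJ : IsOpen J) {t₀ : ℝ} (ht₀ : t₀ ∈ J) {P : ℝ → Prop}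
    (hP : ∀ᶠ t in 𝓝 t₀, P t) :
    ∃ K ⊆ J, IsOpen K ∧ K.OrdConnected ∧ t₀ ∈ K ∧ ∀ t ∈ K, P t := by
  obtain ⟨ε, hε, h⟩ := Metric.eventually_nhds_iff_ball.1 ((hJ.eventually_mem ht₀).and hP)
  exact ⟨Metric.ball t₀ ε, fun t ht => (h t ht).1, Metric.isOpen_ball,
    (convex_ball t₀ ε).ordConnected, Metric.mem_ball_self hε, fun t ht => (h t ht).2⟩

namespace Coef

/-- The parameters of `k V`. -/
def scale (k : ℝ) (c : Coef) : Coef :=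
  ⟨fun t => k * c.τ t, fun t => k * c.χ t, fun t => k * c.ρ t, fun t => k * c.α t,
    fun t => k * c.β t, fun t => k * c.σ t, k * c.l⟩

/-- The parameters of `V + k W`. -/
def shift (a : Coef) (k : ℝ) (w : Coef) : Coef :=
  ⟨fun t => a.τ t + k * w.τ t, fun t => a.χ t + k * w.χ t, fun t => a.ρ t + k * w.ρ t,
    fun t => a.α t + k * w.α t, fun t => a.β t + k * w.β t, fun t => a.σ t + k * w.σ t,
    a.l + k * w.l⟩

variable {J : Set ℝ} {a w : Coef}

theorem SmoothOn.scale (k : ℝ) (h : w.SmoothOn J) : (w.scale k).SmoothOn J :=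
  ⟨contDiffOn_const.mul h.τ, contDiffOn_const.mul h.χ, contDiffOn_const.mul h.ρ,
    contDiffOn_const.mul h.α, contDiffOn_const.mul h.β, contDiffOn_const.mul h.σ⟩

theorem SmoothOn.shift (k : ℝ) (ha : a.SmoothOn J) (h : w.SmoothOn J) :
    (a.shift k w).SmoothOn J :=
  ⟨ha.τ.add (contDiffOn_const.mul h.τ), ha.χ.add (contDiffOn_const.mul h.χ),
    ha.ρ.add (contDiffOn_const.mul h.ρ), ha.α.add (contDiffOn_const.mul h.α),
    ha.β.add (contDiffOn_const.mul h.β), ha.σ.add (contDiffOn_const.mul h.σ)⟩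

end Coef

theorem HasFld.scale {𝔰 : Submodule ℝ (Space → Space)} {J : Set ℝ} {c : Coef}
    (h : HasFld 𝔰 J c) (k : ℝ) : HasFld 𝔰 J (c.scale k) := by
  obtain ⟨V, hV, hV'⟩ := h
  refine ⟨k • V, 𝔰.smul_mem k hV, fun p hp => ?_⟩
  rw [Pi.smul_apply, hV' hp]
  simp only [Coef.fld, Coef.scale, deriv_const_mul_field', Prod.smul_mk, smul_eq_mul,
    Prod.mk.injEq]
  refine ⟨trivial, ?_, ?_, ?_⟩ <;> ring

theorem HasFld.shift {𝔰 : Submodule ℝ (Space → Space)} {J : Set ℝ} (hJ : IsOpen J) {a w : Coef}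
    (ha : a.SmoothOn J) (hw : w.SmoothOn J) (h : HasFld 𝔰 J a) (h' : HasFld 𝔰 J w) (k : ℝ) :
    HasFld 𝔰 J (a.shift k w) := by
  obtain ⟨V, hV, hV'⟩ := h
  obtain ⟨W, hW, hW'⟩ := h'
  refine ⟨V + k • W, 𝔰.add_mem hV (𝔰.smul_mem k hW), fun p hp => ?_⟩
  have ht : p.1 ∈ J := hp
  have D {f g : ℝ → ℝ} (hf : ContDiffOn ℝ ∞ f J) (hg : ContDiffOn ℝ ∞ g J) :
      ∀ t ∈ J, deriv (fun t => f t + k * g t) t = deriv f t + k * deriv g t := fun t ht =>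
    ((smooth_hasDerivAt hJ hf ht).add ((smooth_hasDerivAt hJ hg ht).const_mul k)).deriv
  have hdd : deriv (deriv fun t => a.τ t + k * w.τ t) p.1 =
      deriv (deriv a.τ) p.1 + k * deriv (deriv w.τ) p.1 := by
    rw [(eventuallyEq_of_mem (hJ.mem_nhds ht) (D ha.τ hw.τ)).deriv_eq]
    exact D (smooth_deriv hJ ha.τ) (smooth_deriv hJ hw.τ) _ ht
  rw [Pi.add_apply, Pi.smul_apply, hV' hp, hW' hp]
  simp only [Coef.fld, Coef.shift, hdd, D ha.τ hw.τ _ ht, D ha.χ hw.χ _ ht, D ha.ρ hw.ρ _ ht,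
    Prod.smul_mk, smul_eq_mul, Prod.mk_add_mk, Prod.mk.injEq]
  refine ⟨trivial, ?_, ?_, ?_⟩ <;> ring

/-- `𝔰` contains two commuting vector fields `P^x(χ) + …` and `P^y(ρ) + …` and a vector field
with nonvanishing `t`-component. -/
structure TypeA (𝔰 : Submodule ℝ (Space → Space)) (J : Set ℝ) (e v w : Coef) : Prop where
  se : e.SmoothOn J
  sv : v.SmoothOn J
  sw : w.SmoothOn J
  he : HasFld 𝔰 J e
  hv : HasFld 𝔰 J v
  hw : HasFld 𝔰 J w
  eτ : ∀ t ∈ J, e.τ t ≠ 0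
  vτ : ∀ t ∈ J, v.τ t = 0
  wτ : ∀ t ∈ J, w.τ t = 0
  vl : v.l = 0
  wl : w.l = 0
  vχ : ∀ t ∈ J, 0 < v.χ t
  vρ : ∀ t ∈ J, v.ρ t = 0
  wχ : ∀ t ∈ J, w.χ t = 0
  wρ : ∀ t ∈ J, w.ρ t ≠ 0
  rel : ∀ t ∈ J, v.χ t * w.α t = w.ρ t * v.β t

/-- `𝔰` contains a vector field `V = D^s + …` and a vector field `W = P^x(χ) + P^y(ρ) + …` with
`[V, W] = -W` and proportional `χ` and `ρ`. -/
structure TypeB (𝔰 : Submodule ℝ (Space → Space)) (J : Set ℝ) (v w : Coef) : Prop where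
  sv : v.SmoothOn J
  sw : w.SmoothOn J
  hv : HasFld 𝔰 J v
  hw : HasFld 𝔰 J w
  vτ : ∀ t ∈ J, v.τ t = 0
  wτ : ∀ t ∈ J, w.τ t = 0
  vl : v.l = 1
  wl : w.l = 0
  rχρ : ∀ t ∈ J, deriv w.χ t * w.ρ t = w.χ t * deriv w.ρ t
  rα : ∀ t ∈ J, w.α t = deriv v.χ t * w.χ t - v.χ t * deriv w.χ t
  rβ : ∀ t ∈ J, w.β t = deriv v.ρ t * w.ρ t - v.ρ t * deriv w.ρ t
  rσ : ∀ t ∈ J, 2 * w.σ t = v.χ t * w.α t - w.χ t * v.α t + (v.ρ t * w.β t - w.ρ t * v.β t)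

/-- `𝔰` contains commuting vector fields `A = D^t(τ) + P^x(χ') + …` and
`W = P^x(χ) + P^y(ρ) + …`. -/
structure TypeC (𝔰 : Submodule ℝ (Space → Space)) (J : Set ℝ) (a w : Coef) : Prop where
  sa : a.SmoothOn J
  sw : w.SmoothOn J
  ha : HasFld 𝔰 J a
  hw : HasFld 𝔰 J w
  aτ : ∀ t ∈ J, a.τ t ≠ 0
  wτ : ∀ t ∈ J, w.τ t = 0
  al : a.l = 0
  wl : w.l = 0
  rχ : ∀ t ∈ J, a.τ t * deriv w.χ t = 1 / 3 * deriv a.τ t * w.χ t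
  rρ : ∀ t ∈ J, a.τ t * deriv w.ρ t = 1 / 3 * deriv a.τ t * w.ρ t
  rα : ∀ t ∈ J, a.τ t * deriv w.α t + 1 / 3 * deriv a.τ t * w.α t =
    a.χ t * deriv w.χ t - deriv a.χ t * w.χ t
  rβ : ∀ t ∈ J, a.τ t * deriv w.β t + 1 / 3 * deriv a.τ t * w.β t =
    a.ρ t * deriv w.ρ t - deriv a.ρ t * w.ρ t
  rσ : ∀ t ∈ J, a.τ t * deriv w.σ t +
    (a.χ t * w.α t - w.χ t * a.α t + (a.ρ t * w.β t - w.ρ t * a.β t)) = 0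

section Types

variable {𝔰 : Submodule ℝ (Space → Space)} {I J K : Set ℝ} {a e v w : Coef}

theorem TypeA.mono (h : TypeA 𝔰 J e v w) (hK : K ⊆ J) : TypeA 𝔰 K e v w :=
  ⟨h.se.mono hK, h.sv.mono hK, h.sw.mono hK, h.he.mono hK, h.hv.mono hK, h.hw.mono hK,
    fun t ht => h.eτ t (hK ht), fun t ht => h.vτ t (hK ht), fun t ht => h.wτ t (hK ht), h.vl, h.wl,
    fun t ht => h.vχ t (hK ht), fun t ht => h.vρ t (hK ht), fun t ht => h.wχ t (hK ht),
    fun t ht => h.wρ t (hK ht), fun t ht => h.rel t (hK ht)⟩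

theorem TypeB.mono (h : TypeB 𝔰 J v w) (hK : K ⊆ J) : TypeB 𝔰 K v w :=
  ⟨h.sv.mono hK, h.sw.mono hK, h.hv.mono hK, h.hw.mono hK, fun t ht => h.vτ t (hK ht),
    fun t ht => h.wτ t (hK ht), h.vl, h.wl, fun t ht => h.rχρ t (hK ht),
    fun t ht => h.rα t (hK ht), fun t ht => h.rβ t (hK ht), fun t ht => h.rσ t (hK ht)⟩

theorem TypeC.mono (h : TypeC 𝔰 J a w) (hK : K ⊆ J) : TypeC 𝔰 K a w :=
  ⟨h.sa.mono hK, h.sw.mono hK, h.ha.mono hK, h.hw.mono hK, fun t ht => h.aτ t (hK ht),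
    fun t ht => h.wτ t (hK ht), h.al, h.wl, fun t ht => h.rχ t (hK ht),
    fun t ht => h.rρ t (hK ht), fun t ht => h.rα t (hK ht), fun t ht => h.rβ t (hK ht),
    fun t ht => h.rσ t (hK ht)⟩

theorem TypeB.swap (h : TypeB 𝔰 J v w) : TypeB (swapSub 𝔰) J v.swap w.swap :=
  ⟨h.sv.swap, h.sw.swap, h.hv.swap, h.hw.swap, h.vτ, h.wτ, h.vl, h.wl,
    fun t ht => by have := h.rχρ t ht; simp only [Coef.swap]; linarith, h.rβ, h.rα,
    fun t ht => by have := h.rσ t ht; simp only [Coef.swap]; linarith⟩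

theorem TypeC.swap (h : TypeC 𝔰 J a w) : TypeC (swapSub 𝔰) J a.swap w.swap :=
  ⟨h.sa.swap, h.sw.swap, h.ha.swap, h.hw.swap, h.aτ, h.wτ, h.al, h.wl, h.rρ, h.rχ, h.rβ, h.rα,
    fun t ht => by have := h.rσ t ht; simp only [Coef.swap]; linarith⟩

theorem TypeB.scale (h : TypeB 𝔰 J v w) (k : ℝ) : TypeB 𝔰 J v (w.scale k) := by
  refine ⟨h.sv, h.sw.scale k, h.hv, h.hw.scale k, h.vτ, fun t ht => ?_, h.vl, ?_,
    fun t ht => ?_, fun t ht => ?_, fun t ht => ?_, fun t ht => ?_⟩ <;>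
    simp only [Coef.scale, deriv_const_mul_field']
  · rw [h.wτ t ht, mul_zero]
  · rw [h.wl, mul_zero]
  · linear_combination k ^ 2 * h.rχρ t ht
  · linear_combination k * h.rα t ht
  · linear_combination k * h.rβ t ht
  · linear_combination k * h.rσ t ht

theorem TypeC.scale (h : TypeC 𝔰 J a w) (k : ℝ) : TypeC 𝔰 J a (w.scale k) := by
  refine ⟨h.sa, h.sw.scale k, h.ha, h.hw.scale k, h.aτ, fun t ht => ?_, h.al, ?_,
    fun t ht => ?_, fun t ht => ?_, fun t ht => ?_, fun t ht => ?_, fun t ht => ?_⟩ <;>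
    simp only [Coef.scale, deriv_const_mul_field']
  · rw [h.wτ t ht, mul_zero]
  · rw [h.wl, mul_zero]
  · linear_combination k * h.rχ t ht
  · linear_combination k * h.rρ t ht
  · linear_combination k * h.rα t ht
  · linear_combination k * h.rβ t ht
  · linear_combination k * h.rσ t ht

/-- For a field `W` of type C and the shifted field `A + k W`; here all parameters of `W` are
proportional in the sense of the commutation relations. -/
theorem TypeC.shift (hJ : IsOpen J) (h : TypeC 𝔰 J a w) (k : ℝ) : TypeC 𝔰 J (a.shift k w) w := by
  have e1 : EqOn (a.shift k w).τ a.τ J := fun t ht => by simp [Coef.shift, h.wτ t ht]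
  have e2 : ∀ t ∈ J, deriv (a.shift k w).τ t = deriv a.τ t := fun t ht =>
    (e1.eventuallyEq_of_mem (hJ.mem_nhds ht)).deriv_eq
  have e3 : ∀ t ∈ J, deriv (a.shift k w).χ t = deriv a.χ t + k * deriv w.χ t := fun t ht =>
    ((smooth_hasDerivAt hJ h.sa.χ ht).add ((smooth_hasDerivAt hJ h.sw.χ ht).const_mul k)).deriv
  have e4 : ∀ t ∈ J, deriv (a.shift k w).ρ t = deriv a.ρ t + k * deriv w.ρ t := fun t ht =>
    ((smooth_hasDerivAt hJ h.sa.ρ ht).add ((smooth_hasDerivAt hJ h.sw.ρ ht).const_mul k)).deriv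
  refine ⟨h.sa.shift k h.sw, h.sw, h.ha.shift hJ h.sa h.sw h.hw k, h.hw, fun t ht => ?_, h.wτ, ?_,
    h.wl, fun t ht => ?_, fun t ht => ?_, fun t ht => ?_, fun t ht => ?_, fun t ht => ?_⟩
  · rw [e1 ht]; exact h.aτ t ht
  · simp [Coef.shift, h.al, h.wl]
  · rw [e1 ht, e2 t ht]; exact h.rχ t ht
  · rw [e1 ht, e2 t ht]; exact h.rρ t ht
  · rw [e1 ht, e2 t ht, e3 t ht]; simp only [Coef.shift]; linear_combination h.rα t ht
  · rw [e1 ht, e2 t ht, e4 t ht]; simp only [Coef.shift]; linear_combination h.rβ t ht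
  · rw [e1 ht]; simp only [Coef.shift]; linear_combination h.rσ t ht

/-- The bracket relations of `trichotomy` are compared parameter by parameter, over an interval
where the relevant functions have no zeros and the parameters `τ` of the translations vanish. -/
theorem exists_type {p : Space} (hI : IsOpen I) (h𝔰 : IsSubalgebra I 𝔰)
    (hdim : Module.finrank ℝ 𝔰 = 3) (hp : p ∈ strip I) (hr : rankAt 𝔰 p = 3) :
    ∃ J ⊆ I, IsOpen J ∧ J.OrdConnected ∧ p.1 ∈ J ∧
      ((∃ e v w, TypeA 𝔰 J e v w) ∨
      (∃ v w, TypeB 𝔰 J v w ∧ (p.2.1 + v.χ p.1) * w.ρ p.1 - w.χ p.1 * (p.2.2.1 + v.ρ p.1) ≠ 0) ∨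
      (∃ a w, TypeC 𝔰 J a w ∧ a.τ p.1 = 1 ∧ (w.χ p.1 ≠ 0 ∨ w.ρ p.1 ≠ 0))) := by
  have hp' : p.1 ∈ I := hp
  have hspec := fun {V} (hV : V ∈ 𝔰) => Coef.of_spec hI hp (h𝔰.1 hV)
  have hfld : ∀ {V}, V ∈ 𝔰 → ∀ {J}, J ⊆ I → HasFld 𝔰 J (Coef.of p.1 V) := fun {V} hV {J} hJ =>
    ⟨V, hV, (hspec hV).2.1.mono fun _ hq => hJ hq⟩
  have hbr := fun {V W} (hV : V ∈ 𝔰) (hW : W ∈ 𝔰) =>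
    Coef.of_lieBracket hI (hspec hV).1 (hspec hW).1 (hspec hV).2.1 (hspec hW).2.1 p.1
  have hcont : ∀ {f : ℝ → ℝ}, ContDiffOn ℝ ∞ f I → ContinuousAt f p.1 := fun hf =>
    (smooth_hasDerivAt hI hf hp').continuousAt
  rcases trichotomy hI h𝔰 hdim hp hr with
    ⟨E, hE, V, hV, W, hW, hEτ, hVl, hWl, hτ, hVχ, hVρ, hWχ, hWρ, hVW⟩ |
    ⟨A, hA, V, hV, W, hW, k, hAτ, hAl, hVl, hWl, hτ, hdet, hVW, -, hAW⟩ |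
    ⟨A, hA, W, hW, hAτ, hAl, hWl, hτ, hne, hAW⟩
  · have h1 : ∀ᶠ t in 𝓝 p.1, 0 < (Coef.of p.1 V).χ t :=
      (hcont (hspec hV).1.χ).eventually_const_lt (by rw [hVχ]; norm_num)
    have h2 : ∀ᶠ t in 𝓝 p.1, (Coef.of p.1 W).ρ t ≠ 0 :=
      (hcont (hspec hW).1.ρ).eventually_ne (by rw [hWρ]; norm_num)
    have h3 : ∀ᶠ t in 𝓝 p.1, (Coef.of p.1 E).τ t ≠ 0 :=
      (hcont (hspec hE).1.τ).eventually_ne (by rw [hEτ]; norm_num)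
    obtain ⟨K, hKI, hK, -, hpK, hall⟩ :=
      exists_interval hI hp' (h1.and (h2.and (h3.and hτ)))
    -- A vanishing Wronskian with `f(t₀) ≠ 0` is a first-order linear equation for `g`, so `g(t₀) =
    -- 0` propagates.
    have hz : ∀ {f g : ℝ → ℝ}, ContDiffOn ℝ ∞ f I → ContDiffOn ℝ ∞ g I → f p.1 ≠ 0 → g p.1 = 0 →
        (∀ t ∈ K, f t * deriv g t = deriv f t * g t) → ∀ᶠ t in 𝓝 p.1, g t = 0 :=
      fun {f g} hf hg hf0 hg0 h => by
        refine eventually_zero_of_linear (a := fun t => deriv f t / f t)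
          ((hcont (smooth_deriv hI hf)).div (hcont hf) hf0) ?_ hg0
        filter_upwards [(hcont hf).eventually_ne hf0, hK.mem_nhds hpK] with t h2 h3
        refine (smooth_hasDerivAt hI hg (hKI h3)).congr_deriv ?_
        have := h t h3
        field_simp
        linarith
    have hB := hbr hV hW
    rw [hVW] at hB
    obtain ⟨-, -, -, b4, b5, b6, -⟩ := hB
    have dV := deriv_eq_zero_of_zeroOn hK fun t ht => (hall t ht).2.2.2.1
    have dW := deriv_eq_zero_of_zeroOn hK fun t ht => (hall t ht).2.2.2.2
    have eα : ∀ t, (Coef.of p.1 (0 : Space → Space)).α t = 0 := fun t => by simp [Coef.of]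
    have eβ : ∀ t, (Coef.of p.1 (0 : Space → Space)).β t = 0 := fun t => by simp [Coef.of]
    have eσ : ∀ t, (Coef.of p.1 (0 : Space → Space)).σ t = 0 := fun t => by simp [Coef.of]
    -- The `R^x`-component of `[V, W] = 0` is the Wronskian of `χ_V` and `χ_W`; likewise the
    -- `R^y`-component for `ρ_V` and `ρ_W`. The `Z`-component then becomes the relation between
    -- `α_W` and `β_V`.
    have h4 : ∀ᶠ t in 𝓝 p.1, (Coef.of p.1 W).χ t = 0 := by
      refine hz (hspec hV).1.χ (hspec hW).1.χ (by rw [hVχ]; norm_num) hWχ fun t ht => ?_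
      have := b4 t (hKI ht)
      rw [eα, hVl, hWl, (hall t ht).2.2.2.1, (hall t ht).2.2.2.2, dV t ht, dW t ht] at this
      linarith
    have h5 : ∀ᶠ t in 𝓝 p.1, (Coef.of p.1 V).ρ t = 0 := by
      refine hz (hspec hW).1.ρ (hspec hV).1.ρ (by rw [hWρ]; norm_num) hVρ fun t ht => ?_
      have := b5 t (hKI ht)
      rw [eβ, hVl, hWl, (hall t ht).2.2.2.1, (hall t ht).2.2.2.2, dV t ht, dW t ht] at this
      linarith
    obtain ⟨J, hJK, hJ, hJ', hpJ, hall'⟩ := exists_interval hK hpK (h4.and h5)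
    have hJI := hJK.trans hKI
    refine ⟨J, hJI, hJ, hJ', hpJ, Or.inl ⟨Coef.of p.1 E, Coef.of p.1 V, Coef.of p.1 W,
      (hspec hE).1.mono hJI, (hspec hV).1.mono hJI, (hspec hW).1.mono hJI, hfld hE hJI,
      hfld hV hJI, hfld hW hJI, fun t ht => (hall t (hJK ht)).2.2.1,
      fun t ht => (hall t (hJK ht)).2.2.2.1, fun t ht => (hall t (hJK ht)).2.2.2.2, hVl, hWl,
      fun t ht => (hall t (hJK ht)).1, fun t ht => (hall' t ht).2, fun t ht => (hall' t ht).1,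
      fun t ht => (hall t (hJK ht)).2.1, fun t ht => ?_⟩⟩
    have := b6 t (hJI ht)
    rw [eσ, hVl, hWl, (hall t (hJK ht)).2.2.2.1, (hall t (hJK ht)).2.2.2.2, (hall' t ht).1,
      (hall' t ht).2] at this
    linarith
  · have h3 : ∀ᶠ t in 𝓝 p.1, (Coef.of p.1 A).τ t ≠ 0 :=
      (hcont (hspec hA).1.τ).eventually_ne (by rw [hAτ]; norm_num)
    obtain ⟨J, hJI, hJ, hJ', hpJ, hall⟩ := exists_interval hI hp' (h3.and hτ)
    have dV := deriv_eq_zero_of_zeroOn hJ fun t ht => (hall t ht).2.1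
    have dW := deriv_eq_zero_of_zeroOn hJ fun t ht => (hall t ht).2.2
    have hB := hbr hV hW
    obtain ⟨-, -, -, c4, c5, c6, -⟩ := Coef.of_comb (t₀ := p.1)
      (show lieBracket ℝ V W = (-1 : ℝ) • W + (0 : ℝ) • W + (0 : ℝ) • W by rw [hVW]; module)
    obtain ⟨-, c2, c3, -, -, -, -⟩ := Coef.of_comb (t₀ := p.1)
      (show lieBracket ℝ A W = k • W + (0 : ℝ) • W + (0 : ℝ) • W by rw [hAW]; module)
    obtain ⟨-, -, -, b4, b5, b6, -⟩ := hB
    obtain ⟨-, b2, b3, -, -, -, -⟩ := hbr hA hW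
    refine ⟨J, hJI, hJ, hJ', hpJ, Or.inr (Or.inl ⟨Coef.of p.1 V, Coef.of p.1 W,
      ⟨(hspec hV).1.mono hJI, (hspec hW).1.mono hJI, hfld hV hJI, hfld hW hJI,
        fun t ht => (hall t ht).2.1, fun t ht => (hall t ht).2.2, hVl, hWl, fun t ht => ?_,
        fun t ht => ?_, fun t ht => ?_, fun t ht => ?_⟩, ?_⟩)⟩
    -- By `[A, W] = kW`, both `χ_W` and `ρ_W` solve the same first-order linear equation, so their
    -- Wronskian vanishes.
    · have g2 := b2 t (hJI ht)
      have g3 := b3 t (hJI ht)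
      rw [c2, hAl, hWl, (hall t ht).2.2, dW t ht] at g2
      rw [c3, hAl, hWl, (hall t ht).2.2, dW t ht] at g3
      refine mul_left_cancel₀ (hall t ht).1 ?_
      linear_combination (Coef.of p.1 W).χ t * g3 - (Coef.of p.1 W).ρ t * g2
    · have g := b4 t (hJI ht)
      rw [c4, hVl, hWl, (hall t ht).2.1, (hall t ht).2.2, dV t ht, dW t ht] at g
      linarith
    · have g := b5 t (hJI ht)
      rw [c5, hVl, hWl, (hall t ht).2.1, (hall t ht).2.2, dV t ht, dW t ht] at g
      linarith
    · have g := b6 t (hJI ht)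
      rw [c6, hVl, hWl, (hall t ht).2.1, (hall t ht).2.2] at g
      linarith
    · rw [(hspec hV).2.1 hp, (hspec hW).2.1 hp] at hdet
      simpa [base, Coef.fld, hVl, hWl, dV _ hpJ, dW _ hpJ] using hdet
  · have h3 : ∀ᶠ t in 𝓝 p.1, (Coef.of p.1 A).τ t ≠ 0 :=
      (hcont (hspec hA).1.τ).eventually_ne (by rw [hAτ]; norm_num)
    obtain ⟨J, hJI, hJ, hJ', hpJ, hall⟩ := exists_interval hI hp' (h3.and hτ)
    have dW := deriv_eq_zero_of_zeroOn hJ fun t ht => (hall t ht).2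
    obtain ⟨-, b2, b3, b4, b5, b6, -⟩ := hbr hA hW
    rw [hAW] at b2 b3 b4 b5 b6
    refine ⟨J, hJI, hJ, hJ', hpJ, Or.inr (Or.inr ⟨Coef.of p.1 A, Coef.of p.1 W,
      ⟨(hspec hA).1.mono hJI, (hspec hW).1.mono hJI, hfld hA hJI, hfld hW hJI,
        fun t ht => (hall t ht).1, fun t ht => (hall t ht).2, hAl, hWl, fun t ht => ?_,
        fun t ht => ?_, fun t ht => ?_, fun t ht => ?_, fun t ht => ?_⟩, hAτ, hne⟩)⟩
    · have g := b2 t (hJI ht)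
      rw [show (Coef.of p.1 (0 : Space → Space)).χ t = 0 by simp [Coef.of], hAl, hWl,
        (hall t ht).2, dW t ht] at g
      linarith
    · have g := b3 t (hJI ht)
      rw [show (Coef.of p.1 (0 : Space → Space)).ρ t = 0 by simp [Coef.of], hAl, hWl,
        (hall t ht).2, dW t ht] at g
      linarith
    · have g := b4 t (hJI ht)
      rw [show (Coef.of p.1 (0 : Space → Space)).α t = 0 by simp [Coef.of], hAl, hWl,
        (hall t ht).2, dW t ht] at g
      linarith
    · have g := b5 t (hJI ht)
      rw [show (Coef.of p.1 (0 : Space → Space)).β t = 0 by simp [Coef.of], hAl, hWl,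
        (hall t ht).2, dW t ht] at g
      linarith
    · have g := b6 t (hJI ht)
      rw [show (Coef.of p.1 (0 : Space → Space)).σ t = 0 by simp [Coef.of], hAl, hWl,
        (hall t ht).2] at g
      linarith

end Types

end DN

namespace DN

open Set Filter Topology

/-! ### Treated subalgebras -/

section Treated

variable {𝔰 : Submodule ℝ (Space → Space)} {I J : Set ℝ} {a e v w : Coef} {t₀ : ℝ}

theorem TypeA.fld_v (hJ : IsOpen J) (h : TypeA 𝔰 J e v w) {t : ℝ} (ht : t ∈ J) (x y u : ℝ) :
    v.fld (t, x, y, u) =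
      (0, v.χ t, 0, -(1 / 2) * deriv v.χ t * x ^ 2 + v.α t * x + v.β t * y + v.σ t) := by
  have d1 := deriv_eq_zero_of_zeroOn hJ h.vτ
  simp only [Coef.fld, h.vτ t ht, d1 t ht, deriv_eq_zero_of_zeroOn hJ d1 t ht, h.vl, h.vρ t ht,
    deriv_eq_zero_of_zeroOn hJ h.vρ t ht, Prod.mk.injEq, true_and]
  refine ⟨?_, ?_, ?_⟩ <;> ring

theorem TypeA.fld_w (hJ : IsOpen J) (h : TypeA 𝔰 J e v w) {t : ℝ} (ht : t ∈ J) (x y u : ℝ) :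
    w.fld (t, x, y, u) =
      (0, 0, w.ρ t, -(1 / 2) * deriv w.ρ t * y ^ 2 + w.α t * x + w.β t * y + w.σ t) := by
  have d1 := deriv_eq_zero_of_zeroOn hJ h.wτ
  simp only [Coef.fld, h.wτ t ht, d1 t ht, deriv_eq_zero_of_zeroOn hJ d1 t ht, h.wl, h.wχ t ht,
    deriv_eq_zero_of_zeroOn hJ h.wχ t ht, Prod.mk.injEq, true_and]
  refine ⟨?_, ?_, ?_⟩ <;> ring

/-- With `T_t = χ⁻³`, the function `X` removes the `R^x`-term of `V`, the function `Y` removes the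
`R^y`-term of `W`, and `W₁`, `W₂` remove the two `Z`-terms. The remaining coefficients of `R^y` in
`V` and of `R^x` in `W` match by `rel`. -/
theorem TypeA.locallyTreated (hJ : IsOpen J) (hJ' : J.OrdConnected) (hJI : J ⊆ I) (ht₀ : t₀ ∈ J)
    (h : TypeA 𝔰 J e v w) : LocallyTreated I 𝔰 t₀ := by
  have hχ := h.sv.χ
  have hρ := h.sw.ρ
  have hχ0 : ∀ t ∈ J, v.χ t ≠ 0 := fun t ht => (h.vχ t ht).ne'
  have hχ' := smooth_deriv hJ hχ
  have hρ' := smooth_deriv hJ hρ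
  obtain ⟨X, hX, hX'⟩ := exists_antideriv hJ hJ'
    (h.sv.α.div (hχ.pow 2) fun t ht => pow_ne_zero 2 (hχ0 t ht))
  -- The equation is linear rather than a quadrature because the quadratic term of `P^y(ρ/χ)`,
  -- written in `y/χ + Y`, contributes a term proportional to `yY`.
  obtain ⟨Y, hY, hY'⟩ := exists_linear_ode hJ hJ'
    (((hρ'.mul hχ).sub (hρ.mul hχ')).div (hχ.mul hρ) fun t ht => mul_ne_zero (hχ0 t ht) (h.wρ t ht))
    (h.sw.β.div (hχ.mul hρ) fun t ht => mul_ne_zero (hχ0 t ht) (h.wρ t ht))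
  have hW₁ : ContDiffOn ℝ ∞ (fun t => (v.χ t * v.β t * Y t - v.σ t) / v.χ t) J :=
    (((hχ.mul h.sv.β).mul hY).sub h.sv.σ).div hχ hχ0
  have hW₂ : ContDiffOn ℝ ∞ (fun t => (-(1 / 2) * (deriv w.ρ t * v.χ t - w.ρ t * deriv v.χ t) *
      (v.χ t * Y t ^ 2) + w.ρ t * v.β t * X t - w.σ t) / w.ρ t) J :=
    ((((contDiffOn_const.mul ((hρ'.mul hχ).sub (hρ.mul hχ'))).mul (hχ.mul (hY.pow 2))).add
      ((hρ.mul h.sv.β).mul hX)).sub h.sw.σ).div hρ h.wρ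
  obtain ⟨T, S, Φ, hΦ, hS, hST, hS', hval, hder⟩ :=
    exists_transf hJ hJ' hχ h.vχ one_ne_zero hX hY (contDiffOn_const (c := 0)) hW₁ hW₂
  have hmaps : MapsTo S (T '' J) J := by
    rintro _ ⟨t, ht, rfl⟩
    rw [hST t ht]; exact ht
  have hΦ1 : ∀ p ∈ strip J, (Φ p).1 ∈ T '' J := fun p hp => by
    rw [show p = (p.1, p.2.1, p.2.2.1, p.2.2.2) from rfl, hval p.1 hp]
    exact ⟨p.1, hp, rfl⟩
  set r : ℝ → ℝ := fun s => w.ρ (S s) / v.χ (S s)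
  set b : ℝ → ℝ := fun s => v.χ (S s) * v.β (S s)
  have hr : ∀ t ∈ J, r (T t) = w.ρ t / v.χ t := fun t ht => by simp only [r, hST t ht]
  have hb : ∀ t ∈ J, b (T t) = v.χ t * v.β t := fun t ht => by simp only [b, hST t ht]
  have hdr : ∀ t ∈ J, deriv r (T t) =
      (deriv w.ρ t * v.χ t - w.ρ t * deriv v.χ t) / v.χ t ^ 2 * v.χ t ^ 3 := fun t ht => by
    have h1 := (smooth_hasDerivAt hJ hρ ht).div (smooth_hasDerivAt hJ hχ ht) (hχ0 t ht)
    rw [← hST t ht] at h1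
    have h2 := (h1.comp (T t) (hS' t ht)).deriv
    rw [hST t ht] at h2
    exact h2
  have p1 := h.hv.exists_pushforward 1 hΦ1 (G := Px (fun _ => 1) + Ry b) fun t ht x y u => by
    have h0 := hχ0 t ht
    rw [h.fld_v hJ ht, hder t ht, hval t ht]
    simp only [Px, Ry, Pi.add_apply, Pi.div_apply, hb t ht, (hX' t ht).deriv, one_smul, Prod.mk_add_mk,
      deriv_const, Prod.mk.injEq]
    refine ⟨by simp, by field_simp; ring, by simp, ?_⟩
    field_simp
    ring
  have p2 := h.hw.exists_pushforward 1 hΦ1 (G := Py r + Rx (fun t => r t * b t))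
    fun t ht x y u => by
    have h0 := hχ0 t ht
    have h1 := h.wρ t ht
    have h2 : w.α t = w.ρ t * v.β t / v.χ t := by
      rw [eq_div_iff h0]; linarith [h.rel t ht]
    rw [h.fld_w hJ ht, hder t ht, hval t ht]
    simp only [Py, Rx, Pi.add_apply, Pi.div_apply, hr t ht, hb t ht, hdr t ht, (hY' t ht).deriv, one_smul,
      Prod.mk_add_mk, Prod.mk.injEq, h2]
    refine ⟨by simp, by simp, by field_simp; ring, ?_⟩
    field_simp
    ring
  refine ⟨J, T '' J, Φ, ht₀, hJI, hΦ, Or.inr (Or.inr ⟨r, b, ?_, ?_, ?_, ?_, ?_⟩)⟩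
  · exact (hρ.comp hS hmaps).div (hχ.comp hS hmaps) fun t ht => hχ0 _ (hmaps ht)
  · exact (hχ.comp hS hmaps).mul (h.sv.β.comp hS hmaps)
  · rintro _ ⟨t, ht, rfl⟩
    rw [hr t ht]
    exact div_ne_zero (h.wρ t ht) (hχ0 t ht)
  · refine pushforwardContains_span fun W hW => ?_
    rcases hW with rfl | rfl
    exacts [p1, p2]
  · refine pushforwardContains_span fun W hW => ?_
    rcases hW with rfl
    exact p1

/-- Normalization of a subalgebra of type B with `χ(t₀) ≠ 0`. -/
theorem TypeB.normalize (hJ : IsOpen J) (h : TypeB 𝔰 J v w) (ht₀ : t₀ ∈ J) (hχ : w.χ t₀ ≠ 0) :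
    ∃ K ⊆ J, IsOpen K ∧ K.OrdConnected ∧ t₀ ∈ K ∧ ∃ (k : ℝ) (ν : ℝ), k ≠ 0 ∧
      TypeB 𝔰 K v (w.scale k) ∧
      ∀ t ∈ K, 0 < (w.scale k).χ t ∧ (w.scale k).ρ t = ν * (w.scale k).χ t := by
  have h1 := h.scale (w.χ t₀)⁻¹
  have h2 : (w.scale (w.χ t₀)⁻¹).χ t₀ = 1 := inv_mul_cancel₀ hχ
  obtain ⟨K, hKJ, hK, hK', htK, hpos⟩ := exists_interval hJ ht₀
    ((smooth_hasDerivAt hJ h1.sw.χ ht₀).continuousAt.eventually_const_lt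
      (show 0 < (w.scale (w.χ t₀)⁻¹).χ t₀ by rw [h2]; norm_num))
  set c := w.scale (w.χ t₀)⁻¹
  -- The zero Wronskian makes `ρ/χ` a constant, the number `ν`.
  have hd : ∀ t ∈ K, HasDerivAt (fun t => c.ρ t / c.χ t) 0 t := fun t ht => by
    refine ((smooth_hasDerivAt hJ h1.sw.ρ (hKJ ht)).div (smooth_hasDerivAt hJ h1.sw.χ (hKJ ht))
      (hpos t ht).ne').congr_deriv ?_
    rw [div_eq_zero_iff]
    left
    linear_combination -h1.rχρ t (hKJ ht)
  refine ⟨K, hKJ, hK, hK', htK, (w.χ t₀)⁻¹, c.ρ t₀ / c.χ t₀, inv_ne_zero hχ, h1.mono hKJ,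
    fun t ht => ⟨hpos t ht, ?_⟩⟩
  have := eq_of_hasDerivAt_zero hK' hd ht htK
  exact (div_eq_iff (hpos t ht).ne').1 this

theorem TypeB.fld_v (hJ : IsOpen J) (h : TypeB 𝔰 J v w) {t : ℝ} (ht : t ∈ J) (x y u : ℝ) :
    v.fld (t, x, y, u) = (0, x + v.χ t, y + v.ρ t, 3 * u - 1 / 2 * deriv v.χ t * x ^ 2
      - 1 / 2 * deriv v.ρ t * y ^ 2 + v.α t * x + v.β t * y + v.σ t) := by
  have d1 := deriv_eq_zero_of_zeroOn hJ h.vτ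
  simp only [Coef.fld, h.vτ t ht, d1 t ht, deriv_eq_zero_of_zeroOn hJ d1 t ht, h.vl,
    Prod.mk.injEq, true_and]
  refine ⟨?_, ?_, ?_⟩ <;> ring

theorem TypeB.fld_w (hJ : IsOpen J) (h : TypeB 𝔰 J v w) {t : ℝ} (ht : t ∈ J) (x y u : ℝ) :
    w.fld (t, x, y, u) = (0, w.χ t, w.ρ t, -(1 / 2) * deriv w.χ t * x ^ 2
      - 1 / 2 * deriv w.ρ t * y ^ 2 + w.α t * x + w.β t * y + w.σ t) := by
  have d1 := deriv_eq_zero_of_zeroOn hJ h.wτ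
  simp only [Coef.fld, h.wτ t ht, d1 t ht, deriv_eq_zero_of_zeroOn hJ d1 t ht, h.wl,
    Prod.mk.injEq, true_and]
  refine ⟨?_, ?_, ?_⟩ <;> ring

/-- The parameter functions of the transformation that maps `V` to `D^s` and `W` to
`P^x(1) + ν P^y(1)`. -/
theorem TypeB.exists_parameters (hJ : IsOpen J) (h : TypeB 𝔰 J v w) {ν : ℝ}
    (hpos : ∀ t ∈ J, 0 < w.χ t) (hν : ∀ t ∈ J, w.ρ t = ν * w.χ t) :
    ∃ X Y W₀ W₁ W₂ : ℝ → ℝ, ContDiffOn ℝ ∞ X J ∧ ContDiffOn ℝ ∞ Y J ∧ ContDiffOn ℝ ∞ W₀ J ∧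
      ContDiffOn ℝ ∞ W₁ J ∧ ContDiffOn ℝ ∞ W₂ J ∧
      (∀ t ∈ J, X t = v.χ t / w.χ t) ∧ (∀ t ∈ J, Y t = v.ρ t / w.χ t) ∧
      (∀ t ∈ J, deriv X t = (deriv v.χ t * w.χ t - v.χ t * deriv w.χ t) / w.χ t ^ 2) ∧
      (∀ t ∈ J, deriv Y t = (deriv v.ρ t * w.χ t - v.ρ t * deriv w.χ t) / w.χ t ^ 2) ∧
      (∀ t ∈ J, W₁ t = (v.α t - w.χ t * v.χ t * deriv X t) / 2) ∧
      (∀ t ∈ J, W₂ t = (v.β t - w.χ t * v.ρ t * deriv Y t) / 2) ∧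
      (∀ t ∈ J, W₀ t = (v.σ t + W₁ t * v.χ t + W₂ t * v.ρ t) / 3) ∧
      (∀ t ∈ J, deriv w.ρ t = ν * deriv w.χ t) ∧
      (∀ t ∈ J, w.α t = deriv v.χ t * w.χ t - v.χ t * deriv w.χ t) ∧
      (∀ t ∈ J, w.β t = ν * (deriv v.ρ t * w.χ t - v.ρ t * deriv w.χ t)) ∧
      (∀ t ∈ J, w.σ t + W₁ t * w.χ t + W₂ t * (ν * w.χ t) = 0) := by
  have hχ := h.sw.χ
  have hχ0 : ∀ t ∈ J, w.χ t ≠ 0 := fun t ht => (hpos t ht).ne'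
  have hX : ContDiffOn ℝ ∞ (fun t => v.χ t / w.χ t) J := h.sv.χ.div hχ hχ0
  have hY : ContDiffOn ℝ ∞ (fun t => v.ρ t / w.χ t) J := h.sv.ρ.div hχ hχ0
  have hX' := smooth_deriv hJ hX
  have hY' := smooth_deriv hJ hY
  have hW₁ : ContDiffOn ℝ ∞ (fun t => (v.α t - w.χ t * v.χ t *
      deriv (fun t => v.χ t / w.χ t) t) / 2) J :=
    (h.sv.α.sub ((hχ.mul h.sv.χ).mul hX')).div_const 2
  have hW₂ : ContDiffOn ℝ ∞ (fun t => (v.β t - w.χ t * v.ρ t *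
      deriv (fun t => v.ρ t / w.χ t) t) / 2) J :=
    (h.sv.β.sub ((hχ.mul h.sv.ρ).mul hY')).div_const 2
  have dX : ∀ t ∈ J, deriv (fun t => v.χ t / w.χ t) t =
      (deriv v.χ t * w.χ t - v.χ t * deriv w.χ t) / w.χ t ^ 2 := fun t ht =>
    ((smooth_hasDerivAt hJ h.sv.χ ht).div (smooth_hasDerivAt hJ hχ ht) (hχ0 t ht)).deriv
  have dY : ∀ t ∈ J, deriv (fun t => v.ρ t / w.χ t) t =
      (deriv v.ρ t * w.χ t - v.ρ t * deriv w.χ t) / w.χ t ^ 2 := fun t ht =>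
    ((smooth_hasDerivAt hJ h.sv.ρ ht).div (smooth_hasDerivAt hJ hχ ht) (hχ0 t ht)).deriv
  have dρ : ∀ t ∈ J, deriv w.ρ t = ν * deriv w.χ t := fun t ht => by
    rw [(eventuallyEq_of_mem (hJ.mem_nhds ht) hν).deriv_eq]
    exact deriv_const_mul_field ν
  have hβ : ∀ t ∈ J, w.β t = ν * (deriv v.ρ t * w.χ t - v.ρ t * deriv w.χ t) := fun t ht => by
    rw [h.rβ t ht, dρ t ht, hν t ht]; ring
  refine ⟨_, _, _, _, _, hX, hY, ((h.sv.σ.add (hW₁.mul h.sv.χ)).add (hW₂.mul h.sv.ρ)).div_const 3,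
    hW₁, hW₂, fun _ _ => rfl, fun _ _ => rfl, dX, dY, fun _ _ => rfl, fun _ _ => rfl,
    fun _ _ => rfl, dρ, h.rα, hβ, fun t ht => ?_⟩
  have h0 := hχ0 t ht
  -- All parameter functions are already fixed by sending `V` to `D^s`. That `W` then has no
  -- `Z`-term is the `Z`-component of `[V, W] = -W`.
  have h1 := h.rσ t ht
  rw [hβ t ht, h.rα t ht, hν t ht] at h1
  simp only [dX t ht, dY t ht]
  field_simp
  linear_combination h1

/-- The shifts `X = χ_V/χ_W` and `Y = ρ_V/χ_W` move the centre of the scaling to the origin. The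
result is `𝔰_{2.9}` with the constant function `ρ = ν`. -/
theorem TypeB.locallyTreated_of_ne_zero (hJ : IsOpen J) (hJI : J ⊆ I) (ht₀ : t₀ ∈ J)
    (h : TypeB 𝔰 J v w) (hχ : w.χ t₀ ≠ 0) : LocallyTreated I 𝔰 t₀ := by
  obtain ⟨K, hKJ, hK, hK', htK, k, ν, -, hB, hpos⟩ := h.normalize hJ ht₀ hχ
  set c := w.scale k
  obtain ⟨X, Y, W₀, W₁, W₂, hX, hY, hW₀, hW₁, hW₂, eX, eY, dX, dY, e₁, e₂, e₀, dρ, eα, eβ, eσ⟩ :=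
    hB.exists_parameters hK (fun t ht => (hpos t ht).1) fun t ht => (hpos t ht).2
  obtain ⟨T, S, Φ, hΦ, -, -, -, hval, hder⟩ :=
    exists_transf hK hK' hB.sw.χ (fun t ht => (hpos t ht).1) one_ne_zero hX hY hW₀ hW₁ hW₂
  have hΦ1 : ∀ p ∈ strip K, (Φ p).1 ∈ T '' K := fun p hp => by
    rw [show p = (p.1, p.2.1, p.2.2.1, p.2.2.2) from rfl, hval p.1 hp]
    exact ⟨p.1, hp, rfl⟩
  refine ⟨K, T '' K, Φ, htK, hKJ.trans hJI, hΦ, Or.inr (Or.inl ⟨fun _ => ν, contDiffOn_const,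
    pushforwardContains_span fun W hW => ?_⟩)⟩
  rcases hW with rfl | rfl
  · refine hB.hv.exists_pushforward 1 hΦ1 fun t ht x y u => ?_
    have h0 : c.χ t ≠ 0 := (hpos t ht).1.ne'
    rw [hB.fld_v hK ht, hder t ht, hval t ht]
    simp only [Ds, one_smul, Prod.mk.injEq, e₀ t ht, e₁ t ht, e₂ t ht, dX t ht, dY t ht]
    refine ⟨by simp, ?_, ?_, ?_⟩
    · rw [eX t ht]; field_simp; ring
    · rw [eY t ht]; field_simp; ring
    · field_simp; ring
  · refine hB.hw.exists_pushforward 1 hΦ1 fun t ht x y u => ?_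
    have h0 : c.χ t ≠ 0 := (hpos t ht).1.ne'
    have h1 := eσ t ht
    rw [hB.fld_w hK ht, hder t ht, hval t ht]
    simp only [Px, Py, Pi.add_apply, Prod.mk_add_mk, deriv_const, one_smul, Prod.mk.injEq,
      dX t ht, dY t ht, (hpos t ht).2, dρ t ht, eα t ht, eβ t ht]
    refine ⟨by simp, by field_simp; ring, by field_simp; ring, ?_⟩
    field_simp
    field_simp at h1
    linear_combination (-12 * c.χ t ^ 2) * h1

theorem TypeB.locallyTreated (hJ : IsOpen J) (hJI : J ⊆ I) (ht₀ : t₀ ∈ J)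
    (h : TypeB 𝔰 J v w) (hne : w.χ t₀ ≠ 0 ∨ w.ρ t₀ ≠ 0) : LocallyTreated I 𝔰 t₀ := by
  rcases hne with hχ | hρ
  · exact h.locallyTreated_of_ne_zero hJ hJI ht₀ hχ
  · exact (h.swap.locallyTreated_of_ne_zero hJ hJI ht₀ hρ).of_swap

end Treated

end DN

/-! ### Normalization of commuting pairs of type C -/

namespace DN

open Set Filter Topology

section TypeC

variable {𝔰 : Submodule ℝ (Space → Space)} {I J : Set ℝ} {a e v w : Coef} {t₀ : ℝ}

/-- A normalized pair of vector fields of type C. -/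
structure NormC (𝔰 : Submodule ℝ (Space → Space)) (J : Set ℝ) (a w : Coef) (ν M : ℝ) : Prop
    extends TypeC 𝔰 J a w where
  pos : ∀ t ∈ J, 0 < w.χ t
  eτ : ∀ t ∈ J, a.τ t = w.χ t ^ 3
  eρ : ∀ t ∈ J, w.ρ t = ν * w.χ t
  eχ : ∀ t ∈ J, a.χ t = -(w.α t * w.χ t ^ 2)
  eβ : ∀ t ∈ J, w.β t = M / w.χ t - ν * a.ρ t / w.χ t ^ 2

/-- The relation `[A, W] = 0` yields conserved quantities: `ρ/χ`, `τ/χ³`, `N = α_W χ + χ_A/χ` and `L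
= β_W χ + νρ_A/χ`. The scaling `χ(t₀) = 1` makes the second equal to one, and adding a multiple of
`W` to `A` removes `N`. -/
theorem TypeC.normalize (hJ : IsOpen J) (h : TypeC 𝔰 J a w) (ht₀ : t₀ ∈ J) (haτ : a.τ t₀ = 1)
    (hχ : w.χ t₀ ≠ 0) :
    ∃ K ⊆ J, IsOpen K ∧ K.OrdConnected ∧ t₀ ∈ K ∧ ∃ (a' w' : Coef) (M : ℝ),
      NormC 𝔰 K a' w' (w.ρ t₀ / w.χ t₀) M := by
  have h1 := h.scale (w.χ t₀)⁻¹
  have h2 : (w.scale (w.χ t₀)⁻¹).χ t₀ = 1 := inv_mul_cancel₀ hχ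
  have h2' : (w.scale (w.χ t₀)⁻¹).ρ t₀ = w.ρ t₀ / w.χ t₀ := by simp [Coef.scale]; ring
  obtain ⟨K, hKJ, hK, hK', htK, hpos⟩ := exists_interval hJ ht₀
    ((smooth_hasDerivAt hJ h1.sw.χ ht₀).continuousAt.eventually_const_lt
      (show 0 < (w.scale (w.χ t₀)⁻¹).χ t₀ by rw [h2]; norm_num))
  replace h1 := h1.mono hKJ
  set c := w.scale (w.χ t₀)⁻¹
  have hne : ∀ t ∈ K, c.χ t ≠ 0 := fun t ht => (hpos t ht).ne'
  have D {f : ℝ → ℝ} (hf : ContDiffOn ℝ ∞ f K) {t : ℝ} (ht : t ∈ K) := smooth_hasDerivAt hK hf ht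
  have e1 : ∀ t ∈ K, c.ρ t = w.ρ t₀ / w.χ t₀ * c.χ t := fun t ht => by
    have hd : ∀ t ∈ K, HasDerivAt (fun t => c.ρ t / c.χ t) 0 t := fun t ht => by
      refine ((D h1.sw.ρ ht).div (D h1.sw.χ ht) (hne t ht)).congr_deriv ?_
      rw [div_eq_zero_iff]
      left
      refine mul_left_cancel₀ (h1.aτ t ht) ?_
      linear_combination c.χ t * h1.rρ t ht - c.ρ t * h1.rχ t ht
    have := eq_of_hasDerivAt_zero hK' hd ht htK
    simp only [h2, h2', div_one] at this
    exact (div_eq_iff (hne t ht)).1 this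
  have e2 : ∀ t ∈ K, a.τ t = c.χ t ^ 3 := fun t ht => by
    have hd : ∀ t ∈ K, HasDerivAt (fun t => a.τ t / c.χ t ^ 3) 0 t := fun t ht => by
      refine ((D h1.sa.τ ht).div ((D h1.sw.χ ht).pow 3) (pow_ne_zero 3 (hne t ht))).congr_deriv ?_
      rw [div_eq_zero_iff]
      left
      norm_num
      linear_combination (-3) * c.χ t ^ 2 * h1.rχ t ht
    have := eq_of_hasDerivAt_zero hK' hd ht htK
    simp only [h2, haτ, one_pow, div_one] at this
    exact (div_eq_iff (pow_ne_zero 3 (hne t ht))).1 this |>.trans (one_mul _)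
  have dτ : ∀ t ∈ K, deriv a.τ t = 3 * c.χ t ^ 2 * deriv c.χ t := fun t ht => by
    rw [(eventuallyEq_of_mem (hK.mem_nhds ht) e2).deriv_eq]
    refine ((D h1.sw.χ ht).pow 3).deriv.trans ?_
    norm_num
  have dρ : ∀ t ∈ K, deriv c.ρ t = w.ρ t₀ / w.χ t₀ * deriv c.χ t := fun t ht => by
    rw [(eventuallyEq_of_mem (hK.mem_nhds ht) e1).deriv_eq]
    exact deriv_const_mul_field _
  have e3 : ∀ t ∈ K, c.α t * c.χ t + a.χ t / c.χ t = c.α t₀ * c.χ t₀ + a.χ t₀ / c.χ t₀ :=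
    fun t ht => by
      refine eq_of_hasDerivAt_zero (f := fun t => c.α t * c.χ t + a.χ t / c.χ t) hK'
        (fun t ht => ?_) ht htK
      have h0 := hne t ht
      refine (((D h1.sw.α ht).mul (D h1.sw.χ ht)).add
        ((D h1.sa.χ ht).div (D h1.sw.χ ht) h0)).congr_deriv ?_
      have := h1.rα t ht
      rw [e2 t ht, dτ t ht] at this
      field_simp
      linear_combination this
  have e4 : ∀ t ∈ K, c.β t * c.χ t + w.ρ t₀ / w.χ t₀ * (a.ρ t / c.χ t) =
      c.β t₀ * c.χ t₀ + w.ρ t₀ / w.χ t₀ * (a.ρ t₀ / c.χ t₀) :=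
    fun t ht => by
      refine eq_of_hasDerivAt_zero
        (f := fun t => c.β t * c.χ t + w.ρ t₀ / w.χ t₀ * (a.ρ t / c.χ t)) hK'
        (fun t ht => ?_) ht htK
      have h0 := hne t ht
      refine (((D h1.sw.β ht).mul (D h1.sw.χ ht)).add
        (((D h1.sa.ρ ht).div (D h1.sw.χ ht) h0).const_mul (w.ρ t₀ / w.χ t₀))).congr_deriv ?_
      have := h1.rβ t ht
      rw [e2 t ht, dτ t ht, e1 t ht, dρ t ht] at this
      generalize w.ρ t₀ / w.χ t₀ = ν at *
      field_simp
      linear_combination this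
  set N := c.α t₀ * c.χ t₀ + a.χ t₀ / c.χ t₀
  set L := c.β t₀ * c.χ t₀ + w.ρ t₀ / w.χ t₀ * (a.ρ t₀ / c.χ t₀)
  set ν := w.ρ t₀ / w.χ t₀
  -- Replacing `A` by `A - NW` changes `χ_A/χ` by `-N` and `ρ_A/χ` by `-Nν`; hence the first
  -- invariant becomes zero and the second `L - Nν²`.
  refine ⟨K, hKJ, hK, hK', htK, a.shift (-N) c, c, L - N * ν ^ 2, h1.shift hK (-N), hpos, ?_, e1,
    ?_, ?_⟩
  · intro t ht
    simp [Coef.shift, e2 t ht, h1.wτ t ht]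
  · intro t ht
    have h0 := hne t ht
    have := e3 t ht
    simp only [Coef.shift]
    rw [← this]
    field_simp
    ring
  · intro t ht
    have h0 := hne t ht
    have := e4 t ht
    simp only [Coef.shift, e1 t ht]
    rw [← this]
    field_simp
    ring

/-- These are the conditions for the transformation with `T_t = χ⁻³` to map `A` to `D^t(1)` and `W`
to `P^x(1) + νP^y(1) + MR^y(1)`, for `C = 1`. -/
theorem NormC.exists_parameters {ν M : ℝ} (hJ : IsOpen J) (hJ' : J.OrdConnected)
    (h : NormC 𝔰 J a w ν M) :
    ∃ ξ η w₀ w₁ w₂ : ℝ → ℝ, ContDiffOn ℝ ∞ ξ J ∧ ContDiffOn ℝ ∞ η J ∧ ContDiffOn ℝ ∞ w₀ J ∧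
      ContDiffOn ℝ ∞ w₁ J ∧ ContDiffOn ℝ ∞ w₂ J ∧
      (∀ t ∈ J, deriv ξ t = -(a.χ t / w.χ t ^ 4)) ∧ (∀ t ∈ J, deriv η t = -(a.ρ t / w.χ t ^ 4)) ∧
      (∀ t ∈ J, w.χ t ^ 3 * deriv w₁ t + w.χ t ^ 2 * deriv w.χ t * w₁ t + a.α t +
        a.χ t ^ 2 / w.χ t ^ 3 = 0) ∧
      (∀ t ∈ J, w.χ t ^ 3 * deriv w₂ t + w.χ t ^ 2 * deriv w.χ t * w₂ t + a.β t +
        a.ρ t ^ 2 / w.χ t ^ 3 = 0) ∧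
      (∀ t ∈ J, a.σ t + w.χ t ^ 3 * deriv w₀ t + w₁ t * a.χ t + w₂ t * a.ρ t = 0) ∧
      (∀ t ∈ J, w.σ t + w₁ t * w.χ t + w₂ t * (ν * w.χ t) = M * η t) := by
  have hne : ∀ t ∈ J, w.χ t ≠ 0 := fun t ht => (h.pos t ht).ne'
  have hne4 : ∀ t ∈ J, w.χ t ^ 4 ≠ 0 := fun t ht => pow_ne_zero 4 (hne t ht)
  have hne3 : ∀ t ∈ J, w.χ t ^ 3 ≠ 0 := fun t ht => pow_ne_zero 3 (hne t ht)
  have D {f : ℝ → ℝ} (hf : ContDiffOn ℝ ∞ f J) {t : ℝ} (ht : t ∈ J) := smooth_hasDerivAt hJ hf ht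
  obtain ⟨ξ, hξ, dξ⟩ := exists_antideriv hJ hJ' (h.sa.χ.div (h.sw.χ.pow 4) hne4).neg
  obtain ⟨η, hη, dη⟩ := exists_antideriv hJ hJ' (h.sa.ρ.div (h.sw.χ.pow 4) hne4).neg
  -- Here `o = χw₂`, for which the equation on `w₂` becomes a quadrature. The function `w₁` is not
  -- integrated but defined by the last condition; its own equation then follows from the
  -- `Z`-component of `[A, W] = 0`.
  obtain ⟨o, ho, d_o⟩ := exists_antideriv hJ hJ' (((h.sw.χ.mul (h.sa.β.add
    ((h.sa.ρ.pow 2).div (h.sw.χ.pow 3) hne3))).div (h.sw.χ.pow 3) hne3).neg)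
  have hw₁ : ContDiffOn ℝ ∞ (fun t => (M * η t - w.σ t - ν * o t) / w.χ t) J :=
    (((contDiffOn_const.mul hη).sub h.sw.σ).sub (contDiffOn_const.mul ho)).div h.sw.χ hne
  have hw₂ : ContDiffOn ℝ ∞ (fun t => o t / w.χ t) J := ho.div h.sw.χ hne
  obtain ⟨w₀, hw₀, d₀⟩ := exists_antideriv hJ hJ' (((h.sa.σ.add (hw₁.mul h.sa.χ)).add
    (hw₂.mul h.sa.ρ)).div (h.sw.χ.pow 3) hne3).neg
  refine ⟨ξ, η, w₀, _, _, hξ, hη, hw₀, hw₁, hw₂, fun t ht => (dξ t ht).deriv,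
    fun t ht => (dη t ht).deriv, fun t ht => ?_, fun t ht => ?_, fun t ht => ?_, fun t ht => ?_⟩
  · have h0 := hne t ht
    have e1 := ((((dη t ht).const_mul M).sub (D h.sw.σ ht)).sub ((d_o t ht).const_mul ν)).div
      (D h.sw.χ ht) h0
    have e2 := h.rσ t ht
    rw [h.eτ t ht, h.eρ t ht, h.eβ t ht, h.eχ t ht] at e2
    rw [show deriv (fun t => (M * η t - w.σ t - ν * o t) / w.χ t) t = _ from e1.deriv]
    simp only [Pi.div_apply, Pi.sub_apply, h.eχ t ht]
    field_simp at e2 ⊢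
    linear_combination -e2
  · have h0 := hne t ht
    have e1 := (d_o t ht).div (D h.sw.χ ht) h0
    rw [show deriv (fun t => o t / w.χ t) t = _ from e1.deriv]
    simp only [Pi.div_apply]
    field_simp
    ring
  · have h0 := hne t ht
    rw [(d₀ t ht).deriv]
    simp only [Pi.div_apply]
    field_simp
    ring
  · have h0 := hne t ht
    field_simp
    ring

theorem NormC.derivs {ν M : ℝ} (hJ : IsOpen J) (h : NormC 𝔰 J a w ν M) :
    (∀ t ∈ J, deriv a.τ t = 3 * w.χ t ^ 2 * deriv w.χ t) ∧
    (∀ t ∈ J, deriv (deriv a.τ) t =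
      6 * w.χ t * deriv w.χ t ^ 2 + 3 * w.χ t ^ 2 * deriv (deriv w.χ) t) ∧
    (∀ t ∈ J, deriv w.ρ t = ν * deriv w.χ t) := by
  have D {f : ℝ → ℝ} (hf : ContDiffOn ℝ ∞ f J) {t : ℝ} (ht : t ∈ J) := smooth_hasDerivAt hJ hf ht
  have h1 : ∀ t ∈ J, deriv a.τ t = 3 * w.χ t ^ 2 * deriv w.χ t := fun t ht => by
    rw [(eventuallyEq_of_mem (hJ.mem_nhds ht) h.eτ).deriv_eq]
    refine ((D h.sw.χ ht).pow 3).deriv.trans ?_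
    norm_num
  refine ⟨h1, fun t ht => ?_, fun t ht => ?_⟩
  · rw [(eventuallyEq_of_mem (hJ.mem_nhds ht) h1).deriv_eq]
    refine ((((D h.sw.χ ht).pow 2).const_mul 3).mul (D (smooth_deriv hJ h.sw.χ) ht)).deriv.trans ?_
    norm_num
    ring
  · rw [(eventuallyEq_of_mem (hJ.mem_nhds ht) h.eρ).deriv_eq]
    exact deriv_const_mul_field _

theorem NormC.fld_a {ν M : ℝ} (hJ : IsOpen J) (h : NormC 𝔰 J a w ν M) {t : ℝ} (ht : t ∈ J)
    (x y u : ℝ) :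
    a.fld (t, x, y, u) = (w.χ t ^ 3, w.χ t ^ 2 * deriv w.χ t * x + a.χ t,
      w.χ t ^ 2 * deriv w.χ t * y + a.ρ t,
      -(1 / 18) * (6 * w.χ t * deriv w.χ t ^ 2 + 3 * w.χ t ^ 2 * deriv (deriv w.χ) t) *
        (x ^ 3 + y ^ 3) - 1 / 2 * deriv a.χ t * x ^ 2 - 1 / 2 * deriv a.ρ t * y ^ 2
        + a.α t * x + a.β t * y + a.σ t) := by
  obtain ⟨h1, h2, -⟩ := h.derivs hJ
  simp only [Coef.fld, h1 t ht, h2 t ht, h.al, h.eτ t ht, Prod.mk.injEq, true_and]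
  refine ⟨?_, ?_, ?_⟩ <;> ring

theorem NormC.fld_w {ν M : ℝ} (hJ : IsOpen J) (h : NormC 𝔰 J a w ν M) {t : ℝ} (ht : t ∈ J)
    (x y u : ℝ) :
    w.fld (t, x, y, u) = (0, w.χ t, ν * w.χ t, -(1 / 2) * deriv w.χ t * (x ^ 2 + ν * y ^ 2)
      + w.α t * x + w.β t * y + w.σ t) := by
  have d1 := deriv_eq_zero_of_zeroOn hJ h.wτ
  simp only [Coef.fld, h.wτ t ht, d1 t ht, deriv_eq_zero_of_zeroOn hJ d1 t ht, h.wl,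
    (h.derivs hJ).2.2 t ht, h.eρ t ht, Prod.mk.injEq, true_and]
  refine ⟨?_, ?_, ?_⟩ <;> ring

/-- The functions of `NormC.exists_parameters` straighten `A` and `W`, and the constant `C`
normalizes `M`. The bound on the components at `t₀` puts `ν` into `[-1, 1]`. -/
theorem TypeC.locallyTreated_of_ne_zero (hJ : IsOpen J) (hJI : J ⊆ I) (ht₀ : t₀ ∈ J)
    (h : TypeC 𝔰 J a w) (haτ : a.τ t₀ = 1) (hχ : w.χ t₀ ≠ 0) (hle : |w.ρ t₀| ≤ |w.χ t₀|) :
    LocallyTreated I 𝔰 t₀ := by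
  obtain ⟨K, hKJ, hK, hK', htK, a, c, M, hN⟩ := h.normalize hJ ht₀ haτ hχ
  have hν : w.ρ t₀ / w.χ t₀ ∈ Icc (-1 : ℝ) 1 := by
    rw [Set.mem_Icc, ← abs_le, abs_div]
    exact div_le_one_of_le₀ hle (abs_nonneg _)
  set ν := w.ρ t₀ / w.χ t₀
  clear h haτ hle
  obtain ⟨ξ, η, w₀, w₁, w₂, hξ, hη, hw₀, hw₁, hw₂, dξ, dη, d₁, d₂, d₀, es⟩ :=
    hN.exists_parameters hK hK'
  have hne : ∀ t ∈ K, c.χ t ≠ 0 := fun t ht => (hN.pos t ht).ne'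
  have D {f : ℝ → ℝ} (hf : ContDiffOn ℝ ∞ f K) {t : ℝ} (ht : t ∈ K) := smooth_hasDerivAt hK hf ht
  -- Scaling `x`, `y` by `C` and `u` by `C³` maps `P^x(1)` to `CP^x(1)` and `MR^y(1)` to
  -- `C²MR^y(1)`. After division by `C` the coefficient of `R^y(1)` is `CM`.
  obtain ⟨C, hC, hδ⟩ : ∃ C : ℝ, C ≠ 0 ∧ C * M ∈ ({0, 1} : Set ℝ) := by
    by_cases hM : M = 0
    · exact ⟨1, one_ne_zero, by simp [hM]⟩
    · exact ⟨M⁻¹, inv_ne_zero hM, by simp [hM]⟩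
  obtain ⟨T, S, Φ, hΦ, -, -, -, hval, hder⟩ :=
    exists_transf hK hK' hN.sw.χ hN.pos hC (contDiffOn_const (c := C).mul hξ)
      (contDiffOn_const (c := C).mul hη) (contDiffOn_const (c := C ^ 3).mul hw₀)
      (contDiffOn_const (c := C ^ 3).mul hw₁) (contDiffOn_const (c := C ^ 3).mul hw₂)
  have hΦ1 : ∀ p ∈ strip K, (Φ p).1 ∈ T '' K := fun p hp => by
    rw [show p = (p.1, p.2.1, p.2.2.1, p.2.2.2) from rfl, hval p.1 hp]
    exact ⟨p.1, hp, rfl⟩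
  have g₁ : ∀ t ∈ K, deriv (fun s => deriv c.χ s / (6 * c.χ s)) t =
      (deriv (deriv c.χ) t * c.χ t - deriv c.χ t ^ 2) / (6 * c.χ t ^ 2) := fun t ht => by
    have h0 := hne t ht
    refine ((D (smooth_deriv hK hN.sw.χ) ht).div ((D hN.sw.χ ht).const_mul 6)
      (by simpa using h0)).deriv.trans ?_
    field_simp
  have g₂ : ∀ {f ζ : ℝ → ℝ}, ContDiffOn ℝ ∞ f K → (∀ t ∈ K, deriv ζ t = -(f t / c.χ t ^ 4)) →
      ∀ t ∈ K, deriv (fun s => c.χ s * deriv (fun t => C * ζ t) s) t =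
        -(C * (deriv f t * c.χ t - 3 * f t * deriv c.χ t) / c.χ t ^ 4) := fun {f ζ} hf hζ t ht => by
    have h0 := hne t ht
    have : ∀ s ∈ K, c.χ s * deriv (fun t => C * ζ t) s = -(C * (f s / c.χ s ^ 3)) := fun s hs => by
      have h0 := hne s hs
      rw [show deriv (fun t => C * ζ t) s = C * deriv ζ s from deriv_const_mul_field C, hζ s hs]
      field_simp
    rw [(eventuallyEq_of_mem (hK.mem_nhds ht) this).deriv_eq]
    refine ((((D hf ht).div ((D hN.sw.χ ht).pow 3) (pow_ne_zero 3 h0)).const_mul C).neg).deriv.trans ?_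
    norm_num
    field_simp
  refine ⟨K, T '' K, Φ, htK, hKJ.trans hJI, hΦ, Or.inl ⟨ν, hν, C * M, hδ,
    pushforwardContains_span fun W hW => ?_⟩⟩
  rcases hW with rfl | rfl
  · refine hN.ha.exists_pushforward 1 hΦ1 fun t ht x y u => ?_
    have h0 := hne t ht
    rw [hN.fld_a hK ht, hder t ht, hval t ht, g₁ t ht, g₂ hN.sa.χ dξ t ht, g₂ hN.sa.ρ dη t ht]
    simp only [Dt, one_smul, Prod.mk.injEq, deriv_const, deriv_const', deriv_const_mul_field',
      dξ t ht, dη t ht]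
    refine ⟨by field_simp, by field_simp; ring, by field_simp; ring, ?_⟩
    have e₁ := d₁ t ht
    have e₂ := d₂ t ht
    have e₀ := d₀ t ht
    field_simp at e₁ e₂ e₀ ⊢
    linear_combination -216 * x * e₁ - 216 * y * e₂ - 216 * c.χ t ^ 3 * e₀
  · refine hN.hw.exists_pushforward C⁻¹ hΦ1 fun t ht x y u => ?_
    have h0 := hne t ht
    have e₁ := es t ht
    rw [hN.fld_w hK ht, hder t ht, hval t ht]
    simp only [Px, Py, Ry, Pi.add_apply, Pi.smul_apply, Prod.mk_add_mk, Prod.smul_mk, deriv_const,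
      deriv_const_mul_field', smul_eq_mul, Prod.mk.injEq, dξ t ht, dη t ht, hN.eβ t ht,
      hN.eχ t ht]
    refine ⟨by simp, by field_simp; ring, by field_simp; ring, ?_⟩
    field_simp
    linear_combination -12 * C * c.χ t ^ 2 * e₁

theorem TypeC.locallyTreated (hJ : IsOpen J) (hJI : J ⊆ I) (ht₀ : t₀ ∈ J)
    (h : TypeC 𝔰 J a w) (haτ : a.τ t₀ = 1) (hne : w.χ t₀ ≠ 0 ∨ w.ρ t₀ ≠ 0) :
    LocallyTreated I 𝔰 t₀ := by
  rcases le_total |w.ρ t₀| |w.χ t₀| with hle | hle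
  · refine h.locallyTreated_of_ne_zero hJ hJI ht₀ haτ (fun h0 => ?_) hle
    rw [h0, abs_zero] at hle
    exact hne.elim (fun h => h h0) fun h => h (abs_nonpos_iff.1 hle)
  · refine (h.swap.locallyTreated_of_ne_zero hJ hJI ht₀ haτ (fun h0 => ?_) hle).of_swap
    have h0' : w.ρ t₀ = 0 := h0
    rw [h0', abs_zero] at hle
    exact hne.elim (fun h => h (abs_nonpos_iff.1 hle)) fun h => h h0'

end TypeC

end DN

namespace DN

open Set Filter Topology

/-! ### Partial derivatives -/

section Partial

variable {U V : Set Base} {f g : Base → ℝ} {q : Base}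

theorem ContDiffOn.dt {m n : ℕ∞} (hU : IsOpen U) (hf : ContDiffOn ℝ n f U) (h : m + 1 ≤ n) :
    ContDiffOn ℝ m (dt f) U :=
  (hf.fderiv_of_isOpen hU (by exact_mod_cast h)).clm_apply contDiffOn_const

theorem ContDiffOn.dx {m n : ℕ∞} (hU : IsOpen U) (hf : ContDiffOn ℝ n f U) (h : m + 1 ≤ n) :
    ContDiffOn ℝ m (dx f) U :=
  (hf.fderiv_of_isOpen hU (by exact_mod_cast h)).clm_apply contDiffOn_const

theorem ContDiffOn.dy {m n : ℕ∞} (hU : IsOpen U) (hf : ContDiffOn ℝ n f U) (h : m + 1 ≤ n) :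
    ContDiffOn ℝ m (dy f) U :=
  (hf.fderiv_of_isOpen hU (by exact_mod_cast h)).clm_apply contDiffOn_const

theorem differentiableAt_of_contDiffOn {n : ℕ∞} (hU : IsOpen U) (hf : ContDiffOn ℝ n f U)
    (hn : 1 ≤ n) (hq : q ∈ U) : DifferentiableAt ℝ f q :=
  (hf.contDiffAt (hU.mem_nhds hq)).differentiableAt (by
    have : (1 : WithTop ℕ∞) ≤ n := by exact_mod_cast hn
    exact (lt_of_lt_of_le one_pos this).ne')

theorem hasDerivAt_dt (hf : DifferentiableAt ℝ f q) :
    HasDerivAt (fun s => f (s, q.2.1, q.2.2)) (dt f q) q.1 :=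
  hf.hasFDerivAt.comp_hasDerivAt q.1 (f := fun s => ((s, q.2.1, q.2.2) : Base))
    ((hasDerivAt_id q.1).prodMk (hasDerivAt_const _ _))

theorem hasDerivAt_dx (hf : DifferentiableAt ℝ f q) :
    HasDerivAt (fun s => f (q.1, s, q.2.2)) (dx f q) q.2.1 :=
  hf.hasFDerivAt.comp_hasDerivAt q.2.1 (f := fun s => ((q.1, s, q.2.2) : Base))
    ((hasDerivAt_const _ _).prodMk ((hasDerivAt_id _).prodMk (hasDerivAt_const _ _)))

theorem hasDerivAt_dy (hf : DifferentiableAt ℝ f q) :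
    HasDerivAt (fun s => f (q.1, q.2.1, s)) (dy f q) q.2.2 :=
  hf.hasFDerivAt.comp_hasDerivAt q.2.2 (f := fun s => ((q.1, q.2.1, s) : Base))
    ((hasDerivAt_const _ _).prodMk ((hasDerivAt_const _ _).prodMk (hasDerivAt_id _)))

theorem dt_eq (hf : DifferentiableAt ℝ f q) (hV : IsOpen V) (hq : q ∈ V) (hfg : EqOn f g V) {D : ℝ}
    (h : HasDerivAt (fun s => g (s, q.2.1, q.2.2)) D q.1) : dt f q = D := by
  refine (hasDerivAt_dt hf).unique (h.congr_of_eventuallyEq ?_)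
  have : ContinuousAt (fun s : ℝ => ((s, q.2.1, q.2.2) : Base)) q.1 := by fun_prop
  filter_upwards [this.preimage_mem_nhds (hV.mem_nhds hq)] with s hs using hfg hs

theorem dx_eq (hf : DifferentiableAt ℝ f q) (hV : IsOpen V) (hq : q ∈ V) (hfg : EqOn f g V) {D : ℝ}
    (h : HasDerivAt (fun s => g (q.1, s, q.2.2)) D q.2.1) : dx f q = D := by
  refine (hasDerivAt_dx hf).unique (h.congr_of_eventuallyEq ?_)
  have : ContinuousAt (fun s : ℝ => ((q.1, s, q.2.2) : Base)) q.2.1 := by fun_prop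
  filter_upwards [this.preimage_mem_nhds (hV.mem_nhds hq)] with s hs using hfg hs

theorem dy_eq (hf : DifferentiableAt ℝ f q) (hV : IsOpen V) (hq : q ∈ V) (hfg : EqOn f g V) {D : ℝ}
    (h : HasDerivAt (fun s => g (q.1, q.2.1, s)) D q.2.2) : dy f q = D := by
  refine (hasDerivAt_dy hf).unique (h.congr_of_eventuallyEq ?_)
  have : ContinuousAt (fun s : ℝ => ((q.1, q.2.1, s) : Base)) q.2.2 := by fun_prop
  filter_upwards [this.preimage_mem_nhds (hV.mem_nhds hq)] with s hs using hfg hs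

/-- A function with `f_x = f_y = 0` on a box depends on `t` only. -/
theorem eq_of_partial_eq_zero {K A B : Set ℝ} (hA : A.OrdConnected) (hB : B.OrdConnected)
    (hx : ∀ r ∈ K ×ˢ A ×ˢ B, HasDerivAt (fun s => f (r.1, s, r.2.2)) 0 r.2.1)
    (hy : ∀ r ∈ K ×ˢ A ×ˢ B, HasDerivAt (fun s => f (r.1, r.2.1, s)) 0 r.2.2)
    {r : Base} (hr : r ∈ K ×ˢ A ×ˢ B) {x y : ℝ} (h1 : x ∈ A) (h2 : y ∈ B) :
    f r = f (r.1, x, y) := by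
  have e1 : f r = f (r.1, x, r.2.2) := eq_of_hasDerivAt_zero (f := fun s => f (r.1, s, r.2.2)) hA
    (fun s hs => hx (r.1, s, r.2.2) ⟨hr.1, hs, hr.2.2⟩) hr.2.1 h1
  exact e1.trans (eq_of_hasDerivAt_zero (f := fun s => f (r.1, x, s)) hB
    (fun s hs => hy (r.1, x, s) ⟨hr.1, h1, hs⟩) hr.2.2 h2)

theorem exists_box (hU : IsOpen U) (hq : q ∈ U) :
    ∃ K A B : Set ℝ, IsOpen K ∧ K.OrdConnected ∧ IsOpen A ∧ A.OrdConnected ∧ IsOpen B ∧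
      B.OrdConnected ∧ q ∈ K ×ˢ A ×ˢ B ∧ K ×ˢ A ×ˢ B ⊆ U := by
  obtain ⟨ε, hε, h⟩ := Metric.isOpen_iff.1 hU q hq
  refine ⟨Metric.ball q.1 ε, Metric.ball q.2.1 ε, Metric.ball q.2.2 ε, Metric.isOpen_ball,
    (convex_ball _ _).ordConnected, Metric.isOpen_ball, (convex_ball _ _).ordConnected,
    Metric.isOpen_ball, (convex_ball _ _).ordConnected, ⟨Metric.mem_ball_self hε,
    Metric.mem_ball_self hε, Metric.mem_ball_self hε⟩, ?_⟩
  rwa [ball_prod_same, ball_prod_same]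

theorem hasDerivAt_cubic (a b c d x : ℝ) :
    HasDerivAt (fun s : ℝ => a * s ^ 3 + b * s ^ 2 + c * s + d) (3 * a * x ^ 2 + 2 * b * x + c)
      x := by
  refine ((((((hasDerivAt_id x).pow 3).const_mul a).add (((hasDerivAt_id x).pow 2).const_mul b)).add
    ((hasDerivAt_id x).const_mul c)).add_const d).congr_deriv ?_
  simp
  ring

/-! ### Swapping `x` and `y` -/

/-- The permutation of `x` and `y` in the space of independent variables. -/
def swapBase : Base ≃L[ℝ] Base :=
  (ContinuousLinearEquiv.refl ℝ ℝ).prodCongr (ContinuousLinearEquiv.prodComm ℝ ℝ ℝ)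

theorem swapBase_apply (q : Base) : swapBase q = (q.1, q.2.2, q.2.1) := rfl

theorem dt_comp_swap (f : Base → ℝ) : dt (f ∘ swapBase) = dt f ∘ swapBase := by
  funext q
  simp only [dt, Function.comp_apply, swapBase.comp_right_fderiv]
  rfl

theorem dx_comp_swap (f : Base → ℝ) : dx (f ∘ swapBase) = dy f ∘ swapBase := by
  funext q
  simp only [dx, dy, Function.comp_apply, swapBase.comp_right_fderiv]
  rfl

theorem dy_comp_swap (f : Base → ℝ) : dy (f ∘ swapBase) = dx f ∘ swapBase := by
  funext q
  simp only [dx, dy, Function.comp_apply, swapBase.comp_right_fderiv]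
  rfl

/-- The order of derivatives in the equation is fixed, so its symmetry under the permutation of `x`
and `y` needs Schwarz's theorem. -/
theorem dx_dy_comm {n : ℕ∞} (hU : IsOpen U) (hf : ContDiffOn ℝ n f U) (hn : 2 ≤ n) (hq : q ∈ U) :
    dx (dy f) q = dy (dx f) q := by
  have h : ContDiffAt ℝ n f q := hf.contDiffAt (hU.mem_nhds hq)
  have h2 : ((2 : ℕ∞) : WithTop ℕ∞) ≤ n := WithTop.coe_le_coe.2 hn
  have hd : DifferentiableAt ℝ (fderiv ℝ f) q :=
    (h.fderiv_right (m := 1) (by simpa [one_add_one_eq_two] using h2)).differentiableAt (by simp)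
  have hs : IsSymmSndFDerivAt ℝ f q := h.isSymmSndFDerivAt (by simpa using h2)
  have key (v w : Base) : fderiv ℝ (fun r => fderiv ℝ f r v) q w = fderiv ℝ (fderiv ℝ f) q w v := by
    rw [fderiv_clm_apply hd (differentiableAt_const v)]
    simp
  exact (key _ _).trans ((hs _ _).trans (key _ _).symm)

end Partial

/-- Near `q`, the function `u` is equivalent to an element of the constructed families. -/
def LocallyKnown (n : ℕ∞) (I : Set ℝ) (U : Set Base) (u : Base → ℝ) (q : Base) : Prop :=
  ∃ (J J' : Set ℝ) (Φ : Space → Space) (V : Set Base) (u' : Base → ℝ),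
    J ⊆ I ∧ PointSym J J' Φ ∧ IsOpen V ∧ q ∈ V ∧ V ⊆ U ∧ (∀ r ∈ V, r.1 ∈ J) ∧
    MapsGraph Φ V u u' ∧ IsKnownSolution n J' ((fun r => base (Φ (graphPt u r))) '' V) u'

theorem LocallyKnown.of_swap {n : ℕ∞} {I : Set ℝ} {U : Set Base} {u : Base → ℝ} {q : Base}
    (h : LocallyKnown n I (swapBase ⁻¹' U) (u ∘ swapBase) (swapBase q)) :
    LocallyKnown n I U u q := by
  obtain ⟨J, J', Φ, V, u', h1, h2, h3, h4, h5, h6, h7, h8⟩ := h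
  have hJ := h2.isOpen_ordConnected
  refine ⟨J, J', Φ ∘ swapXY, swapBase ⁻¹' V, u', h1, PointSym.comp J J J' swapXY Φ
    (PointSym.swap J hJ.1 hJ.2) h2, h3.preimage swapBase.continuous, h4, fun r hr => ?_,
    fun r hr => h6 (swapBase r) hr, fun r hr => h7 (swapBase r) hr, ?_⟩
  · exact h5 hr
  · convert h8 using 1
    ext r
    constructor
    · rintro ⟨s, hs, rfl⟩
      exact ⟨_, hs, rfl⟩
    · rintro ⟨s, hs, rfl⟩
      exact ⟨swapBase s, hs, rfl⟩

section Swap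

variable {U : Set Base} {u : Base → ℝ}

theorem IsSolution.swap {n : ℕ∞} (hn : 3 ≤ n) (hU : IsOpen U) (hu : ContDiffOn ℝ n u U)
    (h : IsSolution U u) : IsSolution (swapBase ⁻¹' U) (u ∘ swapBase) := by
  intro q hq
  have h1 := h (swapBase q) hq
  have hu3 : ContDiffOn ℝ (3 : ℕ∞) u U := hu.of_le (by exact_mod_cast hn)
  have hU' := hU.mem_nhds hq
  have e : dx (dy u) =ᶠ[𝓝 (swapBase q)] dy (dx u) :=
    eventuallyEq_of_mem hU' fun r hr => dx_dy_comm hU hu3 (by norm_num) hr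
  have e1 : (fun r => dy (dy u) r * dx (dy u) r) =ᶠ[𝓝 (swapBase q)]
      fun r => dy (dx u) r * dy (dy u) r := by
    filter_upwards [e] with r hr
    rw [hr, mul_comm]
  have e2 : (fun r => dx (dy u) r * dx (dx u) r) =ᶠ[𝓝 (swapBase q)]
      fun r => dx (dx u) r * dy (dx u) r := by
    filter_upwards [e] with r hr
    rw [hr, mul_comm]
  have e3 := dx_dy_comm hU (ContDiffOn.dt (m := 2) hU hu3 (by norm_num)) le_rfl hq
  simp only [dt_comp_swap, dx_comp_swap, dy_comp_swap]
  have c1 : (fun r => (dy (dy u) ∘ swapBase) r * (dx (dy u) ∘ swapBase) r) =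
      (fun r => dy (dy u) r * dx (dy u) r) ∘ swapBase := rfl
  have c2 : (fun r => (dx (dy u) ∘ swapBase) r * (dx (dx u) ∘ swapBase) r) =
      (fun r => dx (dy u) r * dx (dx u) r) ∘ swapBase := rfl
  rw [c1, c2, dx_comp_swap, dy_comp_swap]
  simp only [Function.comp_apply]
  rw [e3, h1, add_comm]
  congr 1
  · exact congrArg (fun L : Base →L[ℝ] ℝ => L (0, 0, 1)) e1.fderiv_eq.symm
  · exact congrArg (fun L : Base →L[ℝ] ℝ => L (0, 1, 0)) e2.fderiv_eq.symm


theorem IsInvariant.swap {𝔰 : Submodule ℝ (Space → Space)} (h : IsInvariant U 𝔰 u) :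
    IsInvariant (swapBase ⁻¹' U) (swapSub 𝔰) (u ∘ swapBase) := by
  intro V hV q hq
  have := h _ hV (swapBase q) hq
  simp only [dt_comp_swap, dx_comp_swap, dy_comp_swap, Function.comp_apply]
  refine Eq.trans this ?_
  change (V (graphPt (u ∘ swapBase) q)).1 * _ + (V (graphPt (u ∘ swapBase) q)).2.2.1 * _ +
    (V (graphPt (u ∘ swapBase) q)).2.1 * _ = _
  ring

theorem HasFld.isInvariant {𝔰 : Submodule ℝ (Space → Space)} {J : Set ℝ} {c : Coef}
    (hc : HasFld 𝔰 J c) (h : IsInvariant U 𝔰 u) {q : Base} (hq : q ∈ U) (hJ : q.1 ∈ J) :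
    (c.fld (graphPt u q)).2.2.2 = (c.fld (graphPt u q)).1 * dt u q +
      (c.fld (graphPt u q)).2.1 * dx u q + (c.fld (graphPt u q)).2.2.1 * dy u q := by
  obtain ⟨V, hV, hV'⟩ := hc
  rw [← hV' (show graphPt u q ∈ strip J from hJ)]
  exact h V hV q hq

end Swap

end DN

namespace DN

open Set Filter Topology

/-! ### Solutions that are polynomial up to a function of one variable -/

/-- The coefficients of a polynomial of degree three in `x`, `y`. -/
structure Cubic where
  (c30 c21 c12 c03 c20 c11 c02 c10 c01 c00 : ℝ → ℝ)

namespace Cubic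

variable (P : Cubic)

def eval (q : Base) : ℝ :=
  P.c30 q.1 * q.2.1 ^ 3 + P.c21 q.1 * q.2.1 ^ 2 * q.2.2 + P.c12 q.1 * q.2.1 * q.2.2 ^ 2 +
    P.c03 q.1 * q.2.2 ^ 3 + P.c20 q.1 * q.2.1 ^ 2 + P.c11 q.1 * q.2.1 * q.2.2 +
    P.c02 q.1 * q.2.2 ^ 2 + P.c10 q.1 * q.2.1 + P.c01 q.1 * q.2.2 + P.c00 q.1

structure DifferentiableAt (t : ℝ) : Prop where
  c30 : _root_.DifferentiableAt ℝ P.c30 t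
  c21 : _root_.DifferentiableAt ℝ P.c21 t
  c12 : _root_.DifferentiableAt ℝ P.c12 t
  c03 : _root_.DifferentiableAt ℝ P.c03 t
  c20 : _root_.DifferentiableAt ℝ P.c20 t
  c11 : _root_.DifferentiableAt ℝ P.c11 t
  c02 : _root_.DifferentiableAt ℝ P.c02 t
  c10 : _root_.DifferentiableAt ℝ P.c10 t
  c01 : _root_.DifferentiableAt ℝ P.c01 t
  c00 : _root_.DifferentiableAt ℝ P.c00 t

end Cubic

/-- The dispersionless Nizhnik equation for `u = P + F(k (y - ν x) + m)` with a polynomial `P` of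
degree three in `x`, `y`. -/
theorem IsSolution.cubic_add_comp {V : Set Base} {u : Base → ℝ} (hsol : IsSolution V u)
    (hV : IsOpen V) (hu : ContDiffOn ℝ (3 : ℕ∞) u V) {P : Cubic}
    (hP : ∀ q ∈ V, P.DifferentiableAt q.1) {k m : ℝ → ℝ} (hk : ∀ q ∈ V, DifferentiableAt ℝ k q.1)
    (hm : ∀ q ∈ V, DifferentiableAt ℝ m q.1) {ν : ℝ} {F F₁ F₂ F₃ : ℝ → ℝ} {Θ : Set ℝ}
    (hΘ : ∀ q ∈ V, k q.1 * (q.2.2 - ν * q.2.1) + m q.1 ∈ Θ)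
    (h₁ : ∀ s ∈ Θ, HasDerivAt F (F₁ s) s) (h₂ : ∀ s ∈ Θ, HasDerivAt F₁ (F₂ s) s)
    (h₃ : ∀ s ∈ Θ, HasDerivAt F₂ (F₃ s) s)
    (h : ∀ q ∈ V, u q = P.eval q + F (k q.1 * (q.2.2 - ν * q.2.1) + m q.1))
    {t x y : ℝ} (hq : (t, x, y) ∈ V) {f₂ f₃ a v b : ℝ}
    (e₂ : F₂ (k t * (y - ν * x) + m t) = f₂) (e₃ : F₃ (k t * (y - ν * x) + m t) = f₃)
    (ha : a = 6 * P.c30 t * x + 2 * P.c21 t * y + 2 * P.c20 t + ν ^ 2 * k t ^ 2 * f₂)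
    (hv : v = 2 * P.c21 t * x + 2 * P.c12 t * y + P.c11 t - ν * k t ^ 2 * f₂)
    (hb : b = 2 * P.c12 t * x + 6 * P.c03 t * y + 2 * P.c02 t + k t ^ 2 * f₂) :
    deriv P.c11 t + 2 * deriv P.c21 t * x + 2 * deriv P.c12 t * y -
        ν * k t ^ 2 * f₃ * (deriv k t * (y - ν * x) + deriv m t) - 2 * ν * k t * deriv k t * f₂ =
      (6 * P.c30 t - ν ^ 3 * k t ^ 3 * f₃) * v + a * (2 * P.c21 t + ν ^ 2 * k t ^ 3 * f₃) +
        (2 * P.c12 t - ν * k t ^ 3 * f₃) * b + v * (6 * P.c03 t + k t ^ 3 * f₃) := by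
  have hx (r : Base) : HasDerivAt (fun s => k r.1 * (r.2.2 - ν * s) + m r.1) (-(ν * k r.1)) r.2.1 := by
    refine ((((hasDerivAt_id r.2.1).const_mul ν).const_sub r.2.2).const_mul (k r.1)).add_const
      (m r.1) |>.congr_deriv ?_
    ring
  have hy (r : Base) : HasDerivAt (fun s => k r.1 * (s - ν * r.2.1) + m r.1) (k r.1) r.2.2 := by
    refine ((((hasDerivAt_id r.2.2).sub_const (ν * r.2.1)).const_mul (k r.1)).add_const
      (m r.1)).congr_deriv ?_
    ring
  have hz (r : Base) : HasDerivAt (fun s => deriv k r.1 * (r.2.2 - ν * s) + deriv m r.1)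
      (-(ν * deriv k r.1)) r.2.1 := by
    refine ((((hasDerivAt_id r.2.1).const_mul ν).const_sub r.2.2).const_mul
      (deriv k r.1)).add_const (deriv m r.1) |>.congr_deriv ?_
    ring
  have hw (r : Base) : HasDerivAt (fun s => deriv k r.1 * (s - ν * r.2.1) + deriv m r.1)
      (deriv k r.1) r.2.2 := by
    refine ((((hasDerivAt_id r.2.2).sub_const (ν * r.2.1)).const_mul (deriv k r.1)).add_const
      (deriv m r.1)).congr_deriv ?_
    ring
  have D {f : Base → ℝ} {i : ℕ∞} (hf : ContDiffOn ℝ i f V) (hi : 1 ≤ i) {r : Base} (hr : r ∈ V) :=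
    differentiableAt_of_contDiffOn hV hf hi hr
  have cx : ContDiffOn ℝ (2 : ℕ∞) (dx u) V := ContDiffOn.dx hV hu (by norm_num)
  have cy : ContDiffOn ℝ (2 : ℕ∞) (dy u) V := ContDiffOn.dy hV hu (by norm_num)
  have ct : ContDiffOn ℝ (2 : ℕ∞) (dt u) V := ContDiffOn.dt hV hu (by norm_num)
  have ctx : ContDiffOn ℝ (1 : ℕ∞) (dx (dt u)) V := ContDiffOn.dx hV ct (by norm_num)
  have cxx : ContDiffOn ℝ (1 : ℕ∞) (dx (dx u)) V := ContDiffOn.dx hV cx (by norm_num)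
  have cxy : ContDiffOn ℝ (1 : ℕ∞) (dy (dx u)) V := ContDiffOn.dy hV cx (by norm_num)
  have cyy : ContDiffOn ℝ (1 : ℕ∞) (dy (dy u)) V := ContDiffOn.dy hV cy (by norm_num)
  -- The derivative in `t` is the innermost one in `u_txy`, so each coefficient has to be
  -- differentiated only once.
  have et : EqOn (dt u) (fun r => deriv P.c30 r.1 * r.2.1 ^ 3 + deriv P.c21 r.1 * r.2.1 ^ 2 * r.2.2 +
      deriv P.c12 r.1 * r.2.1 * r.2.2 ^ 2 + deriv P.c03 r.1 * r.2.2 ^ 3 +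
      deriv P.c20 r.1 * r.2.1 ^ 2 + deriv P.c11 r.1 * r.2.1 * r.2.2 + deriv P.c02 r.1 * r.2.2 ^ 2 +
      deriv P.c10 r.1 * r.2.1 + deriv P.c01 r.1 * r.2.2 + deriv P.c00 r.1 +
      F₁ (k r.1 * (r.2.2 - ν * r.2.1) + m r.1) *
        (deriv k r.1 * (r.2.2 - ν * r.2.1) + deriv m r.1)) V := fun r hr => by
    have hd := hP r hr
    refine dt_eq (D hu (by norm_num) hr) hV hr h ?_
    have hθ : HasDerivAt (fun s => k s * (r.2.2 - ν * r.2.1) + m s)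
        (deriv k r.1 * (r.2.2 - ν * r.2.1) + deriv m r.1) r.1 :=
      ((hk r hr).hasDerivAt.mul_const _).add (hm r hr).hasDerivAt
    refine HasDerivAt.add ?_ ((h₁ _ (hΘ r hr)).comp r.1 hθ)
    simp only [Cubic.eval]
    exact ((((((((((hd.c30.hasDerivAt.mul_const _).add
      ((hd.c21.hasDerivAt.mul_const _).mul_const _)).add
      ((hd.c12.hasDerivAt.mul_const _).mul_const _)).add (hd.c03.hasDerivAt.mul_const _)).add
      (hd.c20.hasDerivAt.mul_const _)).add ((hd.c11.hasDerivAt.mul_const _).mul_const _)).add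
      (hd.c02.hasDerivAt.mul_const _)).add (hd.c10.hasDerivAt.mul_const _)).add
      (hd.c01.hasDerivAt.mul_const _)).add hd.c00.hasDerivAt)
  have etx : EqOn (dx (dt u)) (fun r => 3 * deriv P.c30 r.1 * r.2.1 ^ 2 +
      2 * deriv P.c21 r.1 * r.2.1 * r.2.2 + deriv P.c12 r.1 * r.2.2 ^ 2 +
      2 * deriv P.c20 r.1 * r.2.1 + deriv P.c11 r.1 * r.2.2 + deriv P.c10 r.1 +
      F₂ (k r.1 * (r.2.2 - ν * r.2.1) + m r.1) * -(ν * k r.1) *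
        (deriv k r.1 * (r.2.2 - ν * r.2.1) + deriv m r.1) +
      F₁ (k r.1 * (r.2.2 - ν * r.2.1) + m r.1) * -(ν * deriv k r.1)) V := fun r hr => by
    refine dx_eq (D ct (by norm_num) hr) hV hr et ?_
    refine (((hasDerivAt_cubic (deriv P.c30 r.1) (deriv P.c21 r.1 * r.2.2 + deriv P.c20 r.1)
      (deriv P.c12 r.1 * r.2.2 ^ 2 + deriv P.c11 r.1 * r.2.2 + deriv P.c10 r.1)
      (deriv P.c03 r.1 * r.2.2 ^ 3 + deriv P.c02 r.1 * r.2.2 ^ 2 + deriv P.c01 r.1 * r.2.2 +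
      deriv P.c00 r.1) r.2.1).add (((h₂ _ (hΘ r hr)).comp r.2.1 (hx r)).mul
      (hz r))).congr_deriv ?_).congr_of_eventuallyEq (Eventually.of_forall fun s => ?_)
    · simp only [Function.comp_apply]; ring
    · simp only [Pi.add_apply, Pi.mul_apply, Function.comp_apply]; ring
  have etxy := dy_eq (D ctx (by norm_num) hq) hV hq etx
    ((((hasDerivAt_cubic 0 (deriv P.c12 t) (2 * deriv P.c21 t * x + deriv P.c11 t)
      (3 * deriv P.c30 t * x ^ 2 + 2 * deriv P.c20 t * x + deriv P.c10 t) y).add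
      ((((h₃ _ (hΘ _ hq)).comp y (hy (t, x, y))).mul_const (-(ν * k t))).mul
      (hw (t, x, y)))).add (((h₂ _ (hΘ _ hq)).comp y (hy (t, x, y))).mul_const
      (-(ν * deriv k t)))).congr_of_eventuallyEq (Eventually.of_forall fun s => by
        simp only [Pi.add_apply, Pi.mul_apply, Function.comp_apply]; ring))
  have ex : EqOn (dx u) (fun r => 3 * P.c30 r.1 * r.2.1 ^ 2 +
      2 * P.c21 r.1 * r.2.1 * r.2.2 + P.c12 r.1 * r.2.2 ^ 2 +
      2 * P.c20 r.1 * r.2.1 + P.c11 r.1 * r.2.2 + P.c10 r.1 +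
      F₁ (k r.1 * (r.2.2 - ν * r.2.1) + m r.1) * -(ν * k r.1)) V := fun r hr => by
    refine dx_eq (D hu (by norm_num) hr) hV hr h ?_
    refine (((hasDerivAt_cubic (P.c30 r.1) (P.c21 r.1 * r.2.2 + P.c20 r.1)
      (P.c12 r.1 * r.2.2 ^ 2 + P.c11 r.1 * r.2.2 + P.c10 r.1)
      (P.c03 r.1 * r.2.2 ^ 3 + P.c02 r.1 * r.2.2 ^ 2 + P.c01 r.1 * r.2.2 +
      P.c00 r.1) r.2.1).add ((h₁ _ (hΘ r hr)).comp r.2.1 (hx r))).congr_deriv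
      ?_).congr_of_eventuallyEq (Eventually.of_forall fun s => ?_)
    · ring
    · simp only [Pi.add_apply, Function.comp_apply, Cubic.eval]; ring
  have ey : EqOn (dy u) (fun r => 3 * P.c03 r.1 * r.2.2 ^ 2 +
      2 * P.c12 r.1 * r.2.1 * r.2.2 + P.c21 r.1 * r.2.1 ^ 2 +
      2 * P.c02 r.1 * r.2.2 + P.c11 r.1 * r.2.1 + P.c01 r.1 +
      F₁ (k r.1 * (r.2.2 - ν * r.2.1) + m r.1) * k r.1) V := fun r hr => by
    refine dy_eq (D hu (by norm_num) hr) hV hr h ?_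
    refine (((hasDerivAt_cubic (P.c03 r.1) (P.c12 r.1 * r.2.1 + P.c02 r.1)
      (P.c21 r.1 * r.2.1 ^ 2 + P.c11 r.1 * r.2.1 + P.c01 r.1)
      (P.c30 r.1 * r.2.1 ^ 3 + P.c20 r.1 * r.2.1 ^ 2 + P.c10 r.1 * r.2.1 +
      P.c00 r.1) r.2.2).add ((h₁ _ (hΘ r hr)).comp r.2.2 (hy r))).congr_deriv
      ?_).congr_of_eventuallyEq (Eventually.of_forall fun s => ?_)
    · ring
    · simp only [Pi.add_apply, Function.comp_apply, Cubic.eval]; ring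
  have exx : EqOn (dx (dx u)) (fun r => 6 * P.c30 r.1 * r.2.1 + 2 * P.c21 r.1 * r.2.2 +
      2 * P.c20 r.1 + F₂ (k r.1 * (r.2.2 - ν * r.2.1) + m r.1) * (ν * k r.1) ^ 2) V :=
      fun r hr => by
    refine dx_eq (D cx (by norm_num) hr) hV hr ex ?_
    refine (((hasDerivAt_cubic 0 (3 * P.c30 r.1) (2 * P.c21 r.1 * r.2.2 + 2 * P.c20 r.1)
      (P.c12 r.1 * r.2.2 ^ 2 + P.c11 r.1 * r.2.2 + P.c10 r.1) r.2.1).add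
      (((h₂ _ (hΘ r hr)).comp r.2.1 (hx r)).mul_const (-(ν * k r.1)))).congr_deriv
      ?_).congr_of_eventuallyEq (Eventually.of_forall fun s => ?_)
    · ring
    · simp only [Pi.add_apply, Function.comp_apply]; ring
  have exy : EqOn (dy (dx u)) (fun r => 2 * P.c21 r.1 * r.2.1 + 2 * P.c12 r.1 * r.2.2 +
      P.c11 r.1 + F₂ (k r.1 * (r.2.2 - ν * r.2.1) + m r.1) * (-(ν * k r.1 ^ 2))) V :=
      fun r hr => by
    refine dy_eq (D cx (by norm_num) hr) hV hr ex ?_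
    refine (((hasDerivAt_cubic 0 (P.c12 r.1) (2 * P.c21 r.1 * r.2.1 + P.c11 r.1)
      (3 * P.c30 r.1 * r.2.1 ^ 2 + 2 * P.c20 r.1 * r.2.1 + P.c10 r.1) r.2.2).add
      (((h₂ _ (hΘ r hr)).comp r.2.2 (hy r)).mul_const (-(ν * k r.1)))).congr_deriv
      ?_).congr_of_eventuallyEq (Eventually.of_forall fun s => ?_)
    · ring
    · simp only [Pi.add_apply, Function.comp_apply]; ring
  have eyy : EqOn (dy (dy u)) (fun r => 6 * P.c03 r.1 * r.2.2 + 2 * P.c12 r.1 * r.2.1 +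
      2 * P.c02 r.1 + F₂ (k r.1 * (r.2.2 - ν * r.2.1) + m r.1) * k r.1 ^ 2) V :=
      fun r hr => by
    refine dy_eq (D cy (by norm_num) hr) hV hr ey ?_
    refine (((hasDerivAt_cubic 0 (3 * P.c03 r.1) (2 * P.c12 r.1 * r.2.1 + 2 * P.c02 r.1)
      (P.c21 r.1 * r.2.1 ^ 2 + P.c11 r.1 * r.2.1 + P.c01 r.1) r.2.2).add
      (((h₂ _ (hΘ r hr)).comp r.2.2 (hy r)).mul_const (k r.1))).congr_deriv
      ?_).congr_of_eventuallyEq (Eventually.of_forall fun s => ?_)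
    · ring
    · simp only [Pi.add_apply, Function.comp_apply]; ring
  have r1 := dx_eq (D (cxx.mul cxy) le_rfl hq) hV hq
    (fun r hr => congrArg₂ (· * ·) (exx hr) (exy hr))
    ((((hasDerivAt_cubic 0 0 (6 * P.c30 t) (2 * P.c21 t * y + 2 * P.c20 t) x).add
      (((h₃ _ (hΘ _ hq)).comp x (hx (t, x, y))).mul_const ((ν * k t) ^ 2))).mul
      ((hasDerivAt_cubic 0 0 (2 * P.c21 t) (2 * P.c12 t * y + P.c11 t) x).add
      (((h₃ _ (hΘ _ hq)).comp x (hx (t, x, y))).mul_const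
      (-(ν * k t ^ 2))))).congr_of_eventuallyEq (Eventually.of_forall fun s => by
        simp only [Pi.add_apply, Pi.mul_apply, Function.comp_apply]; ring))
  have r2 := dy_eq (D (cxy.mul cyy) le_rfl hq) hV hq
    (fun r hr => congrArg₂ (· * ·) (exy hr) (eyy hr))
    ((((hasDerivAt_cubic 0 0 (2 * P.c12 t) (2 * P.c21 t * x + P.c11 t) y).add
      (((h₃ _ (hΘ _ hq)).comp y (hy (t, x, y))).mul_const (-(ν * k t ^ 2)))).mul
      ((hasDerivAt_cubic 0 0 (6 * P.c03 t) (2 * P.c12 t * x + 2 * P.c02 t) y).add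
      (((h₃ _ (hΘ _ hq)).comp y (hy (t, x, y))).mul_const
      (k t ^ 2)))).congr_of_eventuallyEq (Eventually.of_forall fun s => by
        simp only [Pi.add_apply, Pi.mul_apply, Function.comp_apply]; ring))
  have key := hsol _ hq
  simp only [Pi.add_apply, Function.comp_apply, e₂, e₃] at etxy r1 r2
  rw [etxy, show dx (fun r => dx (dx u) r * dy (dx u) r) (t, x, y) = _ from r1,
    show dy (fun r => dy (dx u) r * dy (dy u) r) (t, x, y) = _ from r2] at key
  rw [ha, hv, hb]
  linear_combination key

end DN

/-! ### Polynomial solutions and invariant solutions of type A -/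

namespace DN

open Set Filter Topology

/-- The case `F = 0` of the preceding computation. At each `t` it is an affine identity in `x`, `y`.
-/
theorem IsSolution.cubic {V : Set Base} {u : Base → ℝ} (hsol : IsSolution V u)
    (hV : IsOpen V) (hu : ContDiffOn ℝ (3 : ℕ∞) u V) {P : Cubic}
    (hP : ∀ q ∈ V, P.DifferentiableAt q.1) (h : EqOn u P.eval V) {t x y : ℝ}
    (hq : (t, x, y) ∈ V) :
    deriv P.c11 t + 2 * deriv P.c21 t * x + 2 * deriv P.c12 t * y =
      (6 * P.c30 t + 2 * P.c12 t) * (2 * P.c12 t * y) +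
      (2 * P.c21 t + 6 * P.c03 t) * (2 * P.c21 t * x) +
      6 * (P.c30 t + P.c03 t) * P.c11 t + 6 * P.c30 t * (2 * P.c21 t * x) +
      2 * P.c21 t * (6 * P.c30 t * x + 2 * P.c21 t * y + 2 * P.c20 t) +
      2 * P.c12 t * (2 * P.c12 t * x + 6 * P.c03 t * y + 2 * P.c02 t) +
      6 * P.c03 t * (2 * P.c12 t * y) - 4 * P.c12 t ^ 2 * y - 4 * P.c21 t ^ 2 * x := by
  have := hsol.cubic_add_comp hV hu hP (k := 0) (m := 0) (F := 0) (F₁ := 0) (F₂ := 0) (F₃ := 0)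
    (ν := 0) (Θ := univ) (fun _ _ => differentiableAt_const 0) (fun _ _ => differentiableAt_const 0)
    (fun _ _ => mem_univ _) (fun s _ => hasDerivAt_const s 0) (fun s _ => hasDerivAt_const s 0)
    (fun s _ => hasDerivAt_const s 0) (fun r hr => by simpa using h hr) hq rfl rfl rfl rfl rfl
  simp only [Pi.zero_apply] at this
  linear_combination this

/-- Equivalence of `u` to the solution `G(S(t), x, y)`, where `S` is the inverse of the change of
time. -/
theorem LocallyKnown.of_transf {n : ℕ∞} {I K : Set ℝ} {U V : Set Base} {u : Base → ℝ} {q : Base}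
    {χ X Y W₀ W₁ W₂ : ℝ → ℝ} (hK : IsOpen K) (hK' : K.OrdConnected) (hKI : K ⊆ I)
    (hχ : ContDiffOn ℝ ∞ χ K) (hpos : ∀ t ∈ K, 0 < χ t) (hX : ContDiffOn ℝ ∞ X K)
    (hY : ContDiffOn ℝ ∞ Y K) (hW₀ : ContDiffOn ℝ ∞ W₀ K) (hW₁ : ContDiffOn ℝ ∞ W₁ K)
    (hW₂ : ContDiffOn ℝ ∞ W₂ K) (hV : IsOpen V) (hVU : V ⊆ U) (hVK : ∀ r ∈ V, r.1 ∈ K) (hq : q ∈ V)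
    {G : Base → ℝ} (hG : ∀ r ∈ V, u r + deriv χ r.1 / (6 * χ r.1) * (r.2.1 ^ 3 + r.2.2 ^ 3) -
      1 / 2 * (χ r.1 * deriv X r.1 * r.2.1 ^ 2 + χ r.1 * deriv Y r.1 * r.2.2 ^ 2) +
      W₁ r.1 * r.2.1 + W₂ r.1 * r.2.2 + W₀ r.1 =
        G (r.1, r.2.1 / χ r.1 + X r.1, r.2.2 / χ r.1 + Y r.1))
    (hknown : ∀ T S : ℝ → ℝ, ContDiffOn ℝ ∞ S (T '' K) → MapsTo S (T '' K) K →
      (∀ t ∈ K, S (T t) = t) → (∀ t ∈ K, HasDerivAt S (χ t ^ 3) (T t)) →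
      IsKnownSolution n (T '' K)
        ((fun r : Base => (T r.1, r.2.1 / χ r.1 + X r.1, r.2.2 / χ r.1 + Y r.1)) '' V)
        (fun p => G (S p.1, p.2))) : LocallyKnown n I U u q := by
  obtain ⟨T, S, Φ, hΦ, hS, hST, hS', hval, -⟩ :=
    exists_transf hK hK' hχ hpos one_ne_zero hX hY hW₀ hW₁ hW₂
  have hmaps : MapsTo S (T '' K) K := by
    rintro _ ⟨t, ht, rfl⟩
    rwa [hST t ht]
  have hb : ∀ r ∈ V, base (Φ (graphPt u r)) =
      (T r.1, r.2.1 / χ r.1 + X r.1, r.2.2 / χ r.1 + Y r.1) := fun r hr => by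
    simp [graphPt, hval r.1 (hVK r hr), base]
  refine ⟨K, T '' K, Φ, V, fun p => G (S p.1, p.2), hKI, hΦ, hV, hq, hVU, hVK, fun r hr => ?_, ?_⟩
  · rw [hb r hr]
    simp only [hST _ (hVK r hr), ← hG r hr, graphPt, hval r.1 (hVK r hr)]
    ring
  · rw [image_congr hb]
    exact hknown T S hS hmaps hST hS'

/-- Equivalence of solutions that are polynomial in `x`, `y` to solutions of the first two
families. -/
theorem LocallyKnown.of_polynomial {n : ℕ∞} {I J : Set ℝ} {U V : Set Base} {u : Base → ℝ} {q : Base}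
    (hJ : IsOpen J) (hJI : J ⊆ I) (hV : IsOpen V) (hVU : V ⊆ U) (hVJ : ∀ r ∈ V, r.1 ∈ J)
    (hq : q ∈ V) {A B a b c d e g : ℝ → ℝ} (hA : ContDiffOn ℝ ∞ A J) (hB : ContDiffOn ℝ ∞ B J)
    (ha : ContDiffOn ℝ ∞ a J) (hb : ContDiffOn ℝ ∞ b J) (hc : ContDiffOn ℝ ∞ c J)
    (hd : ContDiffOn ℝ ∞ d J) (he : ContDiffOn ℝ ∞ e J) (hg : ContDiffOn ℝ ∞ g J)
    (hb' : ∀ t ∈ J, deriv b t = 6 * b t * (A t + B t))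
    (hu : ∀ r ∈ V, u r = A r.1 * r.2.1 ^ 3 + B r.1 * r.2.2 ^ 3 + a r.1 * r.2.1 ^ 2 +
      c r.1 * r.2.2 ^ 2 + b r.1 * r.2.1 * r.2.2 + d r.1 * r.2.1 + e r.1 * r.2.2 + g r.1) :
    LocallyKnown n I U u q := by
  have hqJ := hVJ q hq
  -- By the linear equation for `b`, a zero at `q.1` makes `b` vanish nearby. This separates the
  -- family `w(t, y)` from the family with nonvanishing `β`.
  obtain ⟨K, hKJ, hK, hK', hqK, hb0⟩ : ∃ K ⊆ J, IsOpen K ∧ K.OrdConnected ∧ q.1 ∈ K ∧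
      ((∀ t ∈ K, b t = 0) ∨ ∀ t ∈ K, b t ≠ 0) := by
    by_cases h0 : b q.1 = 0
    · have hAB : ContinuousAt (fun t => 6 * (A t + B t)) q.1 :=
        ((hA.continuousOn.add hB.continuousOn).continuousAt (hJ.mem_nhds hqJ)).const_mul 6
      obtain ⟨K, h1, h2, h3, h4, h5⟩ := exists_interval hJ hqJ (eventually_zero_of_linear hAB
        ((hJ.eventually_mem hqJ).mono fun t ht => (smooth_hasDerivAt hJ hb ht).congr_deriv
          (by rw [hb' t ht]; ring)) h0)
      exact ⟨K, h1, h2, h3, h4, Or.inl h5⟩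
    · obtain ⟨K, h1, h2, h3, h4, h5⟩ := exists_interval hJ hqJ
        ((hb.continuousOn.continuousAt (hJ.mem_nhds hqJ)).eventually_ne h0)
      exact ⟨K, h1, h2, h3, h4, Or.inr h5⟩
  replace hA := hA.mono hKJ
  replace hB := hB.mono hKJ
  replace ha := ha.mono hKJ
  replace hb := hb.mono hKJ
  replace hc := hc.mono hKJ
  replace hd := hd.mono hKJ
  replace he := he.mono hKJ
  replace hg := hg.mono hKJ
  -- The choice `χ_t = -6Aχ` cancels `x³`. Below, `X` cancels `x²`, the linear equation for `Y`
  -- cancels `y²` after the shift of `y`, and `W₁`, `W₂`, `W₀` cancel the terms of lower degree.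
  obtain ⟨L, hL, dL⟩ := exists_antideriv hK hK' (contDiffOn_const (c := -6).mul hA)
  obtain ⟨χ, hχ, hpos, dχ⟩ : ∃ χ : ℝ → ℝ, ContDiffOn ℝ ∞ χ K ∧ (∀ t ∈ K, 0 < χ t) ∧
      ∀ t ∈ K, HasDerivAt χ (-6 * A t * χ t) t :=
    ⟨fun t => Real.exp (L t), hL.exp, fun t _ => Real.exp_pos _, fun t ht =>
      (dL t ht).exp.congr_deriv (by ring)⟩
  have hχ0 : ∀ t ∈ K, χ t ≠ 0 := fun t ht => (hpos t ht).ne'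
  have hBA := hB.sub hA
  obtain ⟨X, hX, dX⟩ := exists_antideriv hK hK' ((contDiffOn_const (c := 2).mul ha).div hχ hχ0)
  obtain ⟨Y, hY, dY⟩ := exists_linear_ode hK hK' (contDiffOn_const (c := -6).mul hBA)
    ((contDiffOn_const (c := 2).mul hc).div hχ hχ0)
  have hW₁ : ContDiffOn ℝ ∞ (fun t => b t * χ t * Y t - d t) K := ((hb.mul hχ).mul hY).sub hd
  have hW₂ : ContDiffOn ℝ ∞
      (fun t => 3 * (B t - A t) * χ t ^ 2 * Y t ^ 2 + b t * χ t * X t - e t) K :=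
    ((((contDiffOn_const.mul hBA).mul (hχ.pow 2)).mul (hY.pow 2)).add ((hb.mul hχ).mul hX)).sub he
  have hW₀ : ContDiffOn ℝ ∞
      (fun t => (B t - A t) * χ t ^ 3 * Y t ^ 3 + b t * χ t ^ 2 * X t * Y t - g t) K :=
    (((hBA.mul (hχ.pow 3)).mul (hY.pow 3)).add (((hb.mul (hχ.pow 2)).mul hX).mul hY)).sub hg
  refine LocallyKnown.of_transf (V := V ∩ Prod.fst ⁻¹' K) (G := fun p =>
    (B p.1 - A p.1) * χ p.1 ^ 3 * p.2.2 ^ 3 + b p.1 * χ p.1 ^ 2 * p.2.1 * p.2.2) hK hK'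
    (hKJ.trans hJI) hχ hpos hX hY hW₀ hW₁ hW₂ (hV.inter (hK.preimage continuous_fst))
    (inter_subset_left.trans hVU) (fun r hr => hr.2) ⟨hq, hqK⟩ (fun r hr => ?_)
    fun T S hS hmaps hST hS' => ?_
  · have ht : r.1 ∈ K := hr.2
    have h0 := hχ0 _ ht
    simp only [hu r hr.1, (dχ _ ht).deriv, (dX _ ht).deriv, (dY _ ht).deriv, Pi.div_apply]
    field_simp
    ring
  have hk : ContDiffOn ℝ ∞ (fun s => (B (S s) - A (S s)) * χ (S s) ^ 3) (T '' K) :=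
    (hBA.comp hS hmaps).mul ((hχ.comp hS hmaps).pow 3)
  have hβ : ContDiffOn ℝ ∞ (fun s => b (S s) * χ (S s) ^ 2) (T '' K) :=
    (hb.comp hS hmaps).mul ((hχ.comp hS hmaps).pow 2)
  rcases hb0 with hb0 | hb0
  · refine Or.inl ⟨fun p => (B (S p.1) - A (S p.1)) * χ (S p.1) ^ 3 * p.2 ^ 3, ?_, ?_⟩
    · refine ContDiffOn.of_le (n := ∞) ?_ (by exact_mod_cast le_top)
      refine (hk.comp contDiffOn_fst ?_).mul (contDiffOn_snd.pow 3)
      rintro _ ⟨_, ⟨r, hr, rfl⟩, rfl⟩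
      exact ⟨r.1, hr.2, rfl⟩
    · rintro _ ⟨r, hr, rfl⟩
      simp [hST _ hr.2, hb0 _ hr.2]
  · refine Or.inr (Or.inl ⟨_, hβ, ?_, ?_⟩)
    · exact fun s hs => mul_ne_zero (hb0 _ (hmaps hs)) (pow_ne_zero 2 (hχ0 _ (hmaps hs)))
    · rintro _ ⟨r, hr, rfl⟩
      have ht : r.1 ∈ K := hr.2
      have h0 := hχ0 _ ht
      have h2 := hb0 _ ht
      -- For `β = bχ²` in the new time, the equation for `b` gives `β_t/(6β) = χ³(B - A)`, the
      -- coefficient of `y³`.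
      have hdβ : deriv (fun s => b (S s) * χ (S s) ^ 2) (T r.1) =
          6 * b r.1 * χ r.1 ^ 5 * (B r.1 - A r.1) := by
        have h3 := (smooth_hasDerivAt hK hb ht).mul ((dχ _ ht).pow 2)
        rw [← hST _ ht] at h3
        refine (h3.comp (T r.1) (hS' _ ht)).deriv.trans ?_
        simp only [hST _ ht, Pi.pow_apply, hb' _ (hKJ ht)]
        ring
      simp only [hdβ, hST _ ht]
      field_simp

/-- The two translations prescribe `u_x` and `u_y`, so `u` equals an explicit cubic polynomial in
`x`, `y` plus a function of `t`. The equation itself only contributes the equation for the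
coefficient of `xy`. -/
theorem TypeA.locallyKnown {𝔰 : Submodule ℝ (Space → Space)} {n : ℕ∞} {I J : Set ℝ} {U : Set Base}
    {u : Base → ℝ} {q : Base} {e v w : Coef} (hJ : IsOpen J) (hJI : J ⊆ I) (hqJ : q.1 ∈ J)
    (h : TypeA 𝔰 J e v w) (hn : 3 ≤ n) (hU : IsOpen U) (hu : ContDiffOn ℝ n u U)
    (hsol : IsSolution U u) (hinv : IsInvariant U 𝔰 u) (hq : q ∈ U) : LocallyKnown n I U u q := by
  obtain ⟨K, A, B, hK, -, hA, hA', hB, hB', hqm, hsub⟩ :=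
    exists_box (hU.inter (hJ.preimage continuous_fst)) (show q ∈ U ∩ Prod.fst ⁻¹' J from ⟨hq, hqJ⟩)
  have hKJ : K ⊆ J := fun t ht => (hsub (show (t, q.2.1, q.2.2) ∈ K ×ˢ A ×ˢ B from
    ⟨ht, hqm.2⟩)).2
  replace h := h.mono hKJ
  have hVU : K ×ˢ A ×ˢ B ⊆ U := fun r hr => (hsub hr).1
  have hV : IsOpen (K ×ˢ A ×ˢ B) := hK.prod (hA.prod hB)
  have hu3 : ContDiffOn ℝ (3 : ℕ∞) u U := hu.of_le (by exact_mod_cast hn)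
  have hd : ∀ r ∈ K ×ˢ A ×ˢ B, DifferentiableAt ℝ u r := fun r hr =>
    differentiableAt_of_contDiffOn hU hu3 (by norm_num) (hVU hr)
  have hχ := h.sv.χ
  have hρ := h.sw.ρ
  have hχ' := smooth_deriv hK hχ
  have hρ' := smooth_deriv hK hρ
  have hχ0 : ∀ t ∈ K, v.χ t ≠ 0 := fun t ht => (h.vχ t ht).ne'
  have hρ0 := h.wρ
  have ux : ∀ r ∈ K ×ˢ A ×ˢ B, dx u r = (-(1 / 2) * deriv v.χ r.1 * r.2.1 ^ 2 + v.α r.1 * r.2.1 +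
      v.β r.1 * r.2.2 + v.σ r.1) / v.χ r.1 := fun r hr => by
    have h0 := hχ0 r.1 hr.1
    have h1 := h.hv.isInvariant hinv (hVU hr) hr.1
    rw [graphPt, h.fld_v hK hr.1] at h1
    rw [eq_div_iff h0]
    linear_combination -h1
  have uy : ∀ r ∈ K ×ˢ A ×ˢ B, dy u r = (-(1 / 2) * deriv w.ρ r.1 * r.2.2 ^ 2 + w.α r.1 * r.2.1 +
      w.β r.1 * r.2.2 + w.σ r.1) / w.ρ r.1 := fun r hr => by
    have h0 := hρ0 r.1 hr.1
    have h1 := h.hw.isInvariant hinv (hVU hr) hr.1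
    rw [graphPt, h.fld_w hK hr.1] at h1
    rw [eq_div_iff h0]
    linear_combination -h1
  set p : Base → ℝ := fun r => -(deriv v.χ r.1 / (6 * v.χ r.1)) * r.2.1 ^ 3 +
    -(deriv w.ρ r.1 / (6 * w.ρ r.1)) * r.2.2 ^ 3 + v.α r.1 / (2 * v.χ r.1) * r.2.1 ^ 2 +
    w.β r.1 / (2 * w.ρ r.1) * r.2.2 ^ 2 + v.β r.1 / v.χ r.1 * r.2.1 * r.2.2 +
    v.σ r.1 / v.χ r.1 * r.2.1 + w.σ r.1 / w.ρ r.1 * r.2.2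
  have key : ∀ r ∈ K ×ˢ A ×ˢ B, u r - p r = u (r.1, q.2) - p (r.1, q.2) := fun r hr => by
    refine eq_of_partial_eq_zero (f := fun r => u r - p r) (K := K) hA' hB' (fun r hr => ?_)
      (fun r hr => ?_) hr hqm.2.1 hqm.2.2
    · have h0 := hχ0 r.1 hr.1
      refine (((hasDerivAt_dx (hd r hr)).sub (hasDerivAt_cubic (-(deriv v.χ r.1 / (6 * v.χ r.1)))
        (v.α r.1 / (2 * v.χ r.1)) (v.β r.1 / v.χ r.1 * r.2.2 + v.σ r.1 / v.χ r.1)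
        (-(deriv w.ρ r.1 / (6 * w.ρ r.1)) * r.2.2 ^ 3 + w.β r.1 / (2 * w.ρ r.1) * r.2.2 ^ 2 +
        w.σ r.1 / w.ρ r.1 * r.2.2) r.2.1)).congr_deriv ?_).congr_of_eventuallyEq
        (Eventually.of_forall fun s => ?_)
      · rw [ux r hr]
        field_simp
        ring
      · simp only [p, Pi.sub_apply]
        ring
    · have h0 := hχ0 r.1 hr.1
      have h1 := hρ0 r.1 hr.1
      have h2 : w.α r.1 = w.ρ r.1 * v.β r.1 / v.χ r.1 := by
        rw [eq_div_iff h0]; linarith [h.rel r.1 hr.1]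
      refine (((hasDerivAt_dy (hd r hr)).sub (hasDerivAt_cubic (-(deriv w.ρ r.1 / (6 * w.ρ r.1)))
        (w.β r.1 / (2 * w.ρ r.1)) (v.β r.1 / v.χ r.1 * r.2.1 + w.σ r.1 / w.ρ r.1)
        (-(deriv v.χ r.1 / (6 * v.χ r.1)) * r.2.1 ^ 3 + v.α r.1 / (2 * v.χ r.1) * r.2.1 ^ 2 +
        v.σ r.1 / v.χ r.1 * r.2.1) r.2.2)).congr_deriv ?_).congr_of_eventuallyEq
        (Eventually.of_forall fun s => ?_)
      · rw [uy r hr, h2]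
        field_simp
        ring
      · simp only [p, Pi.sub_apply]
        ring
  have c6χ : ContDiffOn ℝ ∞ (fun t => -(deriv v.χ t / (6 * v.χ t))) K :=
    (hχ'.div (contDiffOn_const.mul hχ) fun t ht => mul_ne_zero (by norm_num) (hχ0 t ht)).neg
  have c6ρ : ContDiffOn ℝ ∞ (fun t => -(deriv w.ρ t / (6 * w.ρ t))) K :=
    (hρ'.div (contDiffOn_const.mul hρ) fun t ht => mul_ne_zero (by norm_num) (hρ0 t ht)).neg
  have c2χ : ContDiffOn ℝ ∞ (fun t => v.α t / (2 * v.χ t)) K :=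
    h.sv.α.div (contDiffOn_const.mul hχ) fun t ht => mul_ne_zero (by norm_num) (hχ0 t ht)
  have c2ρ : ContDiffOn ℝ ∞ (fun t => w.β t / (2 * w.ρ t)) K :=
    h.sw.β.div (contDiffOn_const.mul hρ) fun t ht => mul_ne_zero (by norm_num) (hρ0 t ht)
  have cb : ContDiffOn ℝ ∞ (fun t => v.β t / v.χ t) K := h.sv.β.div hχ hχ0
  have cd : ContDiffOn ℝ ∞ (fun t => v.σ t / v.χ t) K := h.sv.σ.div hχ hχ0
  have ce : ContDiffOn ℝ ∞ (fun t => w.σ t / w.ρ t) K := h.sw.σ.div hρ hρ0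
  have cp : ContDiffOn ℝ ∞ (fun t => p (t, q.2)) K := by
    simp only [p]
    exact ((((((c6χ.mul contDiffOn_const).add (c6ρ.mul contDiffOn_const)).add
      (c2χ.mul contDiffOn_const)).add (c2ρ.mul contDiffOn_const)).add
      ((cb.mul contDiffOn_const).mul contDiffOn_const)).add (cd.mul contDiffOn_const)).add
      (ce.mul contDiffOn_const)
  -- The added function of `t` is a priori only of class `C^n`, but the coefficients of a
  -- transformation must be smooth. Invariance under the third field, with `τ ≠ 0`, is a linear
  -- equation in `t` with smooth coefficients.
  have cu : ContDiffOn ℝ ∞ (fun t => u (t, q.2)) K := by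
    have hτ' := smooth_deriv hK h.se.τ
    have cux : ContDiffOn ℝ ∞ (fun t => dx u (t, q.2)) K :=
      (((((contDiffOn_const (c := -(1 / 2))).mul hχ').mul (contDiffOn_const (c := q.2.1 ^ 2))).add
        (h.sv.α.mul (contDiffOn_const (c := q.2.1)))).add
        (h.sv.β.mul (contDiffOn_const (c := q.2.2))) |>.add h.sv.σ).div hχ hχ0 |>.congr
        fun t ht => ux (t, q.2) ⟨ht, hqm.2⟩
    have cuy : ContDiffOn ℝ ∞ (fun t => dy u (t, q.2)) K :=
      (((((contDiffOn_const (c := -(1 / 2))).mul hρ').mul (contDiffOn_const (c := q.2.2 ^ 2))).add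
        (h.sw.α.mul (contDiffOn_const (c := q.2.1)))).add
        (h.sw.β.mul (contDiffOn_const (c := q.2.2))) |>.add h.sw.σ).div hρ hρ0 |>.congr
        fun t ht => uy (t, q.2) ⟨ht, hqm.2⟩
    have cfld : ContDiffOn ℝ ∞ (fun t => e.fld (t, q.2.1, q.2.2, 0)) K := by
      refine (Coef.contDiffOn_fld hK h.se).comp (t := strip K) (by fun_prop) fun t ht => ht
    refine smooth_of_linear_ode hK ((contDiffOn_const (c := 3 * e.l)).div h.se.τ h.eτ)
      (g := fun t => ((e.fld (t, q.2.1, q.2.2, 0)).2.2.2 - (e.fld (t, q.2.1, q.2.2, 0)).2.1 *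
        dx u (t, q.2) - (e.fld (t, q.2.1, q.2.2, 0)).2.2.1 * dy u (t, q.2)) / e.τ t)
      (((cfld.snd.snd.snd.sub (cfld.snd.fst.mul cux)).sub (cfld.snd.snd.fst.mul cuy)).div
        h.se.τ h.eτ) fun t ht => ?_
    have hr : (t, q.2) ∈ K ×ˢ A ×ˢ B := ⟨ht, hqm.2⟩
    have h0 := h.eτ t ht
    have h1 := h.he.isInvariant hinv (hVU hr) ht
    refine (hasDerivAt_dt (hd (t, q.2) hr)).congr_deriv ?_
    simp only [graphPt, Coef.fld, Pi.div_apply] at h1 ⊢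
    field_simp
    linear_combination -108 * h1
  have cg := cu.sub cp
  have hform : ∀ r ∈ K ×ˢ A ×ˢ B, u r = p r + (u (r.1, q.2) - p (r.1, q.2)) := fun r hr => by
    rw [← key r hr]; ring
  have D {f : ℝ → ℝ} (hf : ContDiffOn ℝ ∞ f K) {t : ℝ} (ht : t ∈ K) : DifferentiableAt ℝ f t :=
    (smooth_hasDerivAt hK hf ht).differentiableAt
  refine LocallyKnown.of_polynomial hK (hKJ.trans hJI) hV hVU (fun r hr => hr.1) hqm c6χ c6ρ c2χ cb
    c2ρ cd ce cg (fun t ht => ?_) fun r hr => hform r hr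
  have h1 := IsSolution.cubic (fun r hr => hsol r (hVU hr)) hV (hu3.mono hVU)
    (P := ⟨_, 0, 0, _, _, _, _, _, _, _⟩)
    (fun r hr => ⟨D c6χ hr.1, differentiableAt_const 0, differentiableAt_const 0, D c6ρ hr.1,
      D c2χ hr.1, D cb hr.1, D c2ρ hr.1, D cd hr.1, D ce hr.1, D cg hr.1⟩)
    (fun r hr => by rw [hform r hr]; simp only [Cubic.eval, p, Pi.zero_apply]; ring)
    (show (t, q.2.1, q.2.2) ∈ K ×ˢ A ×ˢ B from ⟨ht, hqm.2⟩)
  simp only [Pi.zero_apply, show deriv (0 : ℝ → ℝ) t = 0 from deriv_const t 0] at h1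
  linear_combination h1

end DN

/-! ### Cubes of one linear form and invariant solutions of type B -/

namespace DN

open Set Filter Topology

/-- Equivalence of solutions that are, up to equivalence, of the form `ϑ (y - ν x)³`. -/
theorem LocallyKnown.of_cube {n : ℕ∞} {I K A B : Set ℝ} {U : Set Base} {u : Base → ℝ} {q : Base}
    {χ X Y W₀ W₁ W₂ θ : ℝ → ℝ} {ν : ℝ} (hK : IsOpen K) (hKI : K ⊆ I)
    (hA : IsOpen A) (hB : IsOpen B)
    (hχ : ContDiffOn ℝ ∞ χ K) (hpos : ∀ t ∈ K, 0 < χ t) (hX : ContDiffOn ℝ ∞ X K)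
    (hY : ContDiffOn ℝ ∞ Y K) (hW₀ : ContDiffOn ℝ ∞ W₀ K) (hW₁ : ContDiffOn ℝ ∞ W₁ K)
    (hW₂ : ContDiffOn ℝ ∞ W₂ K) (hVU : K ×ˢ A ×ˢ B ⊆ U) (hq : q ∈ K ×ˢ A ×ˢ B) (hn : 3 ≤ n)
    (hu : ContDiffOn ℝ n u (K ×ˢ A ×ˢ B)) (hsol : IsSolution (K ×ˢ A ×ˢ B) u)
    (hθ : ContDiffOn ℝ n θ K) (hform : ∀ r ∈ K ×ˢ A ×ˢ B,
      u r + deriv χ r.1 / (6 * χ r.1) * (r.2.1 ^ 3 + r.2.2 ^ 3) -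
      1 / 2 * (χ r.1 * deriv X r.1 * r.2.1 ^ 2 + χ r.1 * deriv Y r.1 * r.2.2 ^ 2) +
      W₁ r.1 * r.2.1 + W₂ r.1 * r.2.2 + W₀ r.1 =
        θ r.1 * (r.2.2 - ν * r.2.1 + χ r.1 * (Y r.1 - ν * X r.1)) ^ 3) : LocallyKnown n I U u q := by
  have hV : IsOpen (K ×ˢ A ×ˢ B) := hK.prod (hA.prod hB)
  have hu3 : ContDiffOn ℝ (3 : ℕ∞) u (K ×ˢ A ×ˢ B) := hu.of_le (by exact_mod_cast hn)
  have hn1 : (1 : WithTop ℕ∞) ≤ n := by exact_mod_cast (le_trans (by norm_num) hn : 1 ≤ n)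
  have hχ0 : ∀ t ∈ K, χ t ≠ 0 := fun t ht => (hpos t ht).ne'
  have D {f : ℝ → ℝ} (hf : ContDiffOn ℝ ∞ f K) {t : ℝ} (ht : t ∈ K) : HasDerivAt f (deriv f t) t :=
    smooth_hasDerivAt hK hf ht
  have D' {f : ℝ → ℝ} (hf : ContDiffOn ℝ n f K) {t : ℝ} (ht : t ∈ K) : DifferentiableAt ℝ f t :=
    (hf.contDiffAt (hK.mem_nhds ht)).differentiableAt (lt_of_lt_of_le one_pos hn1).ne'
  have L {f : ℝ → ℝ} (hf : ContDiffOn ℝ ∞ f K) : ContDiffOn ℝ n f K :=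
    hf.of_le (by exact_mod_cast le_top)
  -- the differential equation for `θ`
  have hode : ν ≠ 0 → ∀ t ∈ K,
      deriv θ t = 12 * (1 - ν ^ 3) * θ t ^ 2 - 3 * (deriv χ t / χ t) * θ t := fun hν t ht => by
    have hκ : ContDiffOn ℝ n (fun t => deriv χ t / (6 * χ t)) K :=
      L ((smooth_deriv hK hχ).div (contDiffOn_const.mul hχ) fun t ht =>
        mul_ne_zero (by norm_num) (hχ0 t ht))
    have hm : ContDiffOn ℝ n (fun t => χ t * (Y t - ν * X t)) K :=
      L (hχ.mul (hY.sub (contDiffOn_const.mul hX)))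
    have hXX : ContDiffOn ℝ n (fun t => 1 / 2 * (χ t * deriv X t)) K :=
      L (contDiffOn_const.mul (hχ.mul (smooth_deriv hK hX)))
    have hYY : ContDiffOn ℝ n (fun t => 1 / 2 * (χ t * deriv Y t)) K :=
      L (contDiffOn_const.mul (hχ.mul (smooth_deriv hK hY)))
    have c {f : ℝ → ℝ} (k : ℝ) (hf : ContDiffOn ℝ n f K) : ContDiffOn ℝ n (fun t => k * f t) K :=
      contDiffOn_const.mul hf
    have key : ∀ y ∈ B, _ := fun y hy => hsol.cubic hV hu3
      (P := ⟨fun t => -ν ^ 3 * θ t - deriv χ t / (6 * χ t), fun t => 3 * ν ^ 2 * θ t,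
        fun t => -3 * ν * θ t, fun t => θ t - deriv χ t / (6 * χ t),
        fun t => 3 * ν ^ 2 * (θ t * (χ t * (Y t - ν * X t))) + 1 / 2 * (χ t * deriv X t),
        fun t => -6 * ν * (θ t * (χ t * (Y t - ν * X t))),
        fun t => 3 * (θ t * (χ t * (Y t - ν * X t))) + 1 / 2 * (χ t * deriv Y t),
        fun t => -3 * ν * (θ t * (χ t * (Y t - ν * X t)) ^ 2) - W₁ t,
        fun t => 3 * (θ t * (χ t * (Y t - ν * X t)) ^ 2) - W₂ t,
        fun t => θ t * (χ t * (Y t - ν * X t)) ^ 3 - W₀ t⟩)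
      (fun r hr => ⟨D' ((c _ hθ).sub hκ) hr.1, D' (c _ hθ) hr.1, D' (c _ hθ) hr.1,
        D' (hθ.sub hκ) hr.1, D' ((c _ (hθ.mul hm)).add hXX) hr.1, D' (c _ (hθ.mul hm)) hr.1,
        D' ((c _ (hθ.mul hm)).add hYY) hr.1, D' ((c _ (hθ.mul (hm.pow 2))).sub (L hW₁)) hr.1,
        D' ((c _ (hθ.mul (hm.pow 2))).sub (L hW₂)) hr.1, D' ((hθ.mul (hm.pow 3)).sub (L hW₀)) hr.1⟩)
      (fun r hr => by simp only [Cubic.eval]; linear_combination hform r hr)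
      (show (t, q.2.1, y) ∈ K ×ˢ A ×ˢ B from ⟨ht, hq.2.1, hy⟩)
    -- The identity from `IsSolution.cubic` is affine in `y`; subtracting it at two points isolates
    -- the coefficient of `y`, which contains `deriv θ`.
    obtain ⟨y, hy, hy'⟩ : ∃ y ∈ B, y ≠ q.2.2 := by
      obtain ⟨y, hy⟩ := (nhdsWithin_neBot (s := {q.2.2}ᶜ) (x := q.2.2)).1 inferInstance
        (hB.mem_nhds hq.2.2)
      exact ⟨y, hy⟩
    have k1 := key y hy
    have k2 := key q.2.2 hq.2.2
    have d1 : deriv (fun t => -3 * ν * θ t) t = -3 * ν * deriv θ t := deriv_const_mul_field _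
    simp only [d1] at k1 k2
    have h0 := hχ0 t ht
    have k3 : ν * (y - q.2.2) * (deriv θ t - (12 * (1 - ν ^ 3) * θ t ^ 2 -
        3 * (deriv χ t / χ t) * θ t)) = 0 := by
      field_simp at k1 k2 ⊢
      linear_combination -(1 / 6) * (k1 - k2)
    exact sub_eq_zero.1 ((mul_eq_zero.1 k3).resolve_left (mul_ne_zero hν (sub_ne_zero.2 hy')))
  have hϑ : ContDiffOn ℝ n (fun t => θ t * χ t ^ 3) K := hθ.mul (L (hχ.pow 3))
  -- The function `ϑ = θχ³` is the coefficient of the cube in the new variables. Its equation is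
  -- linear once `θ` is regarded as known, and in the new time it reads `ϑ_t = 12(1 - ν³)ϑ²`.
  have dϑ : ν ≠ 0 → ∀ t ∈ K,
      HasDerivAt (fun t => θ t * χ t ^ 3) (12 * (1 - ν ^ 3) * θ t * (θ t * χ t ^ 3)) t :=
    fun hν t ht => by
      have h0 := hχ0 t ht
      refine ((D' hθ ht).hasDerivAt.mul ((D hχ ht).pow 3)).congr_deriv ?_
      rw [hode hν t ht, Pi.pow_apply]
      field_simp
      ring
  have fin {J : Set ℝ} (hJ : IsOpen J) (hJ' : J.OrdConnected) (hJK : J ⊆ K) (hqJ : q.1 ∈ J)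
      (hkn : ∀ T S : ℝ → ℝ, ContDiffOn ℝ ∞ S (T '' J) → MapsTo S (T '' J) J →
        (∀ t ∈ J, S (T t) = t) → (∀ t ∈ J, HasDerivAt S (χ t ^ 3) (T t)) →
        ∀ W : Set Base, (∀ p ∈ W, p.1 ∈ T '' J) → IsKnownSolution n (T '' J) W
          (fun p => θ (S p.1) * χ (S p.1) ^ 3 * (p.2.2 - ν * p.2.1) ^ 3)) :
      LocallyKnown n I U u q := by
    have hs : J ×ˢ A ×ˢ B ⊆ K ×ˢ A ×ˢ B := prod_mono_left hJK
    refine LocallyKnown.of_transf (V := J ×ˢ A ×ˢ B) (G := fun p =>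
      θ p.1 * χ p.1 ^ 3 * (p.2.2 - ν * p.2.1) ^ 3) hJ hJ' (hJK.trans hKI) (hχ.mono hJK)
      (fun t ht => hpos t (hJK ht)) (hX.mono hJK) (hY.mono hJK) (hW₀.mono hJK) (hW₁.mono hJK)
      (hW₂.mono hJK) (hJ.prod (hA.prod hB)) (hs.trans hVU) (fun r hr => hr.1) ⟨hqJ, hq.2⟩
      (fun r hr => ?_) fun T S hS hmaps hST hS' => hkn T S hS hmaps hST hS' _ ?_
    · rw [hform r (hs hr)]
      have h0 := hχ0 r.1 (hs hr).1
      field_simp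
      ring
    · rintro _ ⟨r, hr, rfl⟩
      exact ⟨r.1, hr.1, rfl⟩
  obtain ⟨K₁, hK₁K, hK₁, hK₁', hqK₁, -⟩ := exists_interval hK hq.1 (P := fun _ => True) (by simp)
  by_cases hν0 : ν = 0
  · refine fin hK₁ hK₁' hK₁K hqK₁ fun T S hS hmaps hST hS' W hW =>
      Or.inl ⟨fun p => θ (S p.1) * χ (S p.1) ^ 3 * p.2 ^ 3, ?_, fun p hp => by simp [hν0]⟩
    have hk : ContDiffOn ℝ n (fun s => θ (S s) * χ (S s) ^ 3) (T '' K₁) :=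
      (hϑ.mono hK₁K).comp (hS.of_le (by exact_mod_cast le_top)) hmaps
    refine (hk.comp contDiffOn_fst ?_).mul (contDiffOn_snd.pow 3)
    rintro _ ⟨p, hp, rfl⟩
    exact hW p hp
  by_cases hν1 : ν = 1
  · refine fin hK₁ hK₁' hK₁K hqK₁ fun T S hS hmaps hST hS' W hW =>
      Or.inr (Or.inr (Or.inl ⟨fun s => θ q.1 * χ q.1 ^ 3 * s ^ 3, ?_, fun p hp => ?_⟩))
    · exact contDiffOn_const.mul (contDiffOn_id.pow 3)
    · have := eq_of_hasDerivAt_zero hK₁' (fun t ht => (dϑ hν0 t (hK₁K ht)).congr_deriv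
        (by rw [hν1]; ring)) (hmaps (hW p hp)) hqK₁
      simp only [this, hν1, one_mul]
  by_cases hz : θ q.1 * χ q.1 ^ 3 = 0
  · have hc : ContinuousAt (fun t => 12 * (1 - ν ^ 3) * θ t) q.1 :=
      (hθ.continuousOn.continuousAt (hK.mem_nhds hq.1)).const_mul _
    obtain ⟨J, hJK, hJ, hJ', hqJ, h0⟩ := exists_interval hK hq.1 (eventually_zero_of_linear hc
      ((hK.eventually_mem hq.1).mono (dϑ hν0)) hz)
    refine fin hJ hJ' hJK hqJ fun T S hS hmaps hST hS' W hW =>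
      Or.inl ⟨fun _ => 0, contDiffOn_const, fun p hp => ?_⟩
    simp only [h0 _ (hmaps (hW p hp)), zero_mul]
  · obtain ⟨J, hJK, hJ, hJ', hqJ, h0⟩ := exists_interval hK hq.1
      ((hϑ.continuousOn.continuousAt (hK.mem_nhds hq.1)).eventually_ne hz)
    -- For nonvanishing `ϑ` the equation becomes `(1/ϑ)_t = 12(ν³ - 1)`, so `H = 1/(12ν³ϑ)` is the
    -- required antiderivative. With constant `ρ = ν` the term with `ρ_t` disappears.
    refine fin hJ hJ' hJK hqJ fun T S hS hmaps hST hS' W hW =>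
      Or.inr (Or.inr (Or.inr ⟨fun _ => ν, fun s => (12 * ν ^ 3 * (θ (S s) * χ (S s) ^ 3))⁻¹,
        contDiffOn_const, fun _ _ => ⟨hν0, hν1⟩, ?_, fun p hp => ?_⟩))
    · rintro _ ⟨t, ht, rfl⟩
      have h1 := h0 t ht
      have h2 : θ t ≠ 0 := left_ne_zero_of_mul h1
      have h3 := hχ0 t (hJK ht)
      have h4 := dϑ hν0 t (hJK ht)
      rw [← hST t ht] at h4
      have h5 := h4.comp (T t) (hS' t ht)
      rw [hST t ht] at h5
      refine ⟨((h5.const_mul (12 * ν ^ 3)).inv ?_).congr_deriv ?_, ?_⟩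
      · simp only [Function.comp_apply, hST t ht]
        positivity
      · simp only [Function.comp_apply, hST t ht]
        field_simp
        ring
      · simp only [hST t ht]
        positivity
    · have h1 := h0 _ (hmaps (hW p hp))
      have h2 : θ (S p.1) ≠ 0 := left_ne_zero_of_mul h1
      have h3 : χ (S p.1) ≠ 0 := hχ0 _ (hJK (hmaps (hW p hp)))
      simp only [inv_inv, deriv_const]
      field_simp
      simp

/-- For the transformed function `g`, invariance reads `g_x + νg_y = 0` and `(x + χ_V)g_x + (y +
ρ_V)g_y = 3g`. The determinant of this system is `η`, nonzero at `q` because the rank is three, and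
solving it makes `g/η³` a function of `t` only. -/
theorem TypeB.locallyKnown_of_ne_zero {𝔰 : Submodule ℝ (Space → Space)} {n : ℕ∞} {I J : Set ℝ}
    {U : Set Base} {u : Base → ℝ} {q : Base} {v w : Coef} (hJ : IsOpen J) (hJI : J ⊆ I)
    (hqJ : q.1 ∈ J) (h : TypeB 𝔰 J v w)
    (hdet : (q.2.1 + v.χ q.1) * w.ρ q.1 - w.χ q.1 * (q.2.2 + v.ρ q.1) ≠ 0) (hχ : w.χ q.1 ≠ 0)
    (hn : 3 ≤ n) (hU : IsOpen U) (hu : ContDiffOn ℝ n u U)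
    (hsol : IsSolution U u) (hinv : IsInvariant U 𝔰 u) (hq : q ∈ U) : LocallyKnown n I U u q := by
  obtain ⟨K, hKJ, hK, hK', htK, k, ν, hk, hT, hpos⟩ := h.normalize hJ hqJ hχ
  have hν : w.ρ q.1 = ν * w.χ q.1 := by
    have := (hpos q.1 htK).2
    simp only [Coef.scale] at this
    exact mul_left_cancel₀ hk (by linear_combination this)
  set c := w.scale k
  obtain ⟨X, Y, W₀, W₁, W₂, hX, hY, hW₀, hW₁, hW₂, eX, eY, dX, dY, e₁, e₂, e₀, dρ, eα, eβ, eσ⟩ :=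
    hT.exists_parameters hK (fun t ht => (hpos t ht).1) fun t ht => (hpos t ht).2
  have hn1 : 1 ≤ n := le_trans (by norm_num) hn
  -- a box without zeros of `η`
  set η : Base → ℝ := fun r => r.2.2 + v.ρ r.1 - ν * (r.2.1 + v.χ r.1)
  have hηq : η q ≠ 0 := fun h0 => hdet (by
    rw [hν]
    linear_combination -w.χ q.1 * h0)
  have hm : ContDiffOn ℝ ∞ (fun t => v.ρ t - ν * v.χ t) K :=
    hT.sv.ρ.sub (contDiffOn_const.mul hT.sv.χ)
  have hUK : IsOpen (U ∩ Prod.fst ⁻¹' K) := hU.inter (hK.preimage continuous_fst)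
  have hηc : ContinuousOn η (U ∩ Prod.fst ⁻¹' K) := by
    have h1 : ContinuousOn (fun r : Base => v.ρ r.1) (U ∩ Prod.fst ⁻¹' K) :=
      hT.sv.ρ.continuousOn.comp continuousOn_fst fun r hr => hr.2
    have h2 : ContinuousOn (fun r : Base => v.χ r.1) (U ∩ Prod.fst ⁻¹' K) :=
      hT.sv.χ.continuousOn.comp continuousOn_fst fun r hr => hr.2
    fun_prop
  obtain ⟨K₁, A, B, hK₁, -, hA, hA', hB, hB', hqm, hsub⟩ :=
    exists_box (hηc.isOpen_inter_preimage hUK isOpen_ne) ⟨⟨hq, htK⟩, hηq⟩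
  have hK₁K : K₁ ⊆ K := fun t ht => (hsub (show (t, q.2.1, q.2.2) ∈ K₁ ×ˢ A ×ˢ B from
    ⟨ht, hqm.2⟩)).1.2
  have hVU : K₁ ×ˢ A ×ˢ B ⊆ U := fun r hr => (hsub hr).1.1
  have hη : ∀ r ∈ K₁ ×ˢ A ×ˢ B, η r ≠ 0 := fun r hr => (hsub hr).2
  have hχ0 : ∀ t ∈ K, c.χ t ≠ 0 := fun t ht => (hpos t ht).1.ne'
  have hd : ∀ r ∈ K₁ ×ˢ A ×ˢ B, DifferentiableAt ℝ u r := fun r hr =>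
    differentiableAt_of_contDiffOn hU hu hn1 (hVU hr)
  set g : Base → ℝ := fun r => u r + deriv c.χ r.1 / (6 * c.χ r.1) * (r.2.1 ^ 3 + r.2.2 ^ 3) -
    1 / 2 * (c.χ r.1 * deriv X r.1 * r.2.1 ^ 2 + c.χ r.1 * deriv Y r.1 * r.2.2 ^ 2) +
    W₁ r.1 * r.2.1 + W₂ r.1 * r.2.2 + W₀ r.1
  have hgη : ∀ r ∈ K₁ ×ˢ A ×ˢ B, ∃ gx gy : ℝ,
      HasDerivAt (fun s => g (r.1, s, r.2.2)) gx r.2.1 ∧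
      HasDerivAt (fun s => g (r.1, r.2.1, s)) gy r.2.2 ∧
      gx * η r = -3 * ν * g r ∧ gy * η r = 3 * g r := fun r hr => by
    have ht := hK₁K hr.1
    have h0 := hχ0 r.1 ht
    have i1 := hT.hv.isInvariant hinv (hVU hr) ht
    have i2 := hT.hw.isInvariant hinv (hVU hr) ht
    rw [graphPt, hT.fld_v hK ht] at i1
    rw [graphPt, hT.fld_w hK ht] at i2
    simp only at i1 i2
    have i3 := eσ r.1 ht
    refine ⟨dx u r + 3 * (deriv c.χ r.1 / (6 * c.χ r.1)) * r.2.1 ^ 2 +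
      2 * -(1 / 2 * (c.χ r.1 * deriv X r.1)) * r.2.1 + W₁ r.1,
      dy u r + 3 * (deriv c.χ r.1 / (6 * c.χ r.1)) * r.2.2 ^ 2 +
      2 * -(1 / 2 * (c.χ r.1 * deriv Y r.1)) * r.2.2 + W₂ r.1, ?_, ?_, ?_⟩
    · refine (((hasDerivAt_dx (hd r hr)).add (hasDerivAt_cubic (deriv c.χ r.1 / (6 * c.χ r.1))
        (-(1 / 2 * (c.χ r.1 * deriv X r.1))) (W₁ r.1) (deriv c.χ r.1 / (6 * c.χ r.1) * r.2.2 ^ 3 -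
        1 / 2 * (c.χ r.1 * deriv Y r.1 * r.2.2 ^ 2) + W₂ r.1 * r.2.2 + W₀ r.1)
        r.2.1)).congr_deriv ?_).congr_of_eventuallyEq (Eventually.of_forall fun s => ?_)
      · ring
      · simp only [g, Pi.add_apply]; ring
    · refine (((hasDerivAt_dy (hd r hr)).add (hasDerivAt_cubic (deriv c.χ r.1 / (6 * c.χ r.1))
        (-(1 / 2 * (c.χ r.1 * deriv Y r.1))) (W₂ r.1) (deriv c.χ r.1 / (6 * c.χ r.1) * r.2.1 ^ 3 -
        1 / 2 * (c.χ r.1 * deriv X r.1 * r.2.1 ^ 2) + W₁ r.1 * r.2.1 + W₀ r.1)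
        r.2.2)).congr_deriv ?_).congr_of_eventuallyEq (Eventually.of_forall fun s => ?_)
      · ring
      · simp only [g, Pi.add_apply]; ring
    generalize dx u r = ux at *
    generalize dy u r = uy at *
    -- `j1` expresses invariance under the translation `W`, `j2` invariance under the scaling `V`,
    -- in terms of `g`. The two claims are Cramer's rule.
    have j1 : ux + 3 * (deriv c.χ r.1 / (6 * c.χ r.1)) * r.2.1 ^ 2 +
        2 * -(1 / 2 * (c.χ r.1 * deriv X r.1)) * r.2.1 + W₁ r.1 +
        ν * (uy + 3 * (deriv c.χ r.1 / (6 * c.χ r.1)) * r.2.2 ^ 2 +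
        2 * -(1 / 2 * (c.χ r.1 * deriv Y r.1)) * r.2.2 + W₂ r.1) = 0 := by
      rw [(hpos _ ht).2, dρ _ ht, eα _ ht, eβ _ ht] at i2
      rw [dX _ ht, dY _ ht]
      field_simp
      linear_combination 6 * i3 - 6 * i2
    have j2 : (r.2.1 + v.χ r.1) * (ux + 3 * (deriv c.χ r.1 / (6 * c.χ r.1)) * r.2.1 ^ 2 +
        2 * -(1 / 2 * (c.χ r.1 * deriv X r.1)) * r.2.1 + W₁ r.1) +
        (r.2.2 + v.ρ r.1) * (uy + 3 * (deriv c.χ r.1 / (6 * c.χ r.1)) * r.2.2 ^ 2 +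
        2 * -(1 / 2 * (c.χ r.1 * deriv Y r.1)) * r.2.2 + W₂ r.1) = 3 * g r := by
      simp only [g]
      rw [e₀ _ ht, e₁ _ ht, e₂ _ ht, dX _ ht, dY _ ht]
      field_simp
      linear_combination -12 * c.χ r.1 * i1
    simp only [η]
    constructor
    · linear_combination (r.2.2 + v.ρ r.1) * j1 - ν * j2
    · linear_combination j2 - (r.2.1 + v.χ r.1) * j1
  have hy (r : Base) : HasDerivAt (fun s => η (r.1, r.2.1, s)) 1 r.2.2 :=
    ((hasDerivAt_id r.2.2).add_const (v.ρ r.1)).sub_const (ν * (r.2.1 + v.χ r.1))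
  have hx (r : Base) : HasDerivAt (fun s => η (r.1, s, r.2.2)) (-ν) r.2.1 := by
    refine ((((hasDerivAt_id r.2.1).add_const (v.χ r.1)).const_mul ν).const_sub
      (r.2.2 + v.ρ r.1)).congr_deriv ?_
    ring
  have key : ∀ r ∈ K₁ ×ˢ A ×ˢ B, g r / η r ^ 3 = g (r.1, q.2) / η (r.1, q.2) ^ 3 := fun r hr => by
    refine eq_of_partial_eq_zero (f := fun r => g r / η r ^ 3) (K := K₁) hA' hB' (fun r hr => ?_)
      (fun r hr => ?_) hr hqm.2.1 hqm.2.2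
    all_goals
      obtain ⟨gx, gy, h1, h2, h3, h4⟩ := hgη r hr
      have h0 := hη r hr
    · refine (h1.div ((hx r).pow 3) (pow_ne_zero 3 h0)).congr_deriv (div_eq_zero_iff.2 (Or.inl ?_))
      simp only [Pi.pow_apply]
      linear_combination η r ^ 2 * h3
    · refine (h2.div ((hy r).pow 3) (pow_ne_zero 3 h0)).congr_deriv (div_eq_zero_iff.2 (Or.inl ?_))
      simp only [Pi.pow_apply]
      linear_combination η r ^ 2 * h4
  have L {f : ℝ → ℝ} (hf : ContDiffOn ℝ ∞ f K) : ContDiffOn ℝ n f K₁ :=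
    (hf.mono hK₁K).of_le (by exact_mod_cast le_top)
  have hθ : ContDiffOn ℝ n (fun t => g (t, q.2) / η (t, q.2) ^ 3) K₁ := by
    have c1 : ContDiffOn ℝ n (fun t => u (t, q.2)) K₁ :=
      hu.comp (contDiffOn_id.prodMk contDiffOn_const) fun t ht =>
        hVU (show (t, q.2) ∈ K₁ ×ˢ A ×ˢ B from ⟨ht, hqm.2⟩)
    have c2 : ContDiffOn ℝ n (fun t => deriv c.χ t / (6 * c.χ t)) K₁ :=
      L ((smooth_deriv hK hT.sw.χ).div (contDiffOn_const.mul hT.sw.χ) fun t ht =>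
        mul_ne_zero (by norm_num) (hχ0 t ht))
    have c3 := L (hT.sw.χ.mul (smooth_deriv hK hX))
    have c4 := L (hT.sw.χ.mul (smooth_deriv hK hY))
    have c5 : ContDiffOn ℝ n (fun t => η (t, q.2)) K₁ :=
      (contDiffOn_const (c := q.2.2).add (L hT.sv.ρ)).sub
        (contDiffOn_const (c := ν).mul (contDiffOn_const (c := q.2.1).add (L hT.sv.χ)))
    refine ContDiffOn.div ?_ (c5.pow 3) fun t ht => pow_ne_zero 3 (hη (t, q.2) ⟨ht, hqm.2⟩)
    simp only [g]
    exact ((((c1.add (c2.mul contDiffOn_const)).sub (contDiffOn_const.mul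
      ((c3.mul contDiffOn_const).add (c4.mul contDiffOn_const)))).add
      ((L hW₁).mul contDiffOn_const)).add ((L hW₂).mul contDiffOn_const)).add (L hW₀)
  refine LocallyKnown.of_cube (ν := ν) hK₁ ((hK₁K.trans hKJ).trans hJI) hA hB (hT.sw.χ.mono hK₁K)
    (fun t ht => (hpos t (hK₁K ht)).1) (hX.mono hK₁K) (hY.mono hK₁K) (hW₀.mono hK₁K)
    (hW₁.mono hK₁K) (hW₂.mono hK₁K) hVU hqm hn (hu.mono hVU) (fun r hr => hsol r (hVU hr)) hθ
    fun r hr => ?_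
  have ht := hK₁K hr.1
  have h0 := hχ0 r.1 ht
  rw [← key r hr, eX _ ht, eY _ ht, show r.2.2 - ν * r.2.1 + c.χ r.1 * (v.ρ r.1 / c.χ r.1 -
    ν * (v.χ r.1 / c.χ r.1)) = η r by simp only [η]; field_simp; ring]
  exact (div_mul_cancel₀ _ (pow_ne_zero 3 (hη r hr))).symm

theorem TypeB.locallyKnown {𝔰 : Submodule ℝ (Space → Space)} {n : ℕ∞} {I J : Set ℝ}
    {U : Set Base} {u : Base → ℝ} {q : Base} {v w : Coef} (hJ : IsOpen J) (hJI : J ⊆ I)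
    (hqJ : q.1 ∈ J) (h : TypeB 𝔰 J v w)
    (hdet : (q.2.1 + v.χ q.1) * w.ρ q.1 - w.χ q.1 * (q.2.2 + v.ρ q.1) ≠ 0)
    (hn : 3 ≤ n) (hU : IsOpen U) (hu : ContDiffOn ℝ n u U)
    (hsol : IsSolution U u) (hinv : IsInvariant U 𝔰 u) (hq : q ∈ U) : LocallyKnown n I U u q := by
  by_cases hχ : w.χ q.1 = 0
  · have hρ : w.ρ q.1 ≠ 0 := fun h0 => hdet (by rw [hχ, h0]; ring)
    refine LocallyKnown.of_swap (h.swap.locallyKnown_of_ne_zero (q := swapBase q) hJ hJI hqJ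
      (fun h0 => hdet ?_) hρ hn (hU.preimage swapBase.continuous)
      (hu.comp swapBase.contDiff.contDiffOn fun _ hr => hr) (hsol.swap hn hU hu) hinv.swap hq)
    simp only [Coef.swap, swapBase_apply] at h0
    linear_combination -h0
  · exact h.locallyKnown_of_ne_zero hJ hJI hqJ hdet hχ hn hU hu hsol hinv hq

end DN

/-! ### Travelling waves with a quadratic correction -/

namespace DN

open Set Filter Topology

/-- If `(α F'' + β) F''' = 0`, where `α` and `β` do not vanish simultaneously, then `F` is a
quadratic polynomial. -/
theorem exists_quadratic {S : Set ℝ} (hS : IsOpen S) (hS' : S.OrdConnected) {F F₁ F₂ F₃ : ℝ → ℝ}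
    (h₁ : ∀ s ∈ S, HasDerivAt F (F₁ s) s) (h₂ : ∀ s ∈ S, HasDerivAt F₁ (F₂ s) s)
    (h₃ : ∀ s ∈ S, HasDerivAt F₂ (F₃ s) s) {α β : ℝ} (hαβ : α ≠ 0 ∨ β ≠ 0)
    (h : ∀ s ∈ S, (α * F₂ s + β) * F₃ s = 0) :
    ∃ f₀ f₁ f₂ : ℝ, ∀ s ∈ S, F s = f₂ / 2 * s ^ 2 + f₁ * s + f₀ := by
  have hF₃ : ∀ s ∈ S, F₃ s = 0 := fun s hs => by
    by_cases hα : α = 0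
    · have := h s hs
      rw [hα, zero_mul, zero_add] at this
      exact (mul_eq_zero.1 this).resolve_left (hαβ.resolve_left (not_not_intro hα))
    have hφ : ∀ r ∈ S, HasDerivAt (fun r => α * F₂ r + β) (α * F₃ r) r := fun r hr =>
      ((h₃ r hr).const_mul α).add_const β
    by_contra h0
    have hz : α * F₂ s + β = 0 := (mul_eq_zero.1 (h s hs)).resolve_right h0
    -- The square of `αF'' + β` has zero derivative, hence is constant. Being zero at `s`, it is
    -- zero throughout `S`; then `αF''' = 0` at `s`, a contradiction. Continuity of `F'''` is not
    -- needed.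
    have hz' : ∀ r ∈ S, α * F₂ r + β = 0 := fun r hr => by
      have := eq_of_hasDerivAt_zero hS' (f := fun r => (α * F₂ r + β) ^ 2) (fun r hr =>
        ((hφ r hr).pow 2).congr_deriv (by push_cast; linear_combination 2 * α * h r hr)) hr hs
      simp only [hz] at this
      simpa using this
    have h1 := (hφ s hs).unique ((hasDerivAt_const s 0).congr_of_eventuallyEq
      (eventuallyEq_of_mem (hS.mem_nhds hs) hz'))
    exact h0 ((mul_eq_zero.1 h1).resolve_left hα)
  rcases S.eq_empty_or_nonempty with rfl | ⟨s₀, hs₀⟩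
  · exact ⟨0, 0, 0, fun s hs => hs.elim⟩
  have e₂ : ∀ s ∈ S, F₂ s = F₂ s₀ := fun s hs =>
    eq_of_hasDerivAt_zero hS' (fun r hr => (h₃ r hr).congr_deriv (hF₃ r hr)) hs hs₀
  have e₁ : ∀ s ∈ S, F₁ s - F₂ s₀ * s = F₁ s₀ - F₂ s₀ * s₀ := fun s hs =>
    eq_of_hasDerivAt_zero hS' (f := fun r => F₁ r - F₂ s₀ * r) (fun r hr =>
      ((h₂ r hr).sub ((hasDerivAt_id r).const_mul (F₂ s₀))).congr_deriv (by rw [e₂ r hr]; ring))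
      hs hs₀
  set f₁ := F₁ s₀ - F₂ s₀ * s₀
  have e₀ : ∀ s ∈ S, F s - (F₂ s₀ / 2 * s ^ 2 + f₁ * s) = F s₀ - (F₂ s₀ / 2 * s₀ ^ 2 + f₁ * s₀) :=
    fun s hs => eq_of_hasDerivAt_zero hS' (f := fun r => F r - (F₂ s₀ / 2 * r ^ 2 + f₁ * r))
      (fun r hr => ((h₁ r hr).sub ((((hasDerivAt_id r).pow 2).const_mul (F₂ s₀ / 2)).add
        ((hasDerivAt_id r).const_mul f₁))).congr_deriv (by
          push_cast
          simp only [id]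
          linear_combination e₁ r hr)) hs hs₀
  exact ⟨F s₀ - (F₂ s₀ / 2 * s₀ ^ 2 + f₁ * s₀), f₁, F₂ s₀, fun s hs => by
    linear_combination e₀ s hs⟩

/-- Equivalence of solutions that are, up to equivalence, of the form
`F(y - ν x) + M (x y - ν x² / 2)`. -/
theorem LocallyKnown.of_wave {n : ℕ∞} {I K S : Set ℝ} {U V : Set Base} {u : Base → ℝ} {q : Base}
    {χ ξ η w₀ w₁ w₂ F : ℝ → ℝ} {ν M : ℝ} (hK : IsOpen K) (hK' : K.OrdConnected) (hKI : K ⊆ I)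
    (hS : IsOpen S) (hS' : S.OrdConnected)
    (hχ : ContDiffOn ℝ ∞ χ K) (hpos : ∀ t ∈ K, 0 < χ t) (hξ : ContDiffOn ℝ ∞ ξ K)
    (hη : ContDiffOn ℝ ∞ η K) (hw₀ : ContDiffOn ℝ ∞ w₀ K) (hw₁ : ContDiffOn ℝ ∞ w₁ K)
    (hw₂ : ContDiffOn ℝ ∞ w₂ K) (hV : IsOpen V) (hVU : V ⊆ U) (hq : q ∈ V) (hn : 3 ≤ n)
    (hVK : ∀ r ∈ V, r.1 ∈ K)
    (hVS : ∀ r ∈ V, (χ r.1)⁻¹ * (r.2.2 - ν * r.2.1) + (η r.1 - ν * ξ r.1) ∈ S)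
    (hSV : ∀ s ∈ S, (q.1, q.2.1, ν * q.2.1 + χ q.1 * (s - (η q.1 - ν * ξ q.1))) ∈ V)
    (hu : ContDiffOn ℝ n u V) (hsol : IsSolution V u) (hF : ContDiffOn ℝ n F S)
    (hform : ∀ r ∈ V, u r + deriv χ r.1 / (6 * χ r.1) * (r.2.1 ^ 3 + r.2.2 ^ 3) -
      1 / 2 * (χ r.1 * deriv ξ r.1 * r.2.1 ^ 2 + χ r.1 * deriv η r.1 * r.2.2 ^ 2) +
      w₁ r.1 * r.2.1 + w₂ r.1 * r.2.2 + w₀ r.1 =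
        F ((χ r.1)⁻¹ * (r.2.2 - ν * r.2.1) + (η r.1 - ν * ξ r.1)) +
          M * ((r.2.1 / χ r.1 + ξ r.1) * (r.2.2 / χ r.1 + η r.1) -
            ν / 2 * (r.2.1 / χ r.1 + ξ r.1) ^ 2)) : LocallyKnown n I U u q := by
  have hχ0 : ∀ t ∈ K, χ t ≠ 0 := fun t ht => (hpos t ht).ne'
  -- These are the exceptional cases in which both `2ν(ν³ - 1)` and `M(1 - 2ν³)` vanish. The
  -- equation then imposes nothing on `F`, and `u` already has the form `w(t, y)` or `f(y - x)`.
  by_cases hcase : M = 0 ∧ (ν = 0 ∨ ν = 1)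
  · obtain ⟨hM, hν⟩ := hcase
    refine LocallyKnown.of_transf (V := V) (G := fun p => F (p.2.2 - ν * p.2.1)) hK hK' hKI hχ hpos
      hξ hη hw₀ hw₁ hw₂ hV hVU hVK hq (fun r hr => ?_) fun T S hS hmaps hST hS' => ?_
    · rw [hform r hr, hM, zero_mul, add_zero]
      congr 1
      ring
    rcases hν with rfl | rfl
    · refine Or.inl ⟨fun p => F p.2, hF.comp contDiffOn_snd ?_, fun p hp => by simp⟩
      rintro _ ⟨_, ⟨r, hr, rfl⟩, rfl⟩
      convert hVS r hr using 1
      simp only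
      ring
    · refine Or.inr (Or.inr (Or.inl ⟨F, hF.mono ?_, fun p hp => by simp⟩))
      rintro _ ⟨_, ⟨r, hr, rfl⟩, rfl⟩
      convert hVS r hr using 1
      simp only
      ring
  have hn1 : (1 : WithTop ℕ∞) ≤ n := by exact_mod_cast (le_trans (by norm_num) hn : 1 ≤ n)
  have D {f : ℝ → ℝ} (hf : ContDiffOn ℝ ∞ f K) {t : ℝ} (ht : t ∈ K) : HasDerivAt f (deriv f t) t :=
    smooth_hasDerivAt hK hf ht
  have D' {f : ℝ → ℝ} (hf : ContDiffOn ℝ ∞ f K) {t : ℝ} (ht : t ∈ K) : DifferentiableAt ℝ f t :=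
    (D hf ht).differentiableAt
  have hF3 : ContDiffOn ℝ (2 + 1) F S := hF.of_le (by
    have : ((3 : ℕ∞) : WithTop ℕ∞) ≤ n := WithTop.coe_le_coe.2 hn
    refine le_trans (le_of_eq ?_) this
    norm_num)
  obtain ⟨b1, -, b1'⟩ := (contDiffOn_succ_iff_deriv_of_isOpen hS).1 hF3
  rw [show (2 : WithTop ℕ∞) = 1 + 1 by norm_num] at b1'
  obtain ⟨b2, -, b2'⟩ := (contDiffOn_succ_iff_deriv_of_isOpen hS).1 b1'
  have b3 := b2'.differentiableOn (by simp)
  have B {f : ℝ → ℝ} (hf : DifferentiableOn ℝ f S) : ∀ s ∈ S, HasDerivAt f (deriv f s) s :=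
    fun s hs => (hf.differentiableAt (hS.mem_nhds hs)).hasDerivAt
  have hi := hχ.inv hχ0
  have di : ∀ t ∈ K, HasDerivAt (fun t => (χ t)⁻¹) (-deriv χ t / χ t ^ 2) t := fun t ht =>
    (D hχ ht).inv (hχ0 t ht)
  have hm : ContDiffOn ℝ ∞ (fun t => η t - ν * ξ t) K := hη.sub (contDiffOn_const.mul hξ)
  have hκ : ContDiffOn ℝ ∞ (fun t => -(deriv χ t / (6 * χ t))) K :=
    ((smooth_deriv hK hχ).div (contDiffOn_const.mul hχ) fun t ht =>
      mul_ne_zero (by norm_num) (hχ0 t ht)).neg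
  have h20 : ContDiffOn ℝ ∞ (fun t => 1 / 2 * (χ t * deriv ξ t) - M * ν / 2 * (χ t)⁻¹ ^ 2) K :=
    (contDiffOn_const.mul (hχ.mul (smooth_deriv hK hξ))).sub (contDiffOn_const.mul (hi.pow 2))
  have h02 : ContDiffOn ℝ ∞ (fun t => 1 / 2 * (χ t * deriv η t)) K :=
    contDiffOn_const.mul (hχ.mul (smooth_deriv hK hη))
  have h11 : ContDiffOn ℝ ∞ (fun t => M * (χ t)⁻¹ ^ 2) K := contDiffOn_const.mul (hi.pow 2)
  have h10 : ContDiffOn ℝ ∞ (fun t => M * (η t - ν * ξ t) * (χ t)⁻¹ - w₁ t) K :=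
    ((contDiffOn_const.mul hm).mul hi).sub hw₁
  have h01 : ContDiffOn ℝ ∞ (fun t => M * ξ t * (χ t)⁻¹ - w₂ t) K :=
    ((contDiffOn_const.mul hξ).mul hi).sub hw₂
  have h00 : ContDiffOn ℝ ∞ (fun t => M * (ξ t * η t - ν / 2 * ξ t ^ 2) - w₀ t) K :=
    (contDiffOn_const.mul ((hξ.mul hη).sub (contDiffOn_const.mul (hξ.pow 2)))).sub hw₀
  -- The equation is evaluated only at points with the `t` and `x` of `q`. By `hSV` these realize
  -- every `s ∈ S`, so an ordinary differential equation for `F` on the whole of `S` results.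
  obtain ⟨f₀, f₁, f₂, hf⟩ := exists_quadratic hS hS' (B b1) (B b2) (B b3)
    (α := 2 * ν * (ν ^ 3 - 1)) (β := M * (1 - 2 * ν ^ 3)) (by
      by_contra! h0
      obtain ⟨h1, h2⟩ := h0
      have h3 : ν = 0 ∨ ν = 1 := by
        rcases mul_eq_zero.1 h1 with h | h
        · left; linarith
        · right
          have : (ν - 1) * (ν ^ 2 + ν + 1) = 0 := by linear_combination h
          rcases mul_eq_zero.1 this with h | h
          · linarith
          · nlinarith [sq_nonneg (ν + 1 / 2)]
      refine hcase ⟨?_, h3⟩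
      rcases h3 with rfl | rfl <;> linarith) fun s hs => by
    have ht := hVK q hq
    have h0 := hχ0 _ ht
    have harg : (χ q.1)⁻¹ * (ν * q.2.1 + χ q.1 * (s - (η q.1 - ν * ξ q.1)) - ν * q.2.1) +
        (η q.1 - ν * ξ q.1) = s := by
      field_simp
      ring
    have key := hsol.cubic_add_comp hV (hu.of_le (by exact_mod_cast hn))
      (P := ⟨fun t => -(deriv χ t / (6 * χ t)), 0, 0, fun t => -(deriv χ t / (6 * χ t)),
        fun t => 1 / 2 * (χ t * deriv ξ t) - M * ν / 2 * (χ t)⁻¹ ^ 2, fun t => M * (χ t)⁻¹ ^ 2,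
        fun t => 1 / 2 * (χ t * deriv η t), fun t => M * (η t - ν * ξ t) * (χ t)⁻¹ - w₁ t,
        fun t => M * ξ t * (χ t)⁻¹ - w₂ t, fun t => M * (ξ t * η t - ν / 2 * ξ t ^ 2) - w₀ t⟩)
      (fun r hr => have hr := hVK r hr
        ⟨D' hκ hr, differentiableAt_const 0, differentiableAt_const 0, D' hκ hr, D' h20 hr,
        D' h11 hr, D' h02 hr, D' h10 hr, D' h01 hr, D' h00 hr⟩)
      (fun r hr => (di _ (hVK r hr)).differentiableAt) (fun r hr => D' hm (hVK r hr)) (ν := ν) hVS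
      (B b1) (B b2) (B b3) (fun r hr => by
        have h0 := hχ0 _ (hVK r hr)
        simp only [Cubic.eval, Pi.zero_apply]
        linear_combination hform r hr) (hSV s hs) (congrArg _ harg) (congrArg _ harg) rfl rfl rfl
    have d1 : deriv (fun t => M * (χ t)⁻¹ ^ 2) q.1 = -2 * M * deriv χ q.1 / χ q.1 ^ 3 := by
      refine (((di _ ht).pow 2).const_mul M).deriv.trans ?_
      norm_num
      field_simp
    have d2 : deriv (fun t => η t - ν * ξ t) q.1 = deriv η q.1 - ν * deriv ξ q.1 :=
      ((D hη ht).sub ((D hξ ht).const_mul ν)).deriv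
    simp only [d1, d2, (di _ ht).deriv, Pi.zero_apply,
      show deriv (0 : ℝ → ℝ) q.1 = 0 from deriv_const _ 0] at key
    field_simp at key
    linear_combination -key
  -- With quadratic `F` the solution is polynomial in `x`, `y` with smooth coefficients. The
  -- coefficient of `xy` is proportional to `χ⁻²`, and both cubic coefficients are `-χ_t/(6χ)`,
  -- which agrees with `b_t = 6b(A + B)`.
  refine LocallyKnown.of_polynomial hK hKI hV hVU hVK hq hκ hκ
    (a := fun t => 1 / 2 * (χ t * deriv ξ t) - M * ν / 2 * (χ t)⁻¹ ^ 2 +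
      f₂ * ν ^ 2 / 2 * (χ t)⁻¹ ^ 2)
    (b := fun t => (M - ν * f₂) * (χ t)⁻¹ ^ 2)
    (c := fun t => 1 / 2 * (χ t * deriv η t) + f₂ / 2 * (χ t)⁻¹ ^ 2)
    (d := fun t => M * (η t - ν * ξ t) * (χ t)⁻¹ - w₁ t +
      -ν * ((χ t)⁻¹ * (f₂ * (η t - ν * ξ t) + f₁)))
    (e := fun t => M * ξ t * (χ t)⁻¹ - w₂ t + (χ t)⁻¹ * (f₂ * (η t - ν * ξ t) + f₁))
    (g := fun t => M * (ξ t * η t - ν / 2 * ξ t ^ 2) - w₀ t + (f₂ / 2 * (η t - ν * ξ t) ^ 2 +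
      f₁ * (η t - ν * ξ t) + f₀))
    (h20.add (contDiffOn_const.mul (hi.pow 2))) (contDiffOn_const.mul (hi.pow 2))
    (h02.add (contDiffOn_const.mul (hi.pow 2)))
    (h10.add (contDiffOn_const.mul (hi.mul ((contDiffOn_const.mul hm).add contDiffOn_const))))
    (h01.add (hi.mul ((contDiffOn_const.mul hm).add contDiffOn_const)))
    (h00.add (((contDiffOn_const.mul (hm.pow 2)).add (contDiffOn_const.mul hm)).add
      contDiffOn_const)) (fun t ht => ?_) fun r hr => ?_
  · have h0 := hχ0 t ht
    refine (((di _ ht).pow 2).const_mul (M - ν * f₂)).deriv.trans ?_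
    norm_num
    field_simp
    ring
  · have h1 := hform r hr
    rw [hf _ (hVS r hr)] at h1
    linear_combination h1

end DN

/-! ### Invariant solutions of type C -/

namespace DN

open Set Filter Topology

/-- Invariance under the straightened `A` and `W` means that the transformed `u` minus `M(xy -
νx²/2)` depends only on the common invariant `y - νx`. No restriction on `|ν|` is needed, so the
larger component need not be selected. -/
theorem TypeC.locallyKnown_of_ne_zero {𝔰 : Submodule ℝ (Space → Space)} {n : ℕ∞} {I J : Set ℝ}
    {U : Set Base} {u : Base → ℝ} {q : Base} {a w : Coef} (hJ : IsOpen J) (hJI : J ⊆ I)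
    (hqJ : q.1 ∈ J) (h : TypeC 𝔰 J a w) (haτ : a.τ q.1 = 1) (hχ : w.χ q.1 ≠ 0)
    (hn : 3 ≤ n) (hU : IsOpen U) (hu : ContDiffOn ℝ n u U)
    (hsol : IsSolution U u) (hinv : IsInvariant U 𝔰 u) (hq : q ∈ U) : LocallyKnown n I U u q := by
  obtain ⟨K, hKJ, hK, hK', htK, a, c, M, hN⟩ := h.normalize hJ hqJ haτ hχ
  set ν := w.ρ q.1 / w.χ q.1
  clear h haτ
  obtain ⟨ξ, η, w₀, w₁, w₂, hξ, hη, hw₀, hw₁, hw₂, dξ, dη, d₁, d₂, d₀, es⟩ :=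
    hN.exists_parameters hK hK'
  have hn1 : 1 ≤ n := le_trans (by norm_num) hn
  have hne : ∀ t ∈ K, c.χ t ≠ 0 := fun t ht => (hN.pos t ht).ne'
  have D {f : ℝ → ℝ} (hf : ContDiffOn ℝ ∞ f K) {t : ℝ} (ht : t ∈ K) : HasDerivAt f (deriv f t) t :=
    smooth_hasDerivAt hK hf ht
  have hd : ∀ r ∈ U, DifferentiableAt ℝ u r := fun r hr => differentiableAt_of_contDiffOn hU hu hn1 hr
  set m : ℝ → ℝ := fun t => η t - ν * ξ t
  have hm : ContDiffOn ℝ ∞ m K := hη.sub (contDiffOn_const.mul hξ)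
  have dm : ∀ t ∈ K, HasDerivAt m (-((a.ρ t - ν * a.χ t) / c.χ t ^ 4)) t := fun t ht => by
    refine ((D hη ht).sub ((D hξ ht).const_mul ν)).congr_deriv ?_
    rw [dξ t ht, dη t ht]
    ring
  set f : Base → ℝ := fun r => u r + deriv c.χ r.1 / (6 * c.χ r.1) * (r.2.1 ^ 3 + r.2.2 ^ 3) +
    1 / 2 * (a.χ r.1 / c.χ r.1 ^ 3 * r.2.1 ^ 2 + a.ρ r.1 / c.χ r.1 ^ 3 * r.2.2 ^ 2) +
    w₁ r.1 * r.2.1 + w₂ r.1 * r.2.2 + w₀ r.1 - M * ((r.2.1 * (c.χ r.1)⁻¹ + ξ r.1) *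
      (r.2.2 * (c.χ r.1)⁻¹ + η r.1) - ν / 2 * (r.2.1 * (c.χ r.1)⁻¹ + ξ r.1) ^ 2)
  -- The chain rule for `f` along an arbitrary curve in the base; it is applied to the coordinate
  -- lines of `t` and `x` at fixed `s`.
  have curve {τ x y : ℝ → ℝ} {s α b e : ℝ} {r : Base} (hτ : HasDerivAt τ α s) (hx : HasDerivAt x b s)
      (hy : HasDerivAt y e s) (hs : (τ s, x s, y s) = r) (hr : r ∈ U) (ht : r.1 ∈ K) :
      HasDerivAt (fun σ => f (τ σ, x σ, y σ)) (α * dt u r + b * dx u r +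
        e * dy u r + (deriv (deriv c.χ) r.1 * c.χ r.1 - deriv c.χ r.1 ^ 2) /
          (6 * c.χ r.1 ^ 2) * α * (r.2.1 ^ 3 + r.2.2 ^ 3) + deriv c.χ r.1 / (6 * c.χ r.1) *
          (3 * r.2.1 ^ 2 * b + 3 * r.2.2 ^ 2 * e) +
        1 / 2 * ((deriv a.χ r.1 * c.χ r.1 - 3 * a.χ r.1 * deriv c.χ r.1) / c.χ r.1 ^ 4 *
          α * r.2.1 ^ 2 + a.χ r.1 / c.χ r.1 ^ 3 * (2 * r.2.1 * b) +
          (deriv a.ρ r.1 * c.χ r.1 - 3 * a.ρ r.1 * deriv c.χ r.1) / c.χ r.1 ^ 4 *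
          α * r.2.2 ^ 2 + a.ρ r.1 / c.χ r.1 ^ 3 * (2 * r.2.2 * e)) +
        deriv w₁ r.1 * α * r.2.1 + w₁ r.1 * b + deriv w₂ r.1 * α * r.2.2 + w₂ r.1 * e +
        deriv w₀ r.1 * α - M * ((b / c.χ r.1 - r.2.1 * deriv c.χ r.1 * α / c.χ r.1 ^ 2 -
          a.χ r.1 / c.χ r.1 ^ 4 * α) * (r.2.2 / c.χ r.1 + η r.1) +
          (r.2.1 / c.χ r.1 + ξ r.1) * (e / c.χ r.1 - r.2.2 * deriv c.χ r.1 * α /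
          c.χ r.1 ^ 2 - a.ρ r.1 / c.χ r.1 ^ 4 * α) - ν * (r.2.1 / c.χ r.1 + ξ r.1) *
          (b / c.χ r.1 - r.2.1 * deriv c.χ r.1 * α / c.χ r.1 ^ 2 -
          a.χ r.1 / c.χ r.1 ^ 4 * α))) s := by
    subst hs
    simp only at ht ⊢
    have h0 := hne _ ht
    have L {f : ℝ → ℝ} (hf : ContDiffOn ℝ ∞ f K) : HasDerivAt (fun σ => f (τ σ)) (deriv f (τ s) * α) s :=
      (D hf ht).comp s hτ
    have hu' : HasDerivAt (fun σ => u (τ σ, x σ, y σ)) (α * dt u (τ s, x s, y s) +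
        b * dx u (τ s, x s, y s) + e * dy u (τ s, x s, y s)) s := by
      refine ((hd _ hr).hasFDerivAt.comp_hasDerivAt s (hτ.prodMk (hx.prodMk hy))).congr_deriv ?_
      rw [show ((α, b, e) : Base) = α • (1, 0, 0) + b • (0, 1, 0) + e • (0, 0, 1) by simp]
      simp only [map_add, map_smul, smul_eq_mul, dt, dx, dy]
    have hi : HasDerivAt (fun σ => (c.χ (τ σ))⁻¹) (-(deriv c.χ (τ s) * α) / c.χ (τ s) ^ 2) s :=
      (L hN.sw.χ).inv h0
    have hκ : HasDerivAt (fun σ => deriv c.χ (τ σ) / (6 * c.χ (τ σ)))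
        ((deriv (deriv c.χ) (τ s) * c.χ (τ s) - deriv c.χ (τ s) ^ 2) / (6 * c.χ (τ s) ^ 2) * α) s := by
      refine ((L (smooth_deriv hK hN.sw.χ)).div ((L hN.sw.χ).const_mul 6) (by simpa using h0)
        ).congr_deriv ?_
      field_simp
    have hQ {g : ℝ → ℝ} (hg : ContDiffOn ℝ ∞ g K) : HasDerivAt (fun σ => g (τ σ) / c.χ (τ σ) ^ 3)
        ((deriv g (τ s) * c.χ (τ s) - 3 * g (τ s) * deriv c.χ (τ s)) / c.χ (τ s) ^ 4 * α) s := by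
      refine ((L hg).div ((L hN.sw.χ).pow 3) (pow_ne_zero 3 h0)).congr_deriv ?_
      norm_num
      field_simp
    have hX : HasDerivAt (fun σ => x σ * (c.χ (τ σ))⁻¹ + ξ (τ σ)) (b / c.χ (τ s) -
        x s * deriv c.χ (τ s) * α / c.χ (τ s) ^ 2 - a.χ (τ s) / c.χ (τ s) ^ 4 * α) s := by
      refine ((hx.mul hi).add (L hξ)).congr_deriv ?_
      rw [dξ _ ht]
      ring
    have hY : HasDerivAt (fun σ => y σ * (c.χ (τ σ))⁻¹ + η (τ σ)) (e / c.χ (τ s) -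
        y s * deriv c.χ (τ s) * α / c.χ (τ s) ^ 2 - a.ρ (τ s) / c.χ (τ s) ^ 4 * α) s := by
      refine ((hy.mul hi).add (L hη)).congr_deriv ?_
      rw [dη _ ht]
      ring
    refine (((((((hu'.add (hκ.mul ((hx.pow 3).add (hy.pow 3)))).add ((((hQ hN.sa.χ).mul
      (hx.pow 2)).add ((hQ hN.sa.ρ).mul (hy.pow 2))).const_mul (1 / 2))).add
      ((L hw₁).mul hx)).add ((L hw₂).mul hy)).add (L hw₀)).sub
      (((hX.mul hY).sub ((hX.pow 2).const_mul (ν / 2))).const_mul M))).congr_deriv ?_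
    simp only [Pi.add_apply, Pi.pow_apply]
    push_cast
    ring
  -- the coordinates `s = k (y - ν x) + m`, `t`, `x`
  set ψ : Base → Base := fun p => (p.2.1, p.2.2, ν * p.2.2 + c.χ p.2.1 * (p.1 - m p.2.1))
  have hΩ : IsOpen {p : Base | p.2.1 ∈ K} := hK.preimage (continuous_fst.comp continuous_snd)
  have hψ : ContinuousOn ψ {p : Base | p.2.1 ∈ K} := by
    have h1 : ContinuousOn (fun p : Base => c.χ p.2.1) {p : Base | p.2.1 ∈ K} :=
      hN.sw.χ.continuousOn.comp (by fun_prop) fun p hp => hp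
    have h2 : ContinuousOn (fun p : Base => m p.2.1) {p : Base | p.2.1 ∈ K} :=
      hm.continuousOn.comp (by fun_prop) fun p hp => hp
    exact ContinuousOn.prodMk (by fun_prop) (ContinuousOn.prodMk (by fun_prop)
      (ContinuousOn.add (by fun_prop) (h1.mul (ContinuousOn.sub (by fun_prop) h2))))
  have hψr : ∀ r : Base, r.1 ∈ K →
      ψ ((c.χ r.1)⁻¹ * (r.2.2 - ν * r.2.1) + m r.1, r.1, r.2.1) = r := fun r hr => by
    have h0 := hne _ hr
    refine Prod.ext rfl (Prod.ext rfl ?_)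
    simp only [ψ]
    field_simp
    ring
  set s₀ := (c.χ q.1)⁻¹ * (q.2.2 - ν * q.2.1) + m q.1
  obtain ⟨S, K₁, A, hS, hS', hK₁, hK₁', hA, hA', hqm, hsub⟩ :=
    exists_box (q := (s₀, q.1, q.2.1)) (hψ.isOpen_inter_preimage hΩ hU)
      ⟨htK, by rw [mem_preimage, hψr q htK]; exact hq⟩
  have hK₁K : K₁ ⊆ K := fun t ht =>
    (hsub (show (s₀, t, q.2.1) ∈ S ×ˢ K₁ ×ˢ A from ⟨hqm.1, ht, hqm.2.2⟩)).1
  have hbU : ∀ p ∈ S ×ˢ K₁ ×ˢ A, ψ p ∈ U := fun p hp => (hsub hp).2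
  -- The lemma on vanishing partial derivatives is used with `s` as the distinguished first
  -- coordinate, so `f` is a function of `s` alone.
  have key : ∀ p ∈ S ×ˢ K₁ ×ˢ A, f (ψ p) = f (ψ (p.1, q.1, q.2.1)) := fun p hp => by
    refine eq_of_partial_eq_zero (f := fun p => f (ψ p)) (K := S) hK₁' hA' (fun p hp => ?_)
      (fun p hp => ?_) hp hqm.2.1 hqm.2.2
    all_goals
      have hpU := hbU p hp
      have ht : (ψ p).1 ∈ K := hK₁K hp.2.1
      have h0 := hne _ ht
      have i1 := hN.ha.isInvariant hinv hpU ht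
      have i2 := hN.hw.isInvariant hinv hpU ht
      rw [graphPt, hN.fld_a hK ht] at i1
      rw [graphPt, hN.fld_w hK ht] at i2
      have e₃ := es _ ht
      have hβ : c.β (ψ p).1 * c.χ (ψ p).1 ^ 2 = M * c.χ (ψ p).1 - ν * a.ρ (ψ p).1 := by
        rw [hN.eβ _ ht]
        field_simp
      have hα := hN.eχ _ ht
    -- At fixed `s` and `x`, the direction of `∂_t`, multiplied by `χ³`, is that of `A` minus
    -- `(χ²χ_t x + χ_A)/χ` times `W`. This explains the multiples of the two invariance conditions
    -- in the final combination.
    · have hy : HasDerivAt (fun t => ν * p.2.2 + c.χ t * (p.1 - m t)) (deriv c.χ (ψ p).1 /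
          c.χ (ψ p).1 * ((ψ p).2.2 - ν * (ψ p).2.1) + (a.ρ (ψ p).1 - ν * a.χ (ψ p).1) /
          c.χ (ψ p).1 ^ 3) p.2.1 := by
        refine (((D hN.sw.χ ht).mul ((dm _ ht).const_sub p.1)).const_add _).congr_deriv ?_
        simp only [ψ] at h0 ⊢
        field_simp
        ring
      refine (curve (r := ψ p) (hasDerivAt_id p.2.1) (hasDerivAt_const p.2.1 p.2.2) hy rfl hpU
        ht).congr_deriv ?_
      have e₁ := d₁ _ ht
      have e₂ := d₂ _ ht
      have e₀ := d₀ _ ht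
      generalize ψ p = r at h0 i1 i2 e₁ e₂ e₀ e₃ hα hβ ⊢
      simp only at i1 i2
      field_simp at e₁ e₂ ⊢
      linear_combination -12 * c.χ r.1 ^ 3 * i1 + 12 * r.2.1 * e₁ + 12 * r.2.2 * e₂ +
        12 * c.χ r.1 ^ 3 * e₀ + 12 * (c.χ r.1 ^ 2 * deriv c.χ r.1 * r.2.1 + a.χ r.1) *
        (c.χ r.1 ^ 2 * i2 - c.χ r.1 ^ 2 * e₃ - r.2.1 * hα - r.2.2 * hβ)
    · have hy : HasDerivAt (fun x => ν * x + c.χ p.2.1 * (p.1 - m p.2.1)) ν p.2.2 :=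
        (((hasDerivAt_id p.2.2).const_mul ν).add_const _).congr_deriv (mul_one ν)
      refine (curve (r := ψ p) (hasDerivAt_const p.2.2 p.2.1) (hasDerivAt_id p.2.2) hy rfl hpU
        ht).congr_deriv ?_
      generalize ψ p = r at h0 i1 i2 e₃ hα hβ ⊢
      simp only at i1 i2
      field_simp
      linear_combination -12 * c.χ r.1 ^ 4 * i2 + 12 * c.χ r.1 ^ 4 * e₃ +
        12 * c.χ r.1 ^ 2 * (r.2.1 * hα + r.2.2 * hβ)
  have hV : IsOpen (Prod.fst ⁻¹' K₁ ∩ (fun r : Base => ((c.χ r.1)⁻¹ * (r.2.2 - ν * r.2.1) + m r.1,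
      r.1, r.2.1)) ⁻¹' (S ×ˢ K₁ ×ˢ A)) := by
    refine ContinuousOn.isOpen_inter_preimage ?_ (hK₁.preimage continuous_fst)
      (hS.prod (hK₁.prod hA))
    have h1 : ContinuousOn (fun r : Base => (c.χ r.1)⁻¹) (Prod.fst ⁻¹' K₁) :=
      (hN.sw.χ.inv hne).continuousOn.comp continuousOn_fst fun r hr => hK₁K hr
    have h2 : ContinuousOn (fun r : Base => m r.1) (Prod.fst ⁻¹' K₁) :=
      hm.continuousOn.comp continuousOn_fst fun r hr => hK₁K hr
    exact ContinuousOn.prodMk (ContinuousOn.add (h1.mul (by fun_prop)) h2) (by fun_prop)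
  set V : Set Base := Prod.fst ⁻¹' K₁ ∩ (fun r : Base => ((c.χ r.1)⁻¹ * (r.2.2 - ν * r.2.1) + m r.1,
    r.1, r.2.1)) ⁻¹' (S ×ˢ K₁ ×ˢ A)
  have hVU : V ⊆ U := fun r hr => by
    rw [← hψr r (hK₁K hr.1)]
    exact hbU _ hr.2
  have hF : ContDiffOn ℝ n (fun s => f (ψ (s, q.1, q.2.1))) S := by
    have c1 : ContDiff ℝ n fun s : ℝ => ψ (s, q.1, q.2.1) := by
      simp only [ψ]
      fun_prop
    have c2 : ContDiffOn ℝ n (fun s => u (ψ (s, q.1, q.2.1))) S :=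
      hu.comp c1.contDiffOn fun s hs => hbU _ ⟨hs, hqm.2⟩
    refine (((((c2.add ?_).add ?_).add ?_).add ?_).add ?_).sub ?_ <;>
      exact ContDiff.contDiffOn (by simp only [ψ]; fun_prop)
  refine LocallyKnown.of_wave (V := V) (ν := ν) (M := M) hK₁ hK₁' ((hK₁K.trans hKJ).trans hJI)
    hS hS' (hN.sw.χ.mono hK₁K) (fun t ht => hN.pos t (hK₁K ht)) (hξ.mono hK₁K) (hη.mono hK₁K)
    (hw₀.mono hK₁K) (hw₁.mono hK₁K) (hw₂.mono hK₁K) hV hVU ⟨hqm.2.1, hqm⟩ hn (fun r hr => hr.1)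
    (fun r hr => hr.2.1) (fun s hs => ⟨hqm.2.1, ?_, hqm.2⟩) (hu.mono hVU)
    (fun r hr => hsol r (hVU hr)) hF fun r hr => ?_
  · have h0 := hne _ htK
    convert hs using 1
    simp only [m]
    field_simp
    ring
  · have ht := hK₁K hr.1
    have h0 := hne _ ht
    have h1 := key _ hr.2
    rw [hψr r ht] at h1
    simp only at h1
    change _ = f (ψ ((c.χ r.1)⁻¹ * (r.2.2 - ν * r.2.1) + m r.1, q.1, q.2.1)) + _
    rw [← h1, dξ _ ht, dη _ ht]
    simp only [f]
    field_simp
    ring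

theorem TypeC.locallyKnown {𝔰 : Submodule ℝ (Space → Space)} {n : ℕ∞} {I J : Set ℝ}
    {U : Set Base} {u : Base → ℝ} {q : Base} {a w : Coef} (hJ : IsOpen J) (hJI : J ⊆ I)
    (hqJ : q.1 ∈ J) (h : TypeC 𝔰 J a w) (haτ : a.τ q.1 = 1) (hne : w.χ q.1 ≠ 0 ∨ w.ρ q.1 ≠ 0)
    (hn : 3 ≤ n) (hU : IsOpen U) (hu : ContDiffOn ℝ n u U)
    (hsol : IsSolution U u) (hinv : IsInvariant U 𝔰 u) (hq : q ∈ U) : LocallyKnown n I U u q := by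
  rcases hne with hχ | hρ
  · exact h.locallyKnown_of_ne_zero hJ hJI hqJ haτ hχ hn hU hu hsol hinv hq
  · exact LocallyKnown.of_swap (h.swap.locallyKnown_of_ne_zero (q := swapBase q) hJ hJI hqJ haτ hρ
      hn (hU.preimage swapBase.continuous)
      (hu.comp swapBase.contDiff.contDiffOn fun _ hr => hr) (hsol.swap hn hU hu) hinv.swap hq)

end DN

/-! ### The theorem: each rank-three point is handled through its type -/

theorem mainTheorem4 (I : Set ℝ) (hI : IsOpen I) (hI' : I.OrdConnected)
    (𝔰 : Submodule ℝ (DN.Space → DN.Space)) (h𝔰 : DN.IsSubalgebra I 𝔰)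
    (hdim : Module.finrank ℝ 𝔰 = 3) :
    DN.rank I 𝔰 < 3 ∨
    (DN.rank I 𝔰 = 3 ∧
      -- near each value of `t` at which the rank is attained, `𝔰` contains a treated subalgebra
      (∀ p ∈ DN.strip I, DN.rankAt 𝔰 p = 3 →
        ∃ (J J' : Set ℝ) (Φ : DN.Space → DN.Space), p.1 ∈ J ∧ J ⊆ I ∧ DN.PointSym J J' Φ ∧
          DN.ContainsTreated J J' Φ 𝔰) ∧
      -- invariant solutions are locally equivalent to elements of the constructed families
      (∀ (n : ℕ∞) (U : Set DN.Base) (u : DN.Base → ℝ), 3 ≤ n → IsOpen U → (∀ q ∈ U, q.1 ∈ I) →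
        ContDiffOn ℝ n u U → DN.IsSolution U u → DN.IsInvariant U 𝔰 u →
        ∀ q ∈ U, DN.rankAt 𝔰 (DN.graphPt u q) = 3 →
          ∃ (J J' : Set ℝ) (Φ : DN.Space → DN.Space) (V : Set DN.Base) (u' : DN.Base → ℝ),
            J ⊆ I ∧ DN.PointSym J J' Φ ∧ IsOpen V ∧ q ∈ V ∧ V ⊆ U ∧ (∀ r ∈ V, r.1 ∈ J) ∧
            DN.MapsGraph Φ V u u' ∧
            DN.IsKnownSolution n J' ((fun r => DN.base (Φ (DN.graphPt u r))) '' V) u')) := by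
  have hle : DN.rank I 𝔰 ≤ 3 := csSup_le' (by
    rintro _ ⟨p, -, rfl⟩
    exact DN.rankAt_le_three 𝔰 p)
  refine hle.lt_or_eq.imp_right fun h3 => ⟨h3, fun p hp hr => ?_, ?_⟩
  · obtain ⟨J, hJI, hJ, hJ', hpJ, ⟨e, v, w, h⟩ | ⟨v, w, h, hdet⟩ | ⟨a, w, h, haτ, hne⟩⟩ :=
      DN.exists_type hI h𝔰 hdim hp hr
    · exact h.locallyTreated hJ hJ' hJI hpJ
    · refine h.locallyTreated hJ hJI hpJ ?_
      by_contra! h0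
      exact hdet (by rw [h0.1, h0.2]; ring)
    · exact h.locallyTreated hJ hJI hpJ haτ hne
  · intro n U u hn hU hUI hu hsol hinv q hq hr
    obtain ⟨J, hJI, hJ, -, hpJ, ⟨e, v, w, h⟩ | ⟨v, w, h, hdet⟩ | ⟨a, w, h, haτ, hne⟩⟩ :=
      DN.exists_type hI h𝔰 hdim (p := DN.graphPt u q) (hUI q hq) hr
    · exact h.locallyKnown hJ hJI hpJ hn hU hu hsol hinv hq
    · exact h.locallyKnown hJ hJI hpJ hdet hn hU hu hsol hinv hq
    · exact h.locallyKnown hJ hJI hpJ haτ hne hn hU hu hsol hinv hq
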